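/- Let $n\ge 2$, $G=\mathbb{Z}_n$, and let $\rho:G\to\mathbb{C}^\times$ be a faithful one-dimensional representation. For $N\ge1$ let $B_N=[-N,N]^4\cap\mathbb{Z}^4$, and let $C_k(B_N)$ be the set of oriented $k$-cells of the cubical lattice $\mathbb{Z}^4$ all of whose corners lie in $B_N$ (edges for $k=1$, plaquettes for $k=2$; both orientations). A spin configuration is a map $\sigma:C_1(B_N)\to G$ with $\sigma(-e)=-\sigma(e)$, extended linearly to integer $1$-chains; $d\sigma(p)=\sigma(\partial p)$. For $\beta\ge 0$ let $\mu_{N,\beta}(\sigma)$ be the probability proportional to $\exp\bigl(\beta\sum_{p\in C_2(B_N)}\Re\rho(d\sigma(p))\bigr)$, with expectation $\mathbb{E}_{N,\beta}$. A generalized loop is an integer $1$-chain $\gamma$ in $\mathbb{Z}^4$ with finite support, coefficients in $\{-1,0,1\}$ and $\partial\gamma=0$; $W_\gamma(\sigma)=\rho(\sigma(\gamma))$. Let $\ell=|\operatorname{supp}\gamma|$ be its number of edges, and let $\ell_c$ be its number of corner edges, i.e. of edges of $\gamma$ that lie in a common plaquette with another edge of $\gamma$. Put $$\theta(\beta)=\frac{\sum_{g\in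 G}\rho(g)e^{12\beta\Re\rho(g)}}{\sum_{g\in G}e^{12\beta\Re\rho(g)}}\in\mathbb{R},\qquad \lambda(\beta)=\max_{g\ne0}e^{\beta(\Re\rho(g)-1)} .$$ Let $\beta_0>0$ be such that $5(|G|-1)\lambda(\beta)^2<1$ for all $\beta>\beta_0$. For $\beta>\beta_0$ and $M\ge 1$ let $$K_0^{(M)}=\frac{5^M(|G|-1)^M}{1-5(|G|-1)\lambda(\beta)^2},\qquad K^*=\sup_{\beta'>\beta_0}(1-\theta(\beta'))\lambda(\beta')^{-12}.$$ Let $b$ be the smallest integer such that, for all $N'\ge 1$ and $n'\ge2$, every closed $\mathbb{Z}_{n'}$-valued $2$-form $\nu$ on $B_{N'}$ that is irreducible (no restriction of $\nu$ to a nonempty proper orientation-symmetric subset of its support is closed), and whose support has at most $48$ oriented plaquettes, is supported in a cube of width $b$. Let $K_1$ be the least (universal) constant such that, for every generalized loop $\gamma'$ and every integer $2$-chain $q$ with $\partial q=\gamma'$, at most $K_1|\operatorname{supp}\gamma'|$ plaquettes of $\operatorname{supp}q$ lie in a cube of width $b+2$ that meets $\gamma'$. Set $$C_A=\frac{7K_0^{(6)}}{2K^*}+\frac{2K_1K_0^{(7)}}{K^*}+\frac{5K_0^{(25)}}{2^3(K^*)^4}+\frac92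 .$$ Let $\gamma$ be a generalized loop, and let $N$ be so large that $\operatorname{supp}\gamma\subseteq C_1(B_N)$, that $B_N$ contains a cube of width $\ell$ which contains $\gamma$, and that every plaquette of $\mathbb{Z}^4$ having an edge of $\gamma$ in its boundary lies in $B_N$. Then, for all $\beta>\beta_0$, $$\bigl|\mathbb{E}_{N,\beta}[W_\gamma]-e^{-\ell(1-\theta(\beta))}\bigr|\le C_A\,e^{2K^*\ell\lambda(\beta)^{12}}\Bigl[\sqrt{\ell_c/\ell}+\lambda(\beta)^2\Bigr].$$ (For the empty loop, $\ell=0$, the quotient $\ell_c/\ell$ is read as $0$.) -/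

import Mathlib

namespace LatticeGauge

noncomputable section

/-! ### The cell complex of `ℤ⁴` -/

/-- A positively oriented `k`-cell of `ℤ⁴`: the base point `a` together with the set
`{j₁ < ⋯ < j_k}` of its directions. An oriented `k`-cell is such a cell together with a sign. -/
abbrev Cell (k : ℕ) : Type := (Fin 4 → ℤ) × {S : Finset (Fin 4) // S.card = k}

/-- `k`-chains: finite formal sums of positively oriented `k`-cells with integer coefficients. -/
abbrev Chain (k : ℕ) : Type := Cell k →₀ ℤ

/-- The cell `c` is in `L ⊆ ℤ⁴` if all its corners are in `L`. -/
def Cell.IsIn {k : ℕ} (c : Cell k) (L : Set (Fin 4 → ℤ)) : Prop :=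
  ∀ T ⊆ c.2.1, (fun i => c.1 i + if i ∈ T then 1 else 0) ∈ L

/-- The face of `c` obtained by deleting the direction `j`, based at `x`. -/
def Cell.face {k : ℕ} (c : Cell (k + 1)) (j : {j : Fin 4 // j ∈ c.2.1}) (x : Fin 4 → ℤ) :
    Cell k :=
  (x, ⟨c.2.1.erase j.1, by rw [Finset.card_erase_of_mem j.2, c.2.2]; rfl⟩)

/-- The boundary of a positively oriented cell: if `j` is the `k'`-th direction of `c`, the face
without `j` based at `a` has sign `(-1)^k'`, and the one based at `a + e_j` has the opposite
sign. -/
def boundaryCell {k : ℕ} (c : Cell (k + 1)) : Chain k :=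
  ∑ j : {j : Fin 4 // j ∈ c.2.1},
    ((-1 : ℤ) ^ (c.2.1.filter (fun i => i < j.1)).card) •
      (Finsupp.single (c.face j (c.1 + Pi.single j.1 1)) 1 - Finsupp.single (c.face j c.1) 1)

/-- The boundary operator on chains, by linearity. -/
def boundary {k : ℕ} : Chain (k + 1) →ₗ[ℤ] Chain k :=
  Finsupp.linearCombination ℤ boundaryCell

/-- The box `B_N = [-N, N]⁴ ∩ ℤ⁴`. -/
def box (N : ℕ) : Finset (Fin 4 → ℤ) :=
  Finset.Icc (fun _ => -(N : ℤ)) (fun _ => (N : ℤ))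

/-- The cube of width `w` with lowest corner `a`. -/
def cube (a : Fin 4 → ℤ) (w : ℕ) : Set (Fin 4 → ℤ) :=
  {x | ∀ i, a i ≤ x i ∧ x i ≤ a i + w}

open Classical in
/-- The positively oriented `k`-cells in `B_N`. -/
def cells (k N : ℕ) : Finset (Cell k) :=
  (box N ×ˢ Finset.univ).filter (fun c => c.IsIn (box N : Set (Fin 4 → ℤ)))

/-! ### Discrete differential forms on `B_N` -/

/-- `G`-valued `k`-forms on `B_N`, given by their values on positively oriented cells. -/
abbrev Form (k N : ℕ) (G : Type) : Type := {c : Cell k // c ∈ cells k N} → G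

/-- The value of a form on a chain. -/
def Form.eval {k N : ℕ} {G : Type} [AddCommGroup G] (ω : Form k N G) (q : Chain k) : G :=
  ∑ c : {c : Cell k // c ∈ cells k N}, q c.1 • ω c

/-- The exterior derivative, `dω(c) = ω(∂c)`. -/
def Form.d {k N : ℕ} {G : Type} [AddCommGroup G] (ω : Form k N G) : Form (k + 1) N G :=
  fun c => ω.eval (boundaryCell c.1)

open Classical in
/-- The positively oriented cells on which `ω` does not vanish. The support of `ω` consists of
these cells and of their reversals, so it has twice as many elements. -/
def Form.posSupport {k N : ℕ} {G : Type} [AddCommGroup G] (ω : Form k N G) :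
    Finset {c : Cell k // c ∈ cells k N} :=
  Finset.univ.filter (fun c => ω c ≠ 0)

open Classical in
/-- The restriction `ω|_P` of `ω` to a set of cells (and their reversals). -/
def Form.restrict {k N : ℕ} {G : Type} [AddCommGroup G] (ω : Form k N G)
    (P : Finset {c : Cell k // c ∈ cells k N}) : Form k N G :=
  fun c => if c ∈ P then ω c else 0

/-- A closed form is irreducible if no restriction to a nonempty proper subset of its support is
closed. -/
def Form.IsIrreducible {k N : ℕ} {G : Type} [AddCommGroup G] (ω : Form k N G) : Prop :=
  ω.d = 0 ∧ ∀ P : Finset {c : Cell k // c ∈ cells k N},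
    P.Nonempty → P ⊂ ω.posSupport → (ω.restrict P).d ≠ 0

/-! ### Lattice gauge theory with Wilson action -/

section Model

variable {n : ℕ} [NeZero n] (ρ : AddChar (ZMod n) ℂ)

/-- The Wilson action. The sum is over all plaquettes in `B_N` of both orientations. -/
def action {N : ℕ} (σ : Form 1 N (ZMod n)) : ℝ :=
  -∑ p : ℤˣ × {p : Cell 2 // p ∈ cells 2 N}, (ρ ((p.1 : ℤ) • σ.d p.2)).re

/-- The probability `μ_{N,β}(σ)`; the constant density of the uniform reference measure cancels
against the normalization. -/
def gibbs (N : ℕ) (β : ℝ) (σ : Form 1 N (ZMod n)) : ℝ :=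
  Real.exp (-β * action ρ σ) / ∑ τ : Form 1 N (ZMod n), Real.exp (-β * action ρ τ)

/-- The expectation `𝔼_{N,β}[f]`. -/
def expect (N : ℕ) (β : ℝ) (f : Form 1 N (ZMod n) → ℂ) : ℂ :=
  ∑ σ : Form 1 N (ZMod n), f σ * (gibbs ρ N β σ : ℂ)

/-- The Wilson loop observable `W_γ(σ) = ρ(σ(γ))`. -/
def wilson {N : ℕ} (γ : Chain 1) (σ : Form 1 N (ZMod n)) : ℂ :=
  ρ (σ.eval γ)

/-- The quotient of sums that defines `θ(β)`, as a complex number. -/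
def thetaC (β : ℝ) : ℂ :=
  (∑ g : ZMod n, ρ g * (Real.exp (12 * β * (ρ g).re) : ℂ)) /
    ∑ g : ZMod n, (Real.exp (12 * β * (ρ g).re) : ℂ)

/-- `θ(β)` as a real number; see `theta_eq`. -/
def theta (β : ℝ) : ℝ := (thetaC ρ β).re

/-- `thetaC` is real. -/
theorem theta_eq (β : ℝ) : (theta ρ β : ℂ) = thetaC ρ β := by
  have h : (starRingEnd ℂ) (thetaC ρ β) = thetaC ρ β := by
    unfold thetaC
    rw [map_div₀, map_sum, map_sum]
    congr 1
    · rw [← Equiv.sum_comp (Equiv.neg (ZMod n))]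
      refine Finset.sum_congr rfl fun g _ => ?_
      simp only [Equiv.neg_apply, map_mul, Complex.conj_ofReal, AddChar.map_neg_eq_conj,
        Complex.conj_conj, Complex.conj_re]
    · exact Finset.sum_congr rfl fun g _ => Complex.conj_ofReal _
  exact Complex.conj_eq_iff_re.mp h

/-- `λ(β) = max_{g ≠ 0} e^{β Re ρ(g)} / e^{β Re ρ(0)}`. -/
def lam (β : ℝ) : ℝ :=
  ⨆ g : {g : ZMod n // g ≠ 0}, Real.exp (β * (ρ g.1).re) / Real.exp (β * (ρ 0).re)

end Model

/-! ### Generalized loops -/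

/-- A generalized loop: a `1`-chain with coefficients in `{-1, 0, 1}` and empty boundary. -/
def IsGeneralizedLoop (γ : Chain 1) : Prop :=
  (∀ e, γ e = -1 ∨ γ e = 0 ∨ γ e = 1) ∧ boundary γ = 0

open Classical in
/-- The corner edges of `γ`: the edges of `γ` that share a plaquette with another edge of `γ`. -/
def cornerEdges (γ : Chain 1) : Finset (Cell 1) :=
  γ.support.filter (fun e => ∃ e' ∈ γ.support, e' ≠ e ∧
    ∃ p : Cell 2, boundaryCell p e ≠ 0 ∧ boundaryCell p e' ≠ 0)

/-! ### The constants -/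

/-- `b`: the smallest width such that every irreducible `ν ∈ Ω²₀(B_N, ℤ_n)` (for any `N ≥ 1` and
`n ≥ 2`) whose support has at most `2 · 24` elements is contained in a cube of that width. -/
def vortexWidth : ℕ :=
  sInf {w : ℕ | ∀ n N : ℕ, 2 ≤ n → 1 ≤ N → ∀ ν : Form 2 N (ZMod n), ν.IsIrreducible →
    2 * ν.posSupport.card ≤ 2 * 24 →
      ∃ a : Fin 4 → ℤ, ∀ p ∈ ν.posSupport, Cell.IsIn p.1 (cube a w)}

open Classical in
/-- For a surface `q`, the set `Q \ Q'` of the plaquettes in the support of `q` that are contained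
in some cube of width `b + 2` that meets `γ`. -/
def nearPlaquettes (γ : Chain 1) (q : Chain 2) : Finset (Cell 2) :=
  q.support.filter (fun p => ∃ a : Fin 4 → ℤ, p.IsIn (cube a (vortexWidth + 2)) ∧
    ∃ e ∈ γ.support, e.1 ∈ cube a (vortexWidth + 2) ∨
      e.1 + (fun i => if i ∈ e.2.1 then 1 else 0) ∈ cube a (vortexWidth + 2))

/-- `K₁`: the least constant with `|Q \ Q'| ≤ K₁ |supp γ|` for all generalized loops `γ` and all
oriented surfaces `q` with boundary `γ`. -/
def K1 : ℝ :=
  sInf {K : ℝ | ∀ (γ : Chain 1) (q : Chain 2), IsGeneralizedLoop γ → boundary q = γ →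
    ((nearPlaquettes γ q).card : ℝ) ≤ K * γ.support.card}

section Constants

variable {n : ℕ} [NeZero n] (ρ : AddChar (ZMod n) ℂ)

/-- `K₀^{(M)} = 5^M (|G|-1)^M / (1 - 5 (|G|-1) λ(β)²)`. -/
def K0 (M : ℕ) (β : ℝ) : ℝ :=
  (5 : ℝ) ^ M * ((n : ℝ) - 1) ^ M / (1 - 5 * ((n : ℝ) - 1) * lam ρ β ^ 2)

/-- `K* = sup_{β > β₀} (1 - θ(β)) λ(β)^{-12}`. -/
def Kstar (β₀ : ℝ) : ℝ :=
  ⨆ β : Set.Ioi β₀, (1 - theta ρ β) * (lam ρ β ^ 12)⁻¹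

/-- The constant `C_A`. -/
def CA (β₀ β : ℝ) : ℝ :=
  7 * K0 ρ 6 β / (2 * Kstar ρ β₀) + 2 * K1 * K0 ρ 7 β / Kstar ρ β₀ +
    5 * K0 ρ 25 β / (2 ^ 3 * Kstar ρ β₀ ^ 4) + 9 / 2

end Constants

end

end LatticeGauge

namespace LatticeGauge

noncomputable section

open Finsupp

/-! ### The total cell complex and its homotopy operators -/

/-! Let `q` be a surface with boundary `γ`. By Stokes the Wilson loop is `ρ(dσ(q))`, and `dσ` is a
closed 2-form, hence a sum of irreducible closed parts with disjoint supports, the vortices.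
Vortices are rare. A closed form with `m` plaquettes has a primitive by the Poincaré lemma
(`Form.exists_d_eq`), and subtracting it from `σ` shows that the form occurs in `dσ` with
probability at most `λ^(2m)` (`prob_agree_le`). At most `(5(n-1))^m` irreducible forms of size `m`
contain a given plaquette, so a geometric series bounds the probability of a vortex of size at least
`M` there by `K₀^(M) λ^(2M)` (`prob_vortexEvent_le`). Sizes count positively oriented plaquettes.

A vortex of size at most 6 through a plaquette away from the boundary of the box is `d(g 1_e)` for a
single edge `e` (`Form.eq_single_d_of_card_le`); its value on `q` is `γ(e) g`. A vortex of size at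
most 24 lies in a cube of width `b`; if the cube, enlarged by one on each side, misses `γ`, its
value on `q` is zero (`Form.eval_eq_zero_of_far`), because in dimension four a loop that avoids a
cube can be swept away without crossing it. What is left are vortices of size at least 7 close to
`γ`, vortices of size at least 25 anywhere on `q`, and nontrivial minimal vortices around corner
edges. These have probabilities of order `K₁ ℓ λ^14`, `ℓ⁴ λ^50` (`exists_surface` gives a `q` with
at most `ℓ⁴` plaquettes) and `ℓ_c λ^12`. Outside these events the Wilson loop is the product of
`ρ(γ(e) g_e)` over the non-corner edges, where `g_e` is the common value of `dσ` around `e`, or zero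
if there is none (`eval_eq_sum_circ`).

A non-corner edge shares no plaquette with another edge of `γ`, so these spins can be integrated out
one at a time. If `dσ` has a common value around `e`, moving the spin at `e` moves this value
through all of the group, with weight `exp(12 β Re ρ)` from six plaquettes in two orientations; the
average is `θ`. Hence the expectation is that of `θ^k` (`expect_straight`), where `k` counts the
edges with constant surroundings. Few edges fail to have them, so `θ^k` is close to `θ^ℓ`, which is
close to `e^{-ℓ(1-θ)}`. Powers of `ℓ λ^12` in the errors are absorbed by the exponential factor
(`error_terms_le`). -/

/-- A cell of any dimension: a base point and a set of directions. -/
abbrev TCell : Type := (Fin 4 → ℤ) × Finset (Fin 4)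

/-- Chains of mixed dimension. -/
abbrev TChain : Type := TCell →₀ ℤ

/-- The sign of the direction `j` in the boundary of a cell with directions `S`. -/
def dirSign (S : Finset (Fin 4)) (j : Fin 4) : ℤ := (-1) ^ (S.filter (fun i => i < j)).card

lemma dirSign_anticomm : ∀ (S : Finset (Fin 4)) (j k : Fin 4), j ∈ S → k ∈ S → j ≠ k →
    dirSign S j * dirSign (S.erase j) k = -(dirSign S k * dirSign (S.erase k) j) := by
  unfold dirSign; decide

/-- The sign rule that makes faces in direction `j` anticommute with the sweep in direction `k`; a
check over the sixteen sets of directions. -/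
lemma dirSign_insert : ∀ (S : Finset (Fin 4)) (j k : Fin 4), j ∈ S → k ∉ S →
    dirSign S j * dirSign (S.erase j) k = -(dirSign S k * dirSign (insert k S) j) := by
  unfold dirSign; decide

lemma dirSign_insert_self (S : Finset (Fin 4)) (k : Fin 4) :
    dirSign (insert k S) k = dirSign S k := by
  unfold dirSign
  rw [Finset.filter_insert, if_neg (lt_irrefl k)]

lemma dirSign_erase_self (S : Finset (Fin 4)) (k : Fin 4) :
    dirSign (S.erase k) k = dirSign S k := by
  unfold dirSign
  congr 2
  ext i
  simp only [Finset.mem_filter, Finset.mem_erase]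
  exact ⟨fun h => ⟨h.1.2, h.2⟩, fun h => ⟨⟨h.2.ne, h.1⟩, h.2⟩⟩

lemma dirSign_mul_self (S : Finset (Fin 4)) (k : Fin 4) : dirSign S k * dirSign S k = 1 := by
  unfold dirSign
  rw [← mul_pow]; norm_num

lemma dirSign_eq (S : Finset (Fin 4)) (k : Fin 4) : dirSign S k = 1 ∨ dirSign S k = -1 :=
  neg_one_pow_eq_or ℤ _

/-- The part of the boundary operator in direction `j`. -/
def tface (j : Fin 4) : TChain →ₗ[ℤ] TChain :=
  linearCombination ℤ fun c => if j ∈ c.2 then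
    dirSign c.2 j • (single (c.1 + Pi.single j 1, c.2.erase j) 1 - single (c.1, c.2.erase j) 1)
    else 0

/-- The boundary operator on chains of mixed dimension. -/
def tboundary : TChain →ₗ[ℤ] TChain := ∑ j, tface j

/-- The projection to the hyperplane `x_k = s`. -/
def proj (k : Fin 4) (s : ℤ) : TChain →ₗ[ℤ] TChain :=
  linearCombination ℤ fun c => if k ∈ c.2 then 0 else single (Function.update c.1 k s, c.2) 1

/-- The signed column of cells in direction `k` between level `s` and `x`. -/
def column (k : Fin 4) (s : ℤ) (x : Fin 4 → ℤ) (T : Finset (Fin 4)) : TChain :=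
  ∑ t ∈ Finset.Ico s (x k), single (Function.update x k t, T) 1 -
    ∑ t ∈ Finset.Ico (x k) s, single (Function.update x k t, T) 1

/-- The homotopy that sweeps a cell in direction `k` to the hyperplane `x_k = s`. -/
def sweep (k : Fin 4) (s : ℤ) : TChain →ₗ[ℤ] TChain :=
  linearCombination ℤ fun c => if k ∈ c.2 then 0 else dirSign c.2 k • column k s c.1 (insert k c.2)

lemma tface_single (j : Fin 4) (c : TCell) : tface j (single c 1) = if j ∈ c.2 then
    dirSign c.2 j • (single (c.1 + Pi.single j 1, c.2.erase j) 1 - single (c.1, c.2.erase j) 1)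
    else 0 := by
  simp [tface]

lemma proj_single (k : Fin 4) (s : ℤ) (c : TCell) : proj k s (single c 1) =
    if k ∈ c.2 then 0 else single (Function.update c.1 k s, c.2) 1 := by
  simp [proj]

lemma sweep_single (k : Fin 4) (s : ℤ) (c : TCell) : sweep k s (single c 1) =
    if k ∈ c.2 then 0 else dirSign c.2 k • column k s c.1 (insert k c.2) := by
  simp [sweep]

lemma tchain_hom_ext {M : Type*} [AddCommGroup M] {f g : TChain →ₗ[ℤ] M}
    (h : ∀ c, f (single c 1) = g (single c 1)) : f = g :=
  Finsupp.lhom_ext' fun c => LinearMap.ext_ring (h c)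

lemma update_add_single_of_ne {j k : Fin 4} (h : j ≠ k) (x : Fin 4 → ℤ) (t : ℤ) :
    Function.update (x + Pi.single j 1) k t = Function.update x k t + Pi.single j 1 := by
  ext i
  by_cases hi : i = k
  · subst hi; simp [Pi.single_eq_of_ne h.symm]
  · simp [Function.update_of_ne hi]

lemma update_add_single_self (k : Fin 4) (x : Fin 4 → ℤ) (t : ℤ) :
    Function.update (x + Pi.single k 1) k t = Function.update x k t := by
  ext i
  by_cases hi : i = k
  · subst hi; simp
  · simp [Function.update_of_ne hi, Pi.single_eq_of_ne hi]

lemma update_add_one (k : Fin 4) (x : Fin 4 → ℤ) (t : ℤ) :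
    Function.update x k t + Pi.single k 1 = Function.update x k (t + 1) := by
  ext i
  by_cases hi : i = k
  · subst hi; simp
  · simp [Function.update_of_ne hi, Pi.single_eq_of_ne hi]

lemma tface_anticomm {j k : Fin 4} (h : j ≠ k) : tface j ∘ₗ tface k = -(tface k ∘ₗ tface j) := by
  refine tchain_hom_ext fun c => ?_
  simp only [LinearMap.comp_apply, LinearMap.neg_apply, tface_single]
  by_cases hj : j ∈ c.2 <;> by_cases hk : k ∈ c.2
  · simp only [hj, hk, if_true, map_smul, map_sub, tface_single, Finset.mem_erase, h, h.symm, ne_eq,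
      not_false_eq_true, and_self]
    rw [Finset.erase_right_comm (a := j)]
    simp only [← smul_sub, smul_smul]
    rw [dirSign_anticomm _ _ _ hk hj h.symm, add_right_comm c.1]
    rw [neg_smul]
    congr 2
    abel
  · simp [hj, hk, tface_single]
  · simp [hj, hk, tface_single]
  · simp [hj, hk]

lemma tface_self (j : Fin 4) : tface j ∘ₗ tface j = 0 := by
  refine tchain_hom_ext fun c => ?_
  simp only [LinearMap.comp_apply, LinearMap.zero_apply, tface_single]
  split_ifs with hj
  · simp [tface_single]
  · simp

lemma tboundary_tboundary (z : TChain) : tboundary (tboundary z) = 0 := by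
  have h : ∀ j k : Fin 4, j ≠ k → tface j (tface k z) = -tface k (tface j z) := fun j k hjk => by
    simpa using LinearMap.congr_fun (tface_anticomm hjk) z
  have h' : ∀ j : Fin 4, tface j (tface j z) = 0 := fun j => by
    simpa using LinearMap.congr_fun (tface_self j) z
  simp only [tboundary, Fin.sum_univ_four, LinearMap.add_apply, map_add, h']
  rw [h 1 0 (by decide), h 2 0 (by decide), h 3 0 (by decide), h 2 1 (by decide),
    h 3 1 (by decide), h 3 2 (by decide)]
  abel

lemma tface_sweep_of_ne {j k : Fin 4} (h : j ≠ k) (s : ℤ) :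
    tface j ∘ₗ sweep k s + sweep k s ∘ₗ tface j = 0 := by
  refine tchain_hom_ext fun c => ?_
  simp only [LinearMap.comp_apply, LinearMap.add_apply, LinearMap.zero_apply, tface_single,
    sweep_single]
  by_cases hj : j ∈ c.2 <;> by_cases hk : k ∈ c.2
  · simp [hj, hk, sweep_single, h.symm]
  · simp only [hj, hk, if_true, if_false, map_smul, map_sub, sweep_single, Finset.mem_erase,
      and_false, column, map_sum, tface_single, Finset.mem_insert, or_true, Pi.add_apply,
      Pi.single_eq_of_ne h.symm, add_zero, update_add_single_of_ne h, ← smul_sub, ← Finset.smul_sum,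
      smul_smul, Finset.sum_sub_distrib]
    rw [dirSign_insert _ _ _ hj hk, Finset.erase_insert_of_ne h.symm, neg_smul, add_neg_eq_zero]
    congr 1
    abel
  · simp [hj, hk]
  · simp [hj, hk, column, tface_single, h]

/-- One of the two intervals is always empty; the difference is the oriented sum from `s` to `x`, so
the order of `s` and `x` plays no role. -/
lemma sum_Ico_telescope {M : Type*} [AddCommGroup M] (g : ℤ → M) (s x : ℤ) :
    (∑ t ∈ Finset.Ico s x, (g (t + 1) - g t)) - ∑ t ∈ Finset.Ico x s, (g (t + 1) - g t) =
      g x - g s := by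
  have key : ∀ (s : ℤ) (m : ℕ),
      ∑ t ∈ Finset.Ico s (s + m), (g (t + 1) - g t) = g (s + m) - g s := by
    intro s m
    induction m with
    | zero => simp
    | succ m ih =>
      have : Finset.Ico s (s + (m + 1 : ℕ)) = insert (s + m : ℤ) (Finset.Ico s (s + m)) := by
        ext t; simp only [Finset.mem_Ico, Finset.mem_insert]; push_cast; omega
      rw [this, Finset.sum_insert (by simp), ih]
      push_cast
      rw [← add_assoc]; abel
  rcases le_total s x with h | h
  · obtain ⟨m, rfl⟩ := Int.le.dest h
    rw [key, Finset.Ico_eq_empty (by omega)]; simp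
  · obtain ⟨m, rfl⟩ := Int.le.dest h
    rw [key, Finset.Ico_eq_empty (by omega)]; simp

lemma sum_Ico_add_one {M : Type*} [AddCommGroup M] (f : ℤ → M) (s x : ℤ) :
    (∑ t ∈ Finset.Ico s (x + 1), f t - ∑ t ∈ Finset.Ico (x + 1) s, f t) -
      (∑ t ∈ Finset.Ico s x, f t - ∑ t ∈ Finset.Ico x s, f t) = f x := by
  rcases lt_or_ge x s with h | h
  · rw [Finset.Ico_eq_empty (by omega : ¬ s < x + 1), Finset.Ico_eq_empty (by omega : ¬ s < x)]
    have : Finset.Ico x s = insert x (Finset.Ico (x + 1) s) := by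
      ext t; simp only [Finset.mem_Ico, Finset.mem_insert]; omega
    rw [this, Finset.sum_insert (by simp)]
    simp
  · rw [Finset.Ico_eq_empty (by omega : ¬ x + 1 < s), Finset.Ico_eq_empty (by omega : ¬ x < s)]
    have : Finset.Ico s (x + 1) = insert x (Finset.Ico s x) := by
      ext t; simp only [Finset.mem_Ico, Finset.mem_insert]; omega
    rw [this, Finset.sum_insert (by simp)]
    simp

lemma column_add_single (k : Fin 4) (s : ℤ) (x : Fin 4 → ℤ) (T : Finset (Fin 4)) :
    column k s (x + Pi.single k 1) T - column k s x T = single (x, T) 1 := by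
  simp only [column, update_add_single_self, Pi.add_apply, Pi.single_eq_same]
  rw [sum_Ico_add_one (fun t => (single (Function.update x k t, T) 1 : TChain))]
  simp

lemma tface_sweep_self (k : Fin 4) (s : ℤ) :
    tface k ∘ₗ sweep k s + sweep k s ∘ₗ tface k = LinearMap.id - proj k s := by
  refine tchain_hom_ext fun c => ?_
  simp only [LinearMap.comp_apply, LinearMap.add_apply, LinearMap.sub_apply, LinearMap.id_apply,
    tface_single, sweep_single, proj_single]
  by_cases hk : k ∈ c.2
  · simp only [hk, if_true, map_zero, map_smul, map_sub, sweep_single, Finset.notMem_erase, if_false,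
      ← smul_sub, smul_smul, column_add_single, dirSign_erase_self, dirSign_mul_self, one_smul,
      zero_add, sub_zero, Finset.insert_erase hk]
  · simp only [hk, if_false, map_smul, map_zero, add_zero, column, map_sub, map_sum, tface_single,
      Finset.mem_insert_self, if_true, Finset.erase_insert hk, ← Finset.smul_sum, ← smul_sub,
      smul_smul, dirSign_insert_self, dirSign_mul_self, one_smul, update_add_one]
    have := sum_Ico_telescope (fun t => (single (Function.update c.1 k t, c.2) 1 : TChain)) s (c.1 k)
    simpa using this

/-- Faces in directions `j ≠ k` anticommute with the sweep and cancel; in direction `k` the columns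
telescope. -/
lemma homotopy (k : Fin 4) (s : ℤ) (z : TChain) :
    tboundary (sweep k s z) + sweep k s (tboundary z) = z - proj k s z := by
  have h : ∀ j : Fin 4, j ≠ k → tface j (sweep k s z) + sweep k s (tface j z) = 0 := fun j hj => by
    simpa using LinearMap.congr_fun (tface_sweep_of_ne hj s) z
  have h' : tface k (sweep k s z) + sweep k s (tface k z) = z - proj k s z := by
    simpa using LinearMap.congr_fun (tface_sweep_self k s) z
  simp only [tboundary, LinearMap.sum_apply, map_sum]
  rw [← Finset.sum_add_distrib, Finset.sum_eq_single k (fun j _ hj => h j hj) (by simp), h']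

/-- Apply the boundary to the homotopy identity for `z` and compare with the identity for the
boundary of `z`: since `∂∂ = 0`, both have the same left-hand side. -/
lemma tboundary_proj (k : Fin 4) (s : ℤ) (z : TChain) :
    tboundary (proj k s z) = proj k s (tboundary z) := by
  have h1 := congrArg tboundary (homotopy k s z)
  have h2 := homotopy k s (tboundary z)
  rw [map_add, tboundary_tboundary, zero_add, map_sub] at h1
  rw [tboundary_tboundary, map_zero, add_zero, h1] at h2
  exact sub_right_injective h2

/-! ### The cone operator -/

/-- The composition of the projections to the hyperplanes `x_i = b_i`, `i < k`. -/
def projBelow (b : Fin 4 → ℤ) : ℕ → TChain →ₗ[ℤ] TChain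
  | 0 => LinearMap.id
  | m + 1 => if h : m < 4 then proj ⟨m, h⟩ (b ⟨m, h⟩) ∘ₗ projBelow b m else 0

/-- The cone with apex `b`. -/
def cone (b : Fin 4 → ℤ) : TChain →ₗ[ℤ] TChain :=
  ∑ k : Fin 4, sweep k (b k) ∘ₗ projBelow b k

lemma tboundary_projBelow (b : Fin 4 → ℤ) (m : ℕ) (z : TChain) :
    tboundary (projBelow b m z) = projBelow b m (tboundary z) := by
  induction m with
  | zero => rfl
  | succ m ih =>
    simp only [projBelow]
    split_ifs with h
    · simp [tboundary_proj, ih]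
    · simp

/-- The homotopy identities for the successive projections telescope. -/
lemma cone_homotopy (b : Fin 4 → ℤ) (z : TChain) :
    tboundary (cone b z) + cone b (tboundary z) = z - projBelow b 4 z := by
  have h : ∀ k : Fin 4, tboundary (sweep k (b k) (projBelow b k z)) +
      sweep k (b k) (projBelow b k (tboundary z)) = projBelow b k z - projBelow b (k + 1) z := by
    intro k
    rw [← tboundary_projBelow, homotopy]
    simp only [projBelow, k.2, dif_pos, LinearMap.comp_apply]
  simp only [cone, LinearMap.sum_apply, LinearMap.comp_apply, map_sum]
  rw [← Finset.sum_add_distrib, Finset.sum_congr rfl fun k _ => h k]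
  simp only [Fin.sum_univ_four]
  simp [projBelow]

end

end LatticeGauge

namespace LatticeGauge

noncomputable section

open Finsupp

/-! ### Supports of chains -/

lemma linearCombination_mem_of_supported {M : Type*} [AddCommGroup M] {R : Set TCell}
    {f : TCell → M} {W : Submodule ℤ M} (h : ∀ c ∈ R, f c ∈ W) {z : TChain}
    (hz : z ∈ supported ℤ ℤ R) : linearCombination ℤ f z ∈ W := by
  rw [linearCombination_apply]
  exact Submodule.sum_mem _ fun c hc => W.smul_mem _ (h c (hz hc))

lemma linearCombination_eq_zero_of_supported {M : Type*} [AddCommGroup M] {R : Set TCell}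
    {f : TCell → M} (h : ∀ c ∈ R, f c = 0) {z : TChain} (hz : z ∈ supported ℤ ℤ R) :
    linearCombination ℤ f z = 0 := by
  have := linearCombination_mem_of_supported (f := f) (W := ⊥) (fun c hc => by simp [h c hc]) hz
  simpa using this

lemma column_mem {R : Set TCell} {k : Fin 4} {s : ℤ} {x : Fin 4 → ℤ} {T : Finset (Fin 4)}
    (h : ∀ t, (s ≤ t ∧ t < x k) ∨ (x k ≤ t ∧ t < s) → (Function.update x k t, T) ∈ R) :
    column k s x T ∈ supported ℤ ℤ R := by
  refine Submodule.sub_mem _ (Submodule.sum_mem _ fun t ht => ?_)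
    (Submodule.sum_mem _ fun t ht => ?_)
  · exact single_mem_supported ℤ _ (h t (Or.inl (Finset.mem_Ico.1 ht)))
  · exact single_mem_supported ℤ _ (h t (Or.inr (Finset.mem_Ico.1 ht)))

lemma sweep_mem {R R' : Set TCell} {k : Fin 4} {s : ℤ}
    (h : ∀ x S, (x, S) ∈ R → k ∉ S → ∀ t, (s ≤ t ∧ t < x k) ∨ (x k ≤ t ∧ t < s) →
      (Function.update x k t, insert k S) ∈ R')
    {z : TChain} (hz : z ∈ supported ℤ ℤ R) : sweep k s z ∈ supported ℤ ℤ R' := by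
  refine linearCombination_mem_of_supported (fun c hc => ?_) hz
  split_ifs with hk
  · exact Submodule.zero_mem _
  · exact Submodule.smul_mem _ _ (column_mem (h c.1 c.2 hc hk))

lemma proj_mem {R R' : Set TCell} {k : Fin 4} {s : ℤ}
    (h : ∀ x S, (x, S) ∈ R → k ∉ S → (Function.update x k s, S) ∈ R')
    {z : TChain} (hz : z ∈ supported ℤ ℤ R) : proj k s z ∈ supported ℤ ℤ R' := by
  refine linearCombination_mem_of_supported (fun c hc => ?_) hz
  split_ifs with hk
  · exact Submodule.zero_mem _
  · exact single_mem_supported ℤ _ (h c.1 c.2 hc hk)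

/-- The cells all of whose corners lie in the product of the intervals `[lo i, hi i]`. -/
def region (lo hi : Fin 4 → ℤ) : Set TCell :=
  {c | ∀ i, lo i ≤ c.1 i ∧ c.1 i + (if i ∈ c.2 then 1 else 0) ≤ hi i}

lemma update_mem_region {lo hi : Fin 4 → ℤ} {x : Fin 4 → ℤ} {S : Finset (Fin 4)} {k : Fin 4}
    (hx : (x, S) ∈ region lo hi) {t : ℤ} (ht : lo k ≤ t) (ht' : t ≤ hi k) (hk : k ∉ S) :
    (Function.update x k t, S) ∈ region lo hi := by
  intro i
  by_cases hi : i = k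
  · subst hi; simp [hk, ht, ht']
  · simpa [Function.update_of_ne hi] using hx i

lemma update_insert_mem_region {lo hi : Fin 4 → ℤ} {x : Fin 4 → ℤ} {S : Finset (Fin 4)} {k : Fin 4}
    (hx : (x, S) ∈ region lo hi) {t : ℤ} (ht : lo k ≤ t) (ht' : t < hi k) :
    (Function.update x k t, insert k S) ∈ region lo hi := by
  intro i
  by_cases hi : i = k
  · subst hi; simp; omega
  · simpa [Function.update_of_ne hi, hi] using hx i

lemma sweep_mem_region {lo hi : Fin 4 → ℤ} {k : Fin 4} {s : ℤ} (hs : lo k ≤ s) (hs' : s ≤ hi k)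
    {z : TChain} (hz : z ∈ supported ℤ ℤ (region lo hi)) :
    sweep k s z ∈ supported ℤ ℤ (region lo hi) := by
  refine sweep_mem (fun x S hx hk t ht => ?_) hz
  have := hx k
  simp only [hk, if_false] at this
  exact update_insert_mem_region hx (by omega) (by omega)

lemma proj_mem_region {lo hi : Fin 4 → ℤ} {k : Fin 4} {s : ℤ} (hs : lo k ≤ s) (hs' : s ≤ hi k)
    {z : TChain} (hz : z ∈ supported ℤ ℤ (region lo hi)) :
    proj k s z ∈ supported ℤ ℤ (region lo hi) :=
  proj_mem (fun _ _ hx hk => update_mem_region hx hs hs' hk) hz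

lemma projBelow_mem_region {lo hi b : Fin 4 → ℤ} (hb : ∀ k, lo k ≤ b k) (hb' : ∀ k, b k ≤ hi k)
    {z : TChain} (hz : z ∈ supported ℤ ℤ (region lo hi)) (m : ℕ) :
    projBelow b m z ∈ supported ℤ ℤ (region lo hi) := by
  induction m with
  | zero => exact hz
  | succ m ih =>
    simp only [projBelow]
    split_ifs with h
    · exact proj_mem_region (hb _) (hb' _) ih
    · exact Submodule.zero_mem _

lemma cone_mem_region {lo hi b : Fin 4 → ℤ} (hb : ∀ k, lo k ≤ b k) (hb' : ∀ k, b k ≤ hi k)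
    {z : TChain} (hz : z ∈ supported ℤ ℤ (region lo hi)) :
    cone b z ∈ supported ℤ ℤ (region lo hi) := by
  rw [cone, LinearMap.sum_apply]
  exact Submodule.sum_mem _ fun k _ =>
    sweep_mem_region (hb k) (hb' k) (projBelow_mem_region hb hb' hz k)

/-- The set of cells of dimension `k`. -/
def dimCells (k : ℕ) : Set TCell := {c | c.2.card = k}

lemma sweep_mem_dimCells {m : ℕ} {k : Fin 4} {s : ℤ} {z : TChain}
    (hz : z ∈ supported ℤ ℤ (dimCells m)) : sweep k s z ∈ supported ℤ ℤ (dimCells (m + 1)) :=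
  sweep_mem (fun _ _ hx hk _ _ => (Finset.card_insert_of_notMem hk).trans (congrArg (· + 1) hx)) hz

lemma projBelow_mem_dimCells {m : ℕ} {b : Fin 4 → ℤ} {z : TChain}
    (hz : z ∈ supported ℤ ℤ (dimCells m)) (r : ℕ) :
    projBelow b r z ∈ supported ℤ ℤ (dimCells m) := by
  induction r with
  | zero => exact hz
  | succ r ih =>
    simp only [projBelow]
    split_ifs with h
    · exact proj_mem (fun _ _ hx _ => hx) ih
    · exact Submodule.zero_mem _

lemma cone_mem_dimCells {m : ℕ} {b : Fin 4 → ℤ} {z : TChain}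
    (hz : z ∈ supported ℤ ℤ (dimCells m)) : cone b z ∈ supported ℤ ℤ (dimCells (m + 1)) := by
  rw [cone, LinearMap.sum_apply]
  exact Submodule.sum_mem _ fun k _ => sweep_mem_dimCells (projBelow_mem_dimCells hz k)

lemma projBelow_avoids {b : Fin 4 → ℤ} (z : TChain) :
    ∀ m : ℕ, m ≤ 4 → projBelow b m z ∈ supported ℤ ℤ {c : TCell | ∀ i ∈ c.2, m ≤ (i : ℕ)} := by
  intro m
  induction m with
  | zero => intro _ c _; simp
  | succ m ih =>
    intro hm
    simp only [projBelow, show m < 4 by omega, dif_pos]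
    refine proj_mem (fun x S hx hk => ?_) (ih (by omega))
    intro i hi
    have h1 := hx i hi
    have h2 : (i : ℕ) ≠ m := fun h => hk (by rwa [show (⟨m, by omega⟩ : Fin 4) = i from Fin.ext h.symm])
    omega

/-- A projection along `k` kills the cells that extend in direction `k`; after all four only
vertices survive. Thus the cone contracts every chain of positive dimension without an error term.
-/
lemma projBelow_four_eq_zero {b : Fin 4 → ℤ} {m : ℕ} (hm : m ≠ 0) {z : TChain}
    (hz : z ∈ supported ℤ ℤ (dimCells m)) : projBelow b 4 z = 0 := by
  rw [← Finsupp.support_eq_empty, Finset.eq_empty_iff_forall_notMem]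
  intro c hc
  have h1 := projBelow_avoids (b := b) z 4 le_rfl hc
  have h2 : c.2.card = m := projBelow_mem_dimCells hz 4 hc
  obtain ⟨i, hi⟩ := Finset.card_pos.1 (by omega : 0 < c.2.card)
  have := h1 i hi
  omega

/-! ### Graded chains in the total complex -/

/-- Forget the dimension of a cell. -/
def toT {k : ℕ} (c : Cell k) : TCell := (c.1, c.2.1)

lemma toT_injective {k : ℕ} : Function.Injective (toT : Cell k → TCell) := by
  rintro ⟨x, S⟩ ⟨y, T⟩ h
  simp only [toT, Prod.mk.injEq] at h
  exact Prod.ext h.1 (Subtype.ext h.2)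

/-- Forget the dimension of the cells in a chain. -/
def toTChain {k : ℕ} : Chain k →ₗ[ℤ] TChain := Finsupp.lmapDomain ℤ ℤ toT

lemma toTChain_single {k : ℕ} (c : Cell k) (m : ℤ) :
    toTChain (single c m) = single (toT c) m := by
  simp [toTChain]

lemma toTChain_injective {k : ℕ} : Function.Injective (toTChain : Chain k → TChain) :=
  Finsupp.mapDomain_injective toT_injective

lemma toTChain_apply {k : ℕ} (q : Chain k) (c : Cell k) : toTChain q (toT c) = q c :=
  Finsupp.mapDomain_apply toT_injective q c

lemma mem_support_toTChain {k : ℕ} {q : Chain k} {c : TCell} (hc : c ∈ (toTChain q).support) :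
    ∃ c' ∈ q.support, toT c' = c := by
  simpa using Finsupp.mapDomain_support hc

lemma toTChain_mem_supported {k : ℕ} {q : Chain k} {R : Set TCell}
    (h : ∀ c ∈ q.support, toT c ∈ R) : toTChain q ∈ supported ℤ ℤ R := by
  intro c hc
  obtain ⟨c', hc', rfl⟩ := mem_support_toTChain hc
  exact h c' hc'

lemma toTChain_mem_dimCells {k : ℕ} (q : Chain k) : toTChain q ∈ supported ℤ ℤ (dimCells k) :=
  toTChain_mem_supported fun c _ => c.2.2

/-- Every chain of `k`-cells in the total complex comes from a `k`-chain. -/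
lemma exists_toTChain_eq {k : ℕ} {z : TChain} (hz : z ∈ supported ℤ ℤ (dimCells k)) :
    ∃ q : Chain k, toTChain q = z := by
  refine ⟨Finsupp.comapDomain toT z toT_injective.injOn, ?_⟩
  refine Finsupp.mapDomain_comapDomain _ toT_injective z fun c hc => ?_
  exact ⟨(c.1, ⟨c.2, hz hc⟩), rfl⟩

lemma toTChain_boundaryCell {k : ℕ} (c : Cell (k + 1)) :
    toTChain (boundaryCell c) = tboundary (single (toT c) 1) := by
  simp only [tboundary, LinearMap.sum_apply, tface_single]
  rw [← Finset.sum_filter, boundaryCell, map_sum]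
  simp only [map_smul, map_sub, toTChain_single]
  have hmem : ∀ j, j ∈ (Finset.univ.filter fun j => j ∈ (toT c).2) ↔ j ∈ c.2.1 := fun j =>
    ⟨fun h => (Finset.mem_filter.1 h).2, fun h => Finset.mem_filter.2 ⟨Finset.mem_univ j, h⟩⟩
  exact (Finset.sum_subtype (p := fun j => j ∈ c.2.1) (F := inferInstance) _ hmem
    (fun j => dirSign c.2.1 j •
      ((single (c.1 + Pi.single j 1, c.2.1.erase j) 1 : TChain) -
        single (c.1, c.2.1.erase j) 1))).symm

lemma toTChain_boundary {k : ℕ} (q : Chain (k + 1)) :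
    toTChain (boundary q) = tboundary (toTChain q) := by
  have : (toTChain ∘ₗ boundary : Chain (k + 1) →ₗ[ℤ] TChain) = tboundary ∘ₗ toTChain := by
    refine Finsupp.lhom_ext' fun c => LinearMap.ext_ring ?_
    simp [boundary, toTChain_single, toTChain_boundaryCell]
  exact LinearMap.congr_fun this q

lemma boundary_boundary {k : ℕ} (q : Chain (k + 2)) : boundary (boundary q) = 0 :=
  toTChain_injective (by rw [toTChain_boundary, toTChain_boundary, tboundary_tboundary, map_zero])

/-! ### Cells in boxes and cubes -/

lemma isIn_iff {k : ℕ} {c : Cell k} {lo hi : Fin 4 → ℤ} :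
    c.IsIn {x | ∀ i, lo i ≤ x i ∧ x i ≤ hi i} ↔ toT c ∈ region lo hi := by
  constructor
  · intro h i
    have h1 := h ∅ (by simp) i
    have h2 := h c.2.1 (by simp) i
    simp only [Finset.notMem_empty, if_false, add_zero] at h1
    exact ⟨h1.1, h2.2⟩
  · intro h T hT i
    have := h i
    simp only [toT] at this
    by_cases hi : i ∈ T
    · simp only [hT hi, if_true] at this
      simp only [hi, if_true]; omega
    · simp only [hi, if_false]
      split_ifs at this <;> omega

lemma isIn_cube_iff {k : ℕ} {c : Cell k} {a : Fin 4 → ℤ} {w : ℕ} :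
    c.IsIn (cube a w) ↔ toT c ∈ region a (fun i => a i + w) :=
  isIn_iff

/-- The cells of the box `B_N`. -/
def boxRegion (N : ℕ) : Set TCell := region (fun _ => -(N : ℤ)) (fun _ => N)

lemma mem_cells {k N : ℕ} {c : Cell k} : c ∈ cells k N ↔ toT c ∈ boxRegion N := by
  classical
  have hset : (box N : Set (Fin 4 → ℤ)) = {x | ∀ i, -(N : ℤ) ≤ x i ∧ x i ≤ (N : ℤ)} := by
    ext x
    simp [box, Pi.le_def, forall_and]
  unfold cells boxRegion
  rw [Finset.mem_filter, ← isIn_iff, ← hset]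
  refine ⟨fun h => h.2, fun h => ⟨?_, h⟩⟩
  have := h ∅ (by simp)
  simpa using this

/-! ### Forms as functionals on the total complex -/

section Forms

variable {k N : ℕ} {G : Type} [AddCommGroup G]

open Classical in
/-- The extension of a form by zero to all cells. -/
def Form.tot (ω : Form k N G) (c : TCell) : G :=
  if h : ∃ c' : {c : Cell k // c ∈ cells k N}, toT c'.1 = c then ω h.choose else 0

lemma Form.tot_toT (ω : Form k N G) (c : {c : Cell k // c ∈ cells k N}) :
    ω.tot (toT c.1) = ω c := by
  have h : ∃ c' : {c : Cell k // c ∈ cells k N}, toT c'.1 = toT c.1 := ⟨c, rfl⟩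
  rw [Form.tot, dif_pos h]
  congr 1
  exact Subtype.ext (toT_injective h.choose_spec)

lemma Form.tot_eq_zero (ω : Form k N G) {c : TCell} (hc : c ∉ boxRegion N) : ω.tot c = 0 := by
  rw [Form.tot, dif_neg]
  rintro ⟨c', rfl⟩
  exact hc (mem_cells.1 c'.2)

lemma Form.exists_of_tot_ne_zero (ω : Form k N G) {c : TCell} (hc : ω.tot c ≠ 0) :
    ∃ c' : {c : Cell k // c ∈ cells k N}, toT c'.1 = c ∧ ω c' ≠ 0 := by
  by_cases h : ∃ c' : {c : Cell k // c ∈ cells k N}, toT c'.1 = c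
  · obtain ⟨c', rfl⟩ := h
    exact ⟨c', rfl, by rwa [Form.tot_toT] at hc⟩
  · rw [Form.tot, dif_neg h] at hc
    exact absurd rfl hc

/-- A form as a linear functional on chains of mixed dimension. -/
def Form.lin (ω : Form k N G) : TChain →ₗ[ℤ] G := linearCombination ℤ ω.tot

lemma Form.lin_single (ω : Form k N G) (c : TCell) : ω.lin (single c 1) = ω.tot c := by
  simp [Form.lin]

lemma Form.lin_eq_zero (ω : Form k N G) {R : Set TCell} (h : ∀ c ∈ R, ω.tot c = 0) {z : TChain}
    (hz : z ∈ supported ℤ ℤ R) : ω.lin z = 0 :=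
  linearCombination_eq_zero_of_supported h hz

lemma Form.eval_eq_lin (ω : Form k N G) (q : Chain k) : ω.eval q = ω.lin (toTChain q) := by
  classical
  rw [Form.lin, toTChain, lmapDomain_apply, linearCombination_mapDomain, linearCombination_apply,
    Finsupp.sum, Form.eval]
  have h1 : ∀ c : {c : Cell k // c ∈ cells k N}, q c.1 • ω c = q c.1 • ω.tot (toT c.1) :=
    fun c => by rw [Form.tot_toT]
  rw [Finset.sum_congr rfl fun c _ => h1 c,
    ← Finset.sum_subtype (cells k N) (fun c => Iff.rfl) (fun c => q c • ω.tot (toT c))]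
  -- Both sums are extended to the union of the box and the support of `q`: the form vanishes off
  -- the box, the coefficients of `q` off its support.
  refine (Finset.sum_subset_zero_on_sdiff (Finset.subset_union_left (s₂ := q.support)) ?_
    (fun _ _ => rfl)).trans (Finset.sum_subset_zero_on_sdiff Finset.subset_union_right ?_
    (fun _ _ => rfl)).symm
  · intro c hc
    have : c ∉ cells k N := (Finset.mem_sdiff.1 hc).2
    rw [ω.tot_eq_zero (fun h => this (mem_cells.2 h)), smul_zero]
  · intro c hc
    have : c ∉ q.support := (Finset.mem_sdiff.1 hc).2
    rw [Finsupp.notMem_support_iff.1 this, zero_smul]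

lemma Form.d_apply (ω : Form k N G) (c : {c : Cell (k + 1) // c ∈ cells (k + 1) N}) :
    ω.d c = ω.lin (tboundary (single (toT c.1) 1)) := by
  rw [Form.d, Form.eval_eq_lin, toTChain_boundaryCell]

/-- Stokes' theorem. -/
lemma Form.eval_d (ω : Form k N G) {q : Chain (k + 1)} (hq : q.support ⊆ cells (k + 1) N) :
    ω.d.eval q = ω.eval (boundary q) := by
  classical
  rw [Form.eval_eq_lin, Form.eval_eq_lin, toTChain_boundary]
  conv_rhs => rw [← q.sum_single]
  conv_lhs => rw [← q.sum_single]
  simp only [Finsupp.sum, map_sum]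
  refine Finset.sum_congr rfl fun c hc => ?_
  have h : (single c (q c) : Chain (k + 1)) = q c • single c 1 := by simp
  rw [h]
  simp only [map_smul, toTChain_single]
  rw [← ω.d_apply ⟨c, hq hc⟩, Form.lin_single, ← Form.tot_toT ω.d]

lemma Form.lin_tboundary_eq_zero {ω : Form k N G} (hω : ω.d = 0) {z : TChain}
    (hz : z ∈ supported ℤ ℤ (boxRegion N)) (hz' : z ∈ supported ℤ ℤ (dimCells (k + 1))) :
    ω.lin (tboundary z) = 0 := by
  obtain ⟨q, rfl⟩ := exists_toTChain_eq hz'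
  rw [← toTChain_boundary, ← Form.eval_eq_lin, ← Form.eval_d, hω]
  · simp [Form.eval]
  · intro c hc
    refine mem_cells.2 (hz ?_)
    rw [Finset.mem_coe, Finsupp.mem_support_iff, toTChain_apply]
    exact Finsupp.mem_support_iff.1 hc

lemma boundaryCell_support_subset {c : Cell (k + 1)} (hc : c ∈ cells (k + 1) N) :
    (boundaryCell c).support ⊆ cells k N := by
  intro f hf
  rw [Finsupp.mem_support_iff, ← toTChain_apply, toTChain_boundaryCell] at hf
  have h2 : tboundary (single (toT c) 1) ∈ supported ℤ ℤ (boxRegion N) := by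
    rw [tboundary, LinearMap.sum_apply]
    refine Submodule.sum_mem _ fun j _ => ?_
    rw [tface_single]
    split_ifs with hj
    · refine Submodule.smul_mem _ _ (Submodule.sub_mem _ (single_mem_supported ℤ _ ?_)
        (single_mem_supported ℤ _ ?_)) <;>
      · intro i
        have := mem_cells.1 hc i
        by_cases hi : i = j
        · subst hi; simp only [hj, if_true] at this; simp; omega
        · simp only [Finset.mem_erase, hi, ne_eq, not_false_eq_true, true_and]
          simpa [Pi.single_eq_of_ne hi] using this
    · exact Submodule.zero_mem _
  exact mem_cells.2 (h2 (Finsupp.mem_support_iff.2 hf))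

lemma Form.d_d (ω : Form k N G) : ω.d.d = 0 := by
  ext c
  have h : boundary (boundaryCell c.1) = 0 := by
    simpa [boundary] using boundary_boundary (single c.1 (1 : ℤ))
  rw [Form.d, Form.eval_d _ (boundaryCell_support_subset c.2), h]
  simp [Form.eval]

/-- The Poincaré lemma on `B_N`. -/
lemma Form.exists_d_eq {ν : Form (k + 1) N G} (hν : ν.d = 0) : ∃ τ : Form k N G, τ.d = ν := by
  refine ⟨fun e => ν.lin (cone 0 (single (toT e.1) 1)), funext fun p => ?_⟩
  set τ : Form k N G := fun e => ν.lin (cone 0 (single (toT e.1) 1)) with hτ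
  have key : ∀ q : Chain k, q.support ⊆ cells k N → τ.eval q = ν.lin (cone 0 (toTChain q)) := by
    intro q hq
    rw [Form.eval_eq_lin]
    conv_rhs => rw [← q.sum_single]
    conv_lhs => rw [← q.sum_single]
    simp only [Finsupp.sum, map_sum]
    refine Finset.sum_congr rfl fun c hc => ?_
    have h : (single c (q c) : Chain k) = q c • single c 1 := by simp
    rw [h]
    simp only [map_smul, toTChain_single]
    rw [Form.lin_single, τ.tot_toT ⟨c, hq hc⟩]
  have hp : (single (toT p.1) 1 : TChain) ∈ supported ℤ ℤ (boxRegion N) :=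
    single_mem_supported ℤ _ (mem_cells.1 p.2)
  have hp' : (single (toT p.1) 1 : TChain) ∈ supported ℤ ℤ (dimCells (k + 1)) :=
    single_mem_supported ℤ _ p.1.2.2
  -- The cone over `p` has apex in the box, so it stays in the box and `ν` kills its boundary. Hence
  -- `ν(p)` is `ν` of the cone over the boundary of `p`, which is `τ` on that boundary.
  have h := cone_homotopy 0 (single (toT p.1) 1)
  rw [projBelow_four_eq_zero (Nat.succ_ne_zero k) hp', sub_zero] at h
  have h' := congrArg ν.lin h
  rw [map_add, Form.lin_tboundary_eq_zero hν
    (cone_mem_region (by simp) (by simp) hp) (cone_mem_dimCells hp'), zero_add, Form.lin_single,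
    Form.tot_toT] at h'
  rw [Form.d, key _ (boundaryCell_support_subset p.2), toTChain_boundaryCell, h']

end Forms

end

end LatticeGauge

namespace LatticeGauge

noncomputable section

open Finsupp

/-! ### Incidence of cells -/

/-- The doubled barycentre of a cell. -/
def bary {k : ℕ} (c : Cell k) (i : Fin 4) : ℤ := 2 * c.1 i + if i ∈ c.2.1 then 1 else 0

lemma bary_emod {k : ℕ} (c : Cell k) (i : Fin 4) : i ∈ c.2.1 ↔ bary c i % 2 = 1 := by
  unfold bary; split_ifs with h <;> simp [h]

lemma bary_injective {k : ℕ} : Function.Injective (bary : Cell k → Fin 4 → ℤ) := by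
  intro c c' h
  have hi : ∀ i, i ∈ c.2.1 ↔ i ∈ c'.2.1 := fun i => by rw [bary_emod, bary_emod, h]
  refine Prod.ext (funext fun i => ?_) (Subtype.ext (Finset.ext hi))
  have h1 := congrFun h i
  unfold bary at h1
  by_cases h2 : i ∈ c.2.1
  · simp only [h2, (hi i).1 h2, if_true] at h1; omega
  · simp only [h2, (hi i).not.1 h2, if_false] at h1; omega

lemma bary_mem_boxRegion {k N : ℕ} {c : Cell k} :
    c ∈ cells k N ↔ ∀ i, -(2 * N : ℤ) ≤ bary c i ∧ bary c i ≤ 2 * N := by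
  rw [mem_cells]
  refine forall_congr' fun i => ?_
  unfold bary toT
  by_cases h : i ∈ c.2.1 <;> simp only [h, if_true, if_false] <;> omega

lemma boundaryCell_apply {k : ℕ} (c : Cell (k + 1)) (f : Cell k) :
    boundaryCell c f = ∑ j, if j ∈ c.2.1 then dirSign c.2.1 j *
      ((if (c.1 + Pi.single j 1, c.2.1.erase j) = toT f then 1 else 0) -
        if (c.1, c.2.1.erase j) = toT f then 1 else 0) else 0 := by
  rw [← toTChain_apply, toTChain_boundaryCell, tboundary, LinearMap.sum_apply, Finsupp.finsetSum_apply]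
  refine Finset.sum_congr rfl fun j _ => ?_
  rw [tface_single]
  simp only [toT]
  split_ifs with h1 <;> simp_all [Finsupp.single_apply]

lemma erase_inj_of_mem {S : Finset (Fin 4)} {i j : Fin 4} (hj : j ∈ S)
    (h : S.erase i = S.erase j) : i = j := by
  by_contra hne
  have : j ∈ S.erase i := Finset.mem_erase.2 ⟨fun h => hne h.symm, hj⟩
  rw [h] at this
  exact Finset.notMem_erase j S this

lemma boundaryCell_upper {k : ℕ} {c : Cell (k + 1)} {f : Cell k} {j : Fin 4} (hj : j ∈ c.2.1)
    (h : toT f = (c.1 + Pi.single j 1, c.2.1.erase j)) : boundaryCell c f = dirSign c.2.1 j := by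
  rw [boundaryCell_apply, Finset.sum_eq_single j]
  · rw [h]
    have : (c.1, c.2.1.erase j) ≠ (c.1 + Pi.single j 1, c.2.1.erase j) := fun h' => by
      have := congrFun (congrArg Prod.fst h') j
      simp at this
    simp [hj]
  · intro i _ hij
    by_cases hi : i ∈ c.2.1
    · have h1 : ∀ x y : Fin 4 → ℤ, (x, c.2.1.erase i) ≠ (y, c.2.1.erase j) := fun x y h' =>
        hij (erase_inj_of_mem hj (congrArg Prod.snd h'))
      rw [h, if_neg (h1 _ _), if_neg (h1 _ _)]; simp
    · rw [if_neg hi]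
  · simp

lemma boundaryCell_lower {k : ℕ} {c : Cell (k + 1)} {f : Cell k} {j : Fin 4} (hj : j ∈ c.2.1)
    (h : toT f = (c.1, c.2.1.erase j)) : boundaryCell c f = -dirSign c.2.1 j := by
  rw [boundaryCell_apply, Finset.sum_eq_single j]
  · rw [h]
    have : (c.1 + Pi.single j 1, c.2.1.erase j) ≠ (c.1, c.2.1.erase j) := fun h' => by
      have := congrFun (congrArg Prod.fst h') j
      simp at this
    simp [hj]
  · intro i _ hij
    by_cases hi : i ∈ c.2.1
    · have h1 : ∀ x y : Fin 4 → ℤ, (x, c.2.1.erase i) ≠ (y, c.2.1.erase j) := fun x y h' =>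
        hij (erase_inj_of_mem hj (congrArg Prod.snd h'))
      rw [h, if_neg (h1 _ _), if_neg (h1 _ _)]; simp
    · rw [if_neg hi]
  · simp

lemma exists_of_boundaryCell_ne_zero {k : ℕ} {c : Cell (k + 1)} {f : Cell k}
    (h : boundaryCell c f ≠ 0) : ∃ j ∈ c.2.1,
      toT f = (c.1 + Pi.single j 1, c.2.1.erase j) ∨ toT f = (c.1, c.2.1.erase j) := by
  rw [boundaryCell_apply] at h
  obtain ⟨j, _, hj⟩ := Finset.exists_ne_zero_of_sum_ne_zero h
  by_cases hjc : j ∈ c.2.1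
  · refine ⟨j, hjc, ?_⟩
    rw [if_pos hjc] at hj
    by_contra hcon
    push Not at hcon
    rw [if_neg hcon.1.symm, if_neg hcon.2.symm] at hj
    simp at hj
  · simp [hjc] at hj

lemma boundaryCell_eq_or {k : ℕ} {c : Cell (k + 1)} {f : Cell k} (h : boundaryCell c f ≠ 0) :
    boundaryCell c f = 1 ∨ boundaryCell c f = -1 := by
  obtain ⟨j, hj, h | h⟩ := exists_of_boundaryCell_ne_zero h
  · rw [boundaryCell_upper hj h]; exact dirSign_eq _ _
  · rw [boundaryCell_lower hj h]
    rcases dirSign_eq c.2.1 j with h | h <;> simp [h]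

/-- Parities of the doubled coordinates record the directions. If `j` were not a direction of `c`,
all directions of `c` would be directions of `f`, which has too few. -/
lemma mem_of_bary_eq_add {k : ℕ} {c : Cell (k + 1)} {f : Cell k} {j : Fin 4} {s : ℤ}
    (hs : s = 1 ∨ s = -1) (h : bary c = bary f + Pi.single j s) : j ∈ c.2.1 ∧ j ∉ f.2.1 := by
  have hj' : bary c j = bary f j + s := by rw [h]; simp
  have hjc : j ∈ c.2.1 := by
    by_contra hjc
    have hsub : c.2.1 ⊆ f.2.1 := fun i hi => by
      have hij : i ≠ j := fun hij => hjc (hij ▸ hi)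
      rw [bary_emod] at hi ⊢
      rw [h] at hi; simpa [hij] using hi
    have := Finset.card_le_card hsub
    rw [c.2.2, f.2.2] at this
    omega
  refine ⟨hjc, ?_⟩
  rw [bary_emod] at hjc ⊢
  omega

/-- This turns incidence into adjacency in `ℤ⁴`, so that the combinatorics of vortices becomes
integer arithmetic with parities. -/
lemma boundaryCell_ne_zero_iff {k : ℕ} {c : Cell (k + 1)} {f : Cell k} :
    boundaryCell c f ≠ 0 ↔
      ∃ j : Fin 4, ∃ s : ℤ, (s = 1 ∨ s = -1) ∧ bary c = bary f + Pi.single j s := by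
  constructor
  · intro h
    obtain ⟨j, hj, h | h⟩ := exists_of_boundaryCell_ne_zero h
    · refine ⟨j, -1, Or.inr rfl, funext fun i => ?_⟩
      have h1 : f.1 = c.1 + Pi.single j 1 := congrArg Prod.fst h
      have h2 : f.2.1 = c.2.1.erase j := congrArg Prod.snd h
      by_cases hi : i = j
      · subst hi; simp [bary, h1, h2, hj]; ring
      · simp [bary, h1, h2, hi]
    · refine ⟨j, 1, Or.inl rfl, funext fun i => ?_⟩
      have h1 : f.1 = c.1 := congrArg Prod.fst h
      have h2 : f.2.1 = c.2.1.erase j := congrArg Prod.snd h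
      by_cases hi : i = j
      · subst hi; simp [bary, h1, h2, hj]
      · simp [bary, h1, h2, hi]
  · rintro ⟨j, s, hs, h⟩
    have hne : ∀ i, i ≠ j → bary c i = bary f i := fun i hi => by
      rw [h]; simp [hi]
    have hmem : ∀ i, i ≠ j → (i ∈ c.2.1 ↔ i ∈ f.2.1) := fun i hi => by
      rw [bary_emod, bary_emod, hne i hi]
    have hj' : bary c j = bary f j + s := by rw [h]; simp
    obtain ⟨hjc, hjf⟩ := mem_of_bary_eq_add hs h
    have hS : f.2.1 = c.2.1.erase j := by
      ext i
      by_cases hij : i = j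
      · subst hij; simp [hjf]
      · simp [hmem i hij, hij]
    have hx : ∀ i, i ≠ j → f.1 i = c.1 i := fun i hi => by
      have h1 := hne i hi
      unfold bary at h1
      by_cases h2 : i ∈ c.2.1
      · simp only [h2, (hmem i hi).1 h2, if_true] at h1; omega
      · simp only [h2, (hmem i hi).not.1 h2, if_false] at h1; omega
    unfold bary at hj'
    simp only [hjc, hjf, if_true, if_false] at hj'
    rcases hs with rfl | rfl
    · have : toT f = (c.1, c.2.1.erase j) := Prod.ext (funext fun i => by
        by_cases hi : i = j
        · subst hi; simp only [toT]; omega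
        · exact hx i hi) hS
      rw [boundaryCell_lower hjc this]
      rcases dirSign_eq c.2.1 j with h | h <;> simp [h]
    · have : toT f = (c.1 + Pi.single j 1, c.2.1.erase j) := Prod.ext (funext fun i => by
        by_cases hi : i = j
        · subst hi; simp only [toT, Pi.add_apply, Pi.single_eq_same]; omega
        · simpa [hi, toT] using hx i hi) hS
      rw [boundaryCell_upper hjc this]
      rcases dirSign_eq c.2.1 j with h | h <;> simp [h]

/-- The coface of `f` in direction `j` on the side given by the Boolean. -/
def cofaceCell {k : ℕ} (f : Cell k) (j : {j : Fin 4 // j ∉ f.2.1}) (s : Bool) : Cell (k + 1) :=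
  (f.1 - (if s then 0 else Pi.single j.1 1), ⟨insert j.1 f.2.1, by
    rw [Finset.card_insert_of_notMem j.2, f.2.2]⟩)

lemma bary_cofaceCell {k : ℕ} (f : Cell k) (j : {j : Fin 4 // j ∉ f.2.1}) (s : Bool) :
    bary (cofaceCell f j s) = bary f + Pi.single j.1 (if s then 1 else -1) := by
  ext i
  by_cases hi : i = j.1
  · subst hi
    cases s <;> simp [bary, cofaceCell, j.2]; ring
  · cases s <;> simp [bary, cofaceCell, hi]

/-- The cofaces of a cell. -/
def cofaces {k : ℕ} (f : Cell k) : Finset (Cell (k + 1)) :=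
  Finset.univ.map ⟨fun js : {j : Fin 4 // j ∉ f.2.1} × Bool => cofaceCell f js.1 js.2, by
    rintro ⟨j, s⟩ ⟨j', s'⟩ h
    have h1 := congrArg bary h
    simp only [bary_cofaceCell, add_right_inj] at h1
    have h2 := congrFun h1 j.1
    have h3 : j.1 = j'.1 := by
      by_contra hne
      simp [Pi.single_eq_of_ne hne] at h2
      cases s <;> simp at h2
    have h4 : j = j' := Subtype.ext h3
    subst h4
    cases s <;> cases s' <;> simp at h2 ⊢⟩

lemma mem_cofaces {k : ℕ} {f : Cell k} {c : Cell (k + 1)} :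
    c ∈ cofaces f ↔ boundaryCell c f ≠ 0 := by
  rw [boundaryCell_ne_zero_iff]
  constructor
  · intro h
    obtain ⟨⟨j, s⟩, _, rfl⟩ := Finset.mem_map.1 h
    refine ⟨j.1, _, ?_, bary_cofaceCell f j s⟩
    cases s <;> simp
  · rintro ⟨j, s, hs, h⟩
    have hjf := (mem_of_bary_eq_add hs h).2
    refine Finset.mem_map.2 ⟨(⟨j, hjf⟩, decide (s = 1)), Finset.mem_univ _, bary_injective ?_⟩
    change bary (cofaceCell f ⟨j, hjf⟩ (decide (s = 1))) = bary c
    rw [bary_cofaceCell, h]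
    rcases hs with rfl | rfl <;> simp

lemma card_cofaces {k : ℕ} (f : Cell k) : (cofaces f).card = 2 * (4 - k) := by
  rw [cofaces, Finset.card_map, Finset.card_univ, Fintype.card_prod, Fintype.card_bool,
    Fintype.card_subtype_compl, Fintype.card_fin, Fintype.card_coe, f.2.2, mul_comm]

lemma card_boundaryCell_support {k : ℕ} (c : Cell (k + 1)) :
    (boundaryCell c).support.card ≤ 2 * (k + 1) := by
  classical
  have hsub : (boundaryCell c).support.image bary ⊆
      (c.2.1 ×ˢ (Finset.univ : Finset Bool)).image
        (fun js => bary c + Pi.single js.1 (if js.2 then 1 else -1)) := by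
    intro y hy
    obtain ⟨f, hf, rfl⟩ := Finset.mem_image.1 hy
    have hne := Finsupp.mem_support_iff.1 hf
    obtain ⟨j, s, hs, h⟩ := boundaryCell_ne_zero_iff.1 hne
    have hjc := (mem_of_bary_eq_add hs h).1
    refine Finset.mem_image.2 ⟨(j, decide (s = -1)), by simp [hjc, em], ?_⟩
    rw [h]
    rcases hs with rfl | rfl
    · ext i; by_cases hi : i = j
      · subst hi; simp
      · simp [hi]
    · ext i; by_cases hi : i = j
      · subst hi; simp
      · simp [hi]
  calc (boundaryCell c).support.card = ((boundaryCell c).support.image bary).card :=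
        (Finset.card_image_of_injective _ bary_injective).symm
    _ ≤ _ := Finset.card_le_card hsub
    _ ≤ (c.2.1 ×ˢ (Finset.univ : Finset Bool)).card := Finset.card_image_le
    _ = 2 * (k + 1) := by rw [Finset.card_product, c.2.2]; simp [mul_comm]

end

end LatticeGauge

namespace LatticeGauge

noncomputable section

open Finsupp

/-! ### Small vortices -/

/-- A set of doubled barycentres of plaquettes in the box of radius `2N` has no free `3`-cells if
every `3`-cell of the box that contains one of the plaquettes contains another one. -/
def NoFreeFace (N : ℕ) (F : Finset (Fin 4 → ℤ)) : Prop :=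
  ∀ v ∈ F, ∀ m : Fin 4, v m % 2 = 0 → ∀ s : ℤ, (s = 1 ∨ s = -1) → -(2 * N : ℤ) ≤ v m + s →
    v m + s ≤ 2 * N → ∃ (r : Fin 4) (t : ℤ), (t = 1 ∨ t = -1) ∧ (r = m ∨ v r % 2 = 1) ∧
      ¬ (r = m ∧ t = -s) ∧ v + Pi.single m s + Pi.single r t ∈ F

section Classify

variable {N : ℕ} {F : Finset (Fin 4 → ℤ)} {p : Fin 4 → ℤ}

/-- The second plaquette of the 3-cell either is the opposite face, two units further along `m`, or
is a side, one unit further; in both cases the other transverse coordinate is untouched. -/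
lemma NoFreeFace.exists_beyond (hF : NoFreeFace N F) {v : Fin 4 → ℤ} (hv : v ∈ F) {m : Fin 4}
    (hm : v m % 2 = 0) {s : ℤ} (hs : s = 1 ∨ s = -1) (h1 : -(2 * N : ℤ) ≤ v m + s)
    (h2 : v m + s ≤ 2 * N) :
    ∃ w ∈ F, 0 < s * (w m - v m) ∧ ∀ x, x ≠ m → v x % 2 = 0 → w x = v x := by
  obtain ⟨r, t, ht, hr, hrt, h⟩ := hF v hv m hm s hs h1 h2
  refine ⟨_, h, ?_, fun x hx hxv => ?_⟩
  · by_cases hrm : r = m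
    · subst hrm
      have : t = s := by
        have : t ≠ -s := fun h => hrt ⟨rfl, h⟩
        omega
      subst this
      simp only [Pi.add_apply, Pi.single_eq_same]
      rcases ht with rfl | rfl <;> omega
    · simp only [Pi.add_apply, Pi.single_eq_same, Pi.single_eq_of_ne (Ne.symm hrm)]
      rcases hs with rfl | rfl <;> omega
  · have hxr : x ≠ r := by
      rintro rfl
      rcases hr with h | h
      · exact hx h
      · omega
    simp [hx, hxr]

/-- If the 3-cell were closed off by its opposite face, then the plaquettes forced around `p` and
around that face would be seven in number. -/
lemma NoFreeFace.exists_side (hF : NoFreeFace N F) (hcard : F.card ≤ 6) (hp : p ∈ F)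
    (hb : ∀ m, -(2 * N : ℤ) + 2 ≤ p m ∧ p m ≤ 2 * N - 2) {m m' : Fin 4} (hmm : m ≠ m')
    (hm : p m % 2 = 0) (hm' : p m' % 2 = 0) {s : ℤ} (hs : s = 1 ∨ s = -1) :
    ∃ (r : Fin 4) (t : ℤ), (t = 1 ∨ t = -1) ∧ p r % 2 = 1 ∧
      p + Pi.single m s + Pi.single r t ∈ F := by
  have hbm := hb m
  have hbm' := hb m'
  obtain ⟨r, t, ht, hr, hrt, h1⟩ := hF p hp m hm s hs (by omega) (by omega)
  rcases hr with rfl | hr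
  swap
  · exact ⟨r, t, ht, hr, h1⟩
  exfalso
  have hts : t = s := by
    have : t ≠ -s := fun h => hrt ⟨rfl, h⟩
    omega
  subst hts
  set v : Fin 4 → ℤ := p + Pi.single r t + Pi.single r t with hv
  have hvr : v r = p r + 2 * t := by simp [hv]; ring
  have hvm : v m' = p m' := by simp [hv, hmm.symm]
  obtain ⟨w2, h2, a2, b2⟩ := hF.exists_beyond hp hm (s := -t) (by omega) (by omega) (by omega)
  obtain ⟨w3, h3, a3, b3⟩ := hF.exists_beyond hp hm' (s := 1) (by omega) (by omega) (by omega)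
  obtain ⟨w4, h4, a4, b4⟩ := hF.exists_beyond hp hm' (s := -1) (by omega) (by omega) (by omega)
  obtain ⟨w5, h5, a5, b5⟩ := hF.exists_beyond h1 (m := m') (s := 1) (by omega) (by omega) (by omega)
    (by omega)
  obtain ⟨w6, h6, a6, b6⟩ := hF.exists_beyond h1 (m := m') (s := -1) (by omega) (by omega)
    (by omega) (by omega)
  replace b2 := b2 m' hmm.symm hm'
  replace b3 := b3 r hmm hm
  replace b4 := b4 r hmm hm
  replace b5 := b5 r hmm (by omega)
  replace b6 := b6 r hmm (by omega)
  -- The seven plaquettes are told apart by the signs of their displacements along the two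
  -- directions transverse to `p`.
  let φ : (Fin 4 → ℤ) → ℤ × ℤ := fun w => ((t * (w r - p r)).sign, (w m' - p m').sign)
  have hφ : ∀ w ∈ F, φ w ∈ F.image φ := fun w hw => Finset.mem_image_of_mem φ hw
  have htt : t * (2 * t) = 2 := by rcases ht with rfl | rfl <;> rfl
  have e0 : φ p = (0, 0) := by simp [φ]
  have e1 : φ v = (1, 0) := by
    simp only [φ, hvr, hvm, add_sub_cancel_left, htt, sub_self]; rfl
  have e2 : φ w2 = (-1, 0) := by
    simp only [φ, b2, sub_self]
    rw [Int.sign_eq_neg_one_of_neg (by linarith)]; rfl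
  have e3 : φ w3 = (0, 1) := by
    simp only [φ, b3, sub_self, mul_zero]
    rw [Int.sign_eq_one_of_pos (a := w3 m' - p m') (by linarith)]; rfl
  have e4 : φ w4 = (0, -1) := by
    simp only [φ, b4, sub_self, mul_zero]
    rw [Int.sign_eq_neg_one_of_neg (a := w4 m' - p m') (by linarith)]; rfl
  have e5 : φ w5 = (1, 1) := by
    simp only [φ, b5, hvr, add_sub_cancel_left, htt]
    rw [Int.sign_eq_one_of_pos (a := w5 m' - p m') (by linarith)]; rfl
  have e6 : φ w6 = (1, -1) := by
    simp only [φ, b6, hvr, add_sub_cancel_left, htt]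
    rw [Int.sign_eq_neg_one_of_neg (a := w6 m' - p m') (by linarith)]; rfl
  have hsub : ({(0, 0), (1, 0), (-1, 0), (0, 1), (0, -1), (1, 1), (1, -1)} : Finset (ℤ × ℤ)) ⊆
      F.image φ := by
    intro y hy
    simp only [Finset.mem_insert, Finset.mem_singleton] at hy
    rcases hy with rfl | rfl | rfl | rfl | rfl | rfl | rfl
    · exact e0 ▸ hφ _ hp
    · exact e1 ▸ hφ _ h1
    · exact e2 ▸ hφ _ h2
    · exact e3 ▸ hφ _ h3
    · exact e4 ▸ hφ _ h4
    · exact e5 ▸ hφ _ h5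
    · exact e6 ▸ hφ _ h6
  have h7 : ({(0, 0), (1, 0), (-1, 0), (0, 1), (0, -1), (1, 1), (1, -1)} :
      Finset (ℤ × ℤ)).card = 7 := by decide
  have := (Finset.card_le_card hsub).trans Finset.card_image_le
  omega

/-- The doubled barycentres of the plaquettes around the edge with doubled barycentre `p + t u_r`. -/
def star (p : Fin 4 → ℤ) (k l r : Fin 4) (t : ℤ) : Finset (Fin 4 → ℤ) :=
  {p, p + Pi.single k 1 + Pi.single r t, p + Pi.single k (-1) + Pi.single r t,
    p + Pi.single l 1 + Pi.single r t, p + Pi.single l (-1) + Pi.single r t,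
    p + Pi.single r (2 * t)}

lemma star_eq_insert (k l r : Fin 4) (t : ℤ) : star p k l r t =
    insert (p + Pi.single r (2 * t)) {p, p + Pi.single k 1 + Pi.single r t,
      p + Pi.single k (-1) + Pi.single r t, p + Pi.single l 1 + Pi.single r t,
      p + Pi.single l (-1) + Pi.single r t} := by
  unfold star
  generalize p + Pi.single r (2 * t) = x
  ext y
  simp only [Finset.mem_insert, Finset.mem_singleton]
  tauto

lemma abs_offset_le {m r' r : Fin 4} {s t : ℤ} (hm : p m % 2 = 0) (ht : t = 1 ∨ t = -1)
    (hr : p r % 2 = 1) : |(p + Pi.single m s + Pi.single r' t : Fin 4 → ℤ) r - p r| ≤ 1 := by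
  have hmr : r ≠ m := fun h => by subst h; omega
  rw [abs_le]
  simp only [Pi.add_apply, Pi.single_apply]
  split_ifs <;> omega

/-- Along `m` the two sides start two units apart, so each of the unit steps must lead back towards
the middle along `m`. -/
lemma cancel_opposite {m r r' r2 r2' : Fin 4} {t t' t2 t2' : ℤ} (hmr : m ≠ r) (hmr2 : m ≠ r2)
    (ht' : t' = 1 ∨ t' = -1) (ht2' : t2' = 1 ∨ t2' = -1)
    (h : (p + Pi.single m 1 + Pi.single r (2 * t) + Pi.single r' t' : Fin 4 → ℤ) =
      p + Pi.single m (-1) + Pi.single r2 (2 * t2) + Pi.single r2' t2') :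
    (r' = m ∧ t' = -1) ∧ (r2' = m ∧ t2' = 1) := by
  have h := congrFun h m
  simp only [Pi.add_apply, Pi.single_apply] at h
  split_ifs at h <;> omega

lemma add_sub_offset (m r : Fin 4) (s t : ℤ) :
    (p + Pi.single m s + Pi.single r (2 * t) + Pi.single m (-s) : Fin 4 → ℤ) =
      p + Pi.single r (2 * t) := by
  rw [Pi.single_neg]; abel

lemma offset_inj {r r' : Fin 4} {t t' : ℤ} (ht : t = 1 ∨ t = -1)
    (h : (p + Pi.single r (2 * t) : Fin 4 → ℤ) = p + Pi.single r' (2 * t')) :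
    r' = r ∧ t' = t := by
  have h := congrFun h r
  simp only [Pi.add_apply, Pi.single_apply] at h
  split_ifs at h <;> omega

/-- The four 3-cells around `p` each contribute a side, which with `p` makes five distinct
plaquettes. Each side needs a further plaquette in the 3-cell beyond it, away from `p`, and that one
is not among the five. There is room for only one more, so the four further plaquettes coincide;
this forces all sides to lean in the same direction `(r, t)` and the sixth plaquette to close the
star. -/
lemma NoFreeFace.eq_star (hF : NoFreeFace N F) (hcard : F.card ≤ 6) (hp : p ∈ F)
    (hb : ∀ m, -(2 * N : ℤ) + 2 ≤ p m ∧ p m ≤ 2 * N - 2) {k l : Fin 4} (hkl : k ≠ l)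
    (hk : p k % 2 = 0) (hl : p l % 2 = 0) :
    ∃ (r : Fin 4) (t : ℤ), (t = 1 ∨ t = -1) ∧ p r % 2 = 1 ∧ F = star p k l r t := by
  obtain ⟨r1, t1, ht1, hr1, h1⟩ := hF.exists_side hcard hp hb hkl hk hl (s := 1) (by simp)
  obtain ⟨r2, t2, ht2, hr2, h2⟩ := hF.exists_side hcard hp hb hkl hk hl (s := -1) (by simp)
  obtain ⟨r3, t3, ht3, hr3, h3⟩ := hF.exists_side hcard hp hb hkl.symm hl hk (s := 1) (by simp)
  obtain ⟨r4, t4, ht4, hr4, h4⟩ := hF.exists_side hcard hp hb hkl.symm hl hk (s := -1) (by simp)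
  have hk' : ∀ r, p r % 2 = 1 → k ≠ r := fun r hr h => by subst h; omega
  have hl' : ∀ r, p r % 2 = 1 → l ≠ r := fun r hr h => by subst h; omega
  -- the plaquette beyond the side
  have opp : ∀ (m r : Fin 4) (s t : ℤ), (s = 1 ∨ s = -1) → (t = 1 ∨ t = -1) → p r % 2 = 1 →
      m ≠ r → p + Pi.single m s + Pi.single r t ∈ F → ∃ (r' : Fin 4) (t' : ℤ),
        (t' = 1 ∨ t' = -1) ∧ ¬ (r' = r ∧ t' = -t) ∧
        p + Pi.single m s + Pi.single r (2 * t) + Pi.single r' t' ∈ F := by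
    intro m r s t hs ht hr hmr h
    have hbr := hb r
    have hv : (p + Pi.single m s + Pi.single r t : Fin 4 → ℤ) r = p r + t := by simp [hmr.symm]
    obtain ⟨r', t', ht', -, hrt', h'⟩ := hF _ h r (by omega) t ht (by omega) (by omega)
    refine ⟨r', t', ht', hrt', ?_⟩
    have h2 : (Pi.single r (2 * t) : Fin 4 → ℤ) = Pi.single r t + Pi.single r t := by
      rw [← Pi.single_add, two_mul]
    rwa [h2, ← add_assoc]
  obtain ⟨r1', t1', ht1', hrt1, x1⟩ := opp k r1 1 t1 (by simp) ht1 hr1 (hk' _ hr1) h1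
  obtain ⟨r2', t2', ht2', hrt2, x2⟩ := opp k r2 (-1) t2 (by simp) ht2 hr2 (hk' _ hr2) h2
  obtain ⟨r3', t3', ht3', hrt3, x3⟩ := opp l r3 1 t3 (by simp) ht3 hr3 (hl' _ hr3) h3
  obtain ⟨r4', t4', ht4', hrt4, x4⟩ := opp l r4 (-1) t4 (by simp) ht4 hr4 (hl' _ hr4) h4
  set T : Finset (Fin 4 → ℤ) := {p, p + Pi.single k 1 + Pi.single r1 t1,
    p + Pi.single k (-1) + Pi.single r2 t2, p + Pi.single l 1 + Pi.single r3 t3,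
    p + Pi.single l (-1) + Pi.single r4 t4} with hT
  have hTF : T ⊆ F := by
    intro y hy
    simp only [hT, Finset.mem_insert, Finset.mem_singleton] at hy
    rcases hy with rfl | rfl | rfl | rfl | rfl <;> assumption
  have hTcard : T.card = 5 := by
    let φ : (Fin 4 → ℤ) → ℤ × ℤ := fun w => (w k - p k, w l - p l)
    have himg : T.image φ = {(0, 0), (1, 0), (-1, 0), (0, 1), (0, -1)} := by
      simp only [hT, Finset.image_insert, Finset.image_singleton, φ]
      simp [hkl, hkl.symm, hk' _ hr1, hk' _ hr2, hk' _ hr3, hk' _ hr4, hl' _ hr1, hl' _ hr2,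
        hl' _ hr3, hl' _ hr4]
    have h5 : ({(0, 0), (1, 0), (-1, 0), (0, 1), (0, -1)} : Finset (ℤ × ℤ)).card = 5 := by decide
    have h5' : T.card ≤ 5 := Finset.card_le_five
    have := Finset.card_image_le (s := T) (f := φ)
    rw [himg, h5] at this
    omega
  have hTs : ∀ y ∈ T, ∀ r, p r % 2 = 1 → |y r - p r| ≤ 1 := by
    intro y hy r hr
    simp only [hT, Finset.mem_insert, Finset.mem_singleton] at hy
    rcases hy with rfl | rfl | rfl | rfl | rfl
    · simp
    · exact abs_offset_le hk ht1 hr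
    · exact abs_offset_le hk ht2 hr
    · exact abs_offset_le hl ht3 hr
    · exact abs_offset_le hl ht4 hr
  -- Beyond a side the displacement along `r` is at least two, whereas it is at most one on `T`
  -- along every direction of `p`.
  have far : ∀ (m r r' : Fin 4) (s t t' : ℤ), (t = 1 ∨ t = -1) → (t' = 1 ∨ t' = -1) →
      p r % 2 = 1 → m ≠ r → ¬ (r' = r ∧ t' = -t) →
      p + Pi.single m s + Pi.single r (2 * t) + Pi.single r' t' ∉ T := by
    intro m r r' s t t' ht ht' hr hmr hrt hmem
    have := hTs _ hmem r hr
    rw [abs_le] at this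
    simp only [Pi.add_apply, Pi.single_apply] at this
    split_ifs at this <;> omega
  have uniq : ∀ x ∈ F, ∀ y ∈ F, x ∉ T → y ∉ T → x = y := by
    intro x hx y hy hxT hyT
    by_contra hne
    have hsub : insert x (insert y T) ⊆ F :=
      Finset.insert_subset hx (Finset.insert_subset hy hTF)
    have := Finset.card_le_card hsub
    rw [Finset.card_insert_of_notMem (by simp [hne, hxT]), Finset.card_insert_of_notMem hyT,
      hTcard] at this
    omega
  have n1 := far k r1 r1' 1 t1 t1' ht1 ht1' hr1 (hk' _ hr1) hrt1
  have n2 := far k r2 r2' (-1) t2 t2' ht2 ht2' hr2 (hk' _ hr2) hrt2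
  have n3 := far l r3 r3' 1 t3 t3' ht3 ht3' hr3 (hl' _ hr3) hrt3
  have n4 := far l r4 r4' (-1) t4 t4' ht4 ht4' hr4 (hl' _ hr4) hrt4
  -- Comparison of opposite sides shows that the sixth plaquette is straight across from `p`, at `p
  -- + 2 t_i u_{r_i}` for each side; hence all the pairs `(r_i, t_i)` agree.
  obtain ⟨⟨rfl, rfl⟩, rfl, rfl⟩ := cancel_opposite (hk' _ hr1) (hk' _ hr2)
    ht1' ht2' (uniq _ x1 _ x2 n1 n2)
  obtain ⟨⟨rfl, rfl⟩, rfl, rfl⟩ := cancel_opposite (hl' _ hr3) (hl' _ hr4)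
    ht3' ht4' (uniq _ x3 _ x4 n3 n4)
  have c1 := add_sub_offset (p := p) r2' r1 1 t1
  have c2 := add_sub_offset (p := p) r2' r2 (-1) t2
  have c3 := add_sub_offset (p := p) r4' r3 1 t3
  have c4 := add_sub_offset (p := p) r4' r4 (-1) t4
  rw [neg_neg] at c2 c4
  obtain ⟨rfl, rfl⟩ := offset_inj (p := p) (r := r1) (r' := r2) (t' := t2) ht1 (by rw [← c1, ← c2]; exact uniq _ x1 _ x2 n1 n2)
  obtain ⟨rfl, rfl⟩ := offset_inj (p := p) (r := r2) (r' := r3) (t' := t3) ht1 (by rw [← c1, ← c3]; exact uniq _ x1 _ x3 n1 n3)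
  obtain ⟨rfl, rfl⟩ := offset_inj (p := p) (r := r3) (r' := r4) (t' := t4) ht1 (by rw [← c1, ← c4]; exact uniq _ x1 _ x4 n1 n4)
  refine ⟨r4, t4, ht1, hr1, ?_⟩
  rw [c1] at x1 n1
  have hins : insert (p + Pi.single r4 (2 * t4)) T = F := by
    refine Finset.eq_of_subset_of_card_le (Finset.insert_subset x1 hTF) ?_
    rw [Finset.card_insert_of_notMem n1, hTcard]; exact hcard
  rw [← hins, hT, star_eq_insert]

/-- Within the star, the 3-cell between `p` and a side contains only these two plaquettes, so
without `p` the sides are absent as well. The plaquette across from `p` is then alone in its 3-cell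
in direction `k`. -/
lemma NoFreeFace.eq_empty_of_subset_star {k l r : Fin 4} {t : ℤ} (hF : NoFreeFace N F)
    (hb : ∀ m, -(2 * N : ℤ) + 2 ≤ p m ∧ p m ≤ 2 * N - 2) (hkr : k ≠ r) (hlr : l ≠ r)
    (hk : p k % 2 = 0) (hr : p r % 2 = 1) (ht : t = 1 ∨ t = -1)
    (hsub : F ⊆ star p k l r t) (hp : p ∉ F) : F = ∅ := by
  have hbk := hb k
  have hbr := hb r
  have hstar : ∀ v ∈ F, v r = p r + t ∨ v = p + Pi.single r (2 * t) := by
    intro v hv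
    have h1 := hsub hv
    simp only [star, Finset.mem_insert, Finset.mem_singleton] at h1
    rcases h1 with rfl | rfl | rfl | rfl | rfl | rfl
    · exact absurd hv hp
    all_goals simp [hkr.symm, hlr.symm]
  have hside : ∀ v ∈ F, v r ≠ p r + t := by
    intro v hv hvr
    obtain ⟨r', t', ht', -, hrt, h⟩ := hF v hv r (by omega) (-t) (by omega) (by omega) (by omega)
    rcases hstar _ h with h1 | h1
    · simp only [Pi.add_apply, Pi.single_apply] at h1
      split_ifs at h1 <;> omega
    · have h1 := congrFun h1 r
      simp only [Pi.add_apply, Pi.single_apply] at h1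
      split_ifs at h1 <;> omega
  rw [Finset.eq_empty_iff_forall_notMem]
  intro v hv
  have hv' := (hstar v hv).resolve_left (hside v hv)
  have hvk : v k = p k := by rw [hv']; simp [hkr]
  obtain ⟨r', t', ht', -, hrt, h⟩ := hF v hv k (by omega) 1 (by simp) (by omega) (by omega)
  have h1 := (hstar _ h).resolve_left (hside _ h)
  rw [← hv'] at h1
  have h1 := congrFun h1 k
  simp only [Pi.add_apply, Pi.single_apply] at h1
  split_ifs at h1 <;> omega

end Classify

/-! ### Closed 2-forms with few plaquettes -/

section Vortex

variable {N : ℕ} {G : Type} [AddCommGroup G]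

lemma smul_ne_zero_of_unit {u : ℤ} (hu : u = 1 ∨ u = -1) {g : G} (hg : g ≠ 0) : u • g ≠ 0 := by
  rcases hu with rfl | rfl <;> simpa

lemma smul_smul_of_unit {u : ℤ} (hu : u = 1 ∨ u = -1) (g : G) : u • u • g = g := by
  rcases hu with rfl | rfl <;> simp

open Classical in
/-- The form with value `g` on the cell `e` and zero elsewhere. -/
def Form.single {k : ℕ} (e : {e : Cell k // e ∈ cells k N}) (g : G) : Form k N G := Pi.single e g

lemma Form.single_eval {k : ℕ} (e : {e : Cell k // e ∈ cells k N}) (g : G) (q : Chain k) :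
    (Form.single e g).eval q = q e.1 • g := by
  classical
  rw [Form.eval, Finset.sum_eq_single e]
  · simp [Form.single]
  · intro c _ hc
    simp [Form.single, hc]
  · simp

lemma Form.single_d {k : ℕ} (e : {e : Cell k // e ∈ cells k N}) (g : G)
    (c : {c : Cell (k + 1) // c ∈ cells (k + 1) N}) :
    (Form.single e g).d c = boundaryCell c.1 e.1 • g :=
  Form.single_eval e g _

lemma Form.d_sub {k : ℕ} (ω ω' : Form k N G) : (ω - ω').d = ω.d - ω'.d := by
  ext c
  simp [Form.d, Form.eval, smul_sub]

lemma Form.d_add {k : ℕ} (ω ω' : Form k N G) : (ω + ω').d = ω.d + ω'.d := by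
  ext c
  simp [Form.d, Form.eval, smul_add, Finset.sum_add_distrib]

lemma Form.eval_add_form {k : ℕ} (ω ω' : Form k N G) (q : Chain k) :
    (ω + ω').eval q = ω.eval q + ω'.eval q := by
  simp [Form.eval, smul_add, Finset.sum_add_distrib]

lemma Form.mem_posSupport {k : ℕ} {ω : Form k N G} {c : {c : Cell k // c ∈ cells k N}} :
    c ∈ ω.posSupport ↔ ω c ≠ 0 := by
  simp [Form.posSupport]

/-- Otherwise `dν` on `c` would be the single term `±ν(q)`. -/
lemma Form.exists_neighbour {k : ℕ} {ν : Form k N G} (hν : ν.d = 0)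
    {q : {q : Cell k // q ∈ cells k N}} (hq : ν q ≠ 0)
    {c : Cell (k + 1)} (hc : c ∈ cells (k + 1) N) (hcq : boundaryCell c q.1 ≠ 0) :
    ∃ q' : {q : Cell k // q ∈ cells k N}, q' ≠ q ∧ ν q' ≠ 0 ∧ boundaryCell c q'.1 ≠ 0 := by
  by_contra hcon
  push Not at hcon
  have h := congrFun hν ⟨c, hc⟩
  rw [Form.d, Form.eval, Finset.sum_eq_single q] at h
  · exact smul_ne_zero_of_unit (boundaryCell_eq_or hcq) hq h
  · intro q' _ hne
    by_cases h0 : ν q' = 0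
    · rw [h0, smul_zero]
    · rw [hcon q' hne h0, zero_smul]
  · simp

lemma Form.noFreeFace {ν : Form 2 N G} (hν : ν.d = 0) :
    NoFreeFace N (ν.posSupport.image fun q => bary q.1) := by
  intro v hv m hm s hs h1 h2
  obtain ⟨q, hq, rfl⟩ := Finset.mem_image.1 hv
  have hmq : m ∉ q.1.2.1 := by rw [bary_emod]; omega
  set c := cofaceCell q.1 ⟨m, hmq⟩ (decide (s = 1)) with hc
  have hbc : bary c = bary q.1 + Pi.single m s := by
    rw [hc, bary_cofaceCell]
    rcases hs with rfl | rfl <;> simp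
  have hcN : c ∈ cells 3 N := by
    rw [bary_mem_boxRegion]
    intro i
    have := bary_mem_boxRegion.1 q.2 i
    rw [hbc]
    by_cases hi : i = m
    · subst hi; simpa using ⟨h1, h2⟩
    · simpa [hi] using this
  obtain ⟨q', hne, hq', hbd⟩ := Form.exists_neighbour hν (Form.mem_posSupport.1 hq) hcN
    (boundaryCell_ne_zero_iff.2 ⟨m, s, hs, hbc⟩)
  obtain ⟨r, t, ht, hbt⟩ := boundaryCell_ne_zero_iff.1 hbd
  have hrc := (mem_of_bary_eq_add ht hbt).1
  have hq'' : bary q'.1 = bary q.1 + Pi.single m s + Pi.single r (-t) := by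
    rw [← hbc, hbt, Pi.single_neg]; abel
  refine ⟨r, -t, by omega, ?_, ?_, ?_⟩
  · by_cases hrm : r = m
    · exact Or.inl hrm
    · right
      rw [bary_emod, hbc] at hrc
      simpa [hrm] using hrc
  · rintro ⟨rfl, h⟩
    refine hne (Subtype.ext (bary_injective ?_))
    rw [hq'', h, Pi.single_neg]; abel
  · rw [← hq'']
    exact Finset.mem_image_of_mem (fun q : {q : Cell 2 // q ∈ cells 2 N} => bary q.1)
      (Form.mem_posSupport.2 hq')

lemma exists_face {k : ℕ} (c : Cell (k + 1)) {r : Fin 4} (hr : r ∈ c.2.1) {t : ℤ}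
    (ht : t = 1 ∨ t = -1) : ∃ f : Cell k, bary f = bary c + Pi.single r t := by
  refine ⟨c.face ⟨r, hr⟩ (c.1 + if t = 1 then Pi.single r 1 else 0), funext fun i => ?_⟩
  by_cases hi : i = r
  · subst hi
    rcases ht with rfl | rfl <;> simp [bary, Cell.face, hr]; ring
  · rcases ht with rfl | rfl <;> simp [bary, Cell.face, hi]

/-- A closed `2`-form with at most six plaquettes in its support, one of which is away from the
boundary of the box, is the vortex around a single edge. -/
lemma Form.eq_single_d_of_card_le {ν : Form 2 N G} (hν : ν.d = 0) (hcard : ν.posSupport.card ≤ 6)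
    {p : {p : Cell 2 // p ∈ cells 2 N}} (hp : ν p ≠ 0)
    (hb : ∀ m, -(2 * N : ℤ) + 2 ≤ bary p.1 m ∧ bary p.1 m ≤ 2 * N - 2) :
    ∃ (e : {e : Cell 1 // e ∈ cells 1 N}) (g : G), g ≠ 0 ∧ ν = (Form.single e g).d := by
  have hcompl : (p.1.2.1ᶜ).card = 2 := by
    rw [Finset.card_compl, p.1.2.2]; rfl
  obtain ⟨k, l, hkl, hS⟩ := Finset.card_eq_two.1 hcompl
  have hk : k ∉ p.1.2.1 := by rw [← Finset.mem_compl, hS]; simp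
  have hl : l ∉ p.1.2.1 := by rw [← Finset.mem_compl, hS]; simp
  have hk2 : bary p.1 k % 2 = 0 := by rw [bary_emod] at hk; omega
  have hl2 : bary p.1 l % 2 = 0 := by rw [bary_emod] at hl; omega
  obtain ⟨r, t, ht, hr, hF⟩ := (Form.noFreeFace hν).eq_star
    (Finset.card_image_le.trans hcard)
    (Finset.mem_image_of_mem (fun q : {q : Cell 2 // q ∈ cells 2 N} => bary q.1)
      (Form.mem_posSupport.2 hp)) hb hkl hk2 hl2
  have hrp := (bary_emod p.1 r).2 hr
  have hkr : k ≠ r := fun h => hk (h ▸ hrp)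
  have hlr : l ≠ r := fun h => hl (h ▸ hrp)
  obtain ⟨e, he⟩ := exists_face p.1 hrp ht
  have heN : e ∈ cells 1 N := by
    rw [bary_mem_boxRegion]
    intro i
    have := hb i
    rw [he]
    simp only [Pi.add_apply, Pi.single_apply]
    split_ifs <;> omega
  have hpe : boundaryCell p.1 e ≠ 0 := boundaryCell_ne_zero_iff.2 ⟨r, -t, by omega, by
    rw [he, Pi.single_neg]; abel⟩
  refine ⟨⟨e, heN⟩, boundaryCell p.1 e • ν p, smul_ne_zero_of_unit (boundaryCell_eq_or hpe) hp, ?_⟩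
  -- The incidence number is its own inverse, so the chosen value cancels `ν` at `p`. The difference
  -- is closed, supported in the star and zero at `p`, hence zero.
  set ω : Form 2 N G := ν - (Form.single ⟨e, heN⟩ (boundaryCell p.1 e • ν p)).d with hω
  have hωd : ω.d = 0 := by rw [hω, Form.d_sub, hν, Form.d_d, sub_zero]
  have hempty := (Form.noFreeFace hωd).eq_empty_of_subset_star (p := bary p.1) (k := k) (l := l)
    (r := r) (t := t) hb hkr hlr hk2 hr ht (by
      intro v hv
      obtain ⟨q, hq, rfl⟩ := Finset.mem_image.1 hv
      by_cases hνq : ν q = 0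
      · have hq := Form.mem_posSupport.1 hq
        rw [hω, Pi.sub_apply, hνq, zero_sub, neg_ne_zero, Form.single_d] at hq
        have hqe : boundaryCell q.1 e ≠ 0 := fun h => hq (by rw [h, zero_smul])
        obtain ⟨j, s, hs, hj⟩ := boundaryCell_ne_zero_iff.1 hqe
        have hje := (mem_of_bary_eq_add hs hj).2
        have hj' : j = r ∨ j = k ∨ j = l := by
          by_contra hcon
          push Not at hcon
          have hjp : j ∈ p.1.2.1 := by
            by_contra h
            rw [← Finset.mem_compl, hS] at h
            simp [hcon.2.1, hcon.2.2] at h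
          rw [bary_emod, he] at hje
          rw [bary_emod] at hjp
          simp [hcon.1, hjp] at hje
        have hq' : bary q.1 = bary p.1 + Pi.single j s + Pi.single r t := by
          rw [hj, he]; abel
        simp only [hq', star, Finset.mem_insert, Finset.mem_singleton]
        rcases hj' with rfl | rfl | rfl
        · rcases hs with rfl | rfl <;> rcases ht with rfl | rfl
          · iterate 5 right
            rw [add_assoc, ← Pi.single_add]; rfl
          · left; rw [Pi.single_neg]; abel
          · left; rw [Pi.single_neg]; abel
          · iterate 5 right
            rw [add_assoc, ← Pi.single_add]; rfl
        · rcases hs with rfl | rfl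
          · right; left; rfl
          · right; right; left; rfl
        · rcases hs with rfl | rfl
          · right; right; right; left; rfl
          · right; right; right; right; left; rfl
      · rw [← hF]
        exact Finset.mem_image_of_mem (fun q : {q : Cell 2 // q ∈ cells 2 N} => bary q.1)
          (Form.mem_posSupport.2 hνq))
    (by
      intro hmem
      obtain ⟨q, hq, hqp⟩ := Finset.mem_image.1 hmem
      have : q = p := Subtype.ext (bary_injective hqp)
      subst this
      refine Form.mem_posSupport.1 hq ?_
      rw [hω, Pi.sub_apply, Form.single_d, smul_smul_of_unit (boundaryCell_eq_or hpe), sub_self])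
  have hω0 : ω = 0 := by
    ext q
    by_contra hq
    have := Finset.mem_image_of_mem (fun q : {q : Cell 2 // q ∈ cells 2 N} => bary q.1)
      (Form.mem_posSupport.2 hq)
    rw [hempty] at this
    simp at this
  exact sub_eq_zero.1 hω0

end Vortex

end

end LatticeGauge

namespace LatticeGauge

noncomputable section

open Finsupp

/-! ### Vortices away from a loop -/

/-- Additivity of oriented interval sums, obtained from the primitive `F` of `f`. -/
lemma sum_Ico_add {M : Type*} [AddCommGroup M] (f : ℤ → M) (s s' x : ℤ) :
    (∑ t ∈ Finset.Ico s x, f t - ∑ t ∈ Finset.Ico x s, f t) =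
      (∑ t ∈ Finset.Ico s s', f t - ∑ t ∈ Finset.Ico s' s, f t) +
        (∑ t ∈ Finset.Ico s' x, f t - ∑ t ∈ Finset.Ico x s', f t) := by
  set F : ℤ → M := fun x => ∑ t ∈ Finset.Ico 0 x, f t - ∑ t ∈ Finset.Ico x 0, f t with hF
  have h1 : ∀ t, f t = F (t + 1) - F t := fun t => (sum_Ico_add_one f 0 t).symm
  have h2 : ∀ s x, (∑ t ∈ Finset.Ico s x, f t - ∑ t ∈ Finset.Ico x s, f t) = F x - F s :=
    fun s x => by
      rw [Finset.sum_congr rfl fun t _ => h1 t, Finset.sum_congr (s₁ := Finset.Ico x s) rfl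
        fun t _ => h1 t]
      exact sum_Ico_telescope F s x
  rw [h2, h2, h2]; abel

/-- A sweep to level `s` may pass through level `s'`. This is used to go around the cube: up to the
top of the box first, and from there down to the bottom. -/
lemma sweep_eq_add (k : Fin 4) (s s' : ℤ) (z : TChain) :
    sweep k s z = sweep k s (proj k s' z) + sweep k s' z := by
  have : sweep k s = sweep k s ∘ₗ proj k s' + sweep k s' := by
    refine tchain_hom_ext fun c => ?_
    simp only [LinearMap.add_apply, LinearMap.comp_apply, sweep_single, proj_single]
    split_ifs with hk
    · simp
    · rw [sweep_single, if_neg hk, ← smul_add]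
      congr 1
      simp only [column, Function.update_self, Function.update_idem]
      exact sum_Ico_add (fun t => (single (Function.update c.1 k t, insert k c.2) 1 : TChain)) s s' _
  exact LinearMap.congr_fun this z

lemma tboundary_mem {R R' : Set TCell}
    (h : ∀ x S, (x, S) ∈ R → ∀ j ∈ S, (x + Pi.single j 1, S.erase j) ∈ R' ∧ (x, S.erase j) ∈ R')
    {z : TChain} (hz : z ∈ supported ℤ ℤ R) : tboundary z ∈ supported ℤ ℤ R' := by
  rw [tboundary, LinearMap.sum_apply]
  refine Submodule.sum_mem _ fun j _ => linearCombination_mem_of_supported (fun c hc => ?_) hz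
  split_ifs with hj
  · exact Submodule.smul_mem _ _ (Submodule.sub_mem _ (single_mem_supported ℤ _ (h _ _ hc j hj).1)
      (single_mem_supported ℤ _ (h _ _ hc j hj).2))
  · exact Submodule.zero_mem _

/-- The cells in the hyperplane `x_k = s`. -/
def slice (k : Fin 4) (s : ℤ) : Set TCell := {c | c.1 k = s ∧ k ∉ c.2}

lemma sweep_mem_slice {j k : Fin 4} (h : j ≠ k) {s s' : ℤ} {z : TChain}
    (hz : z ∈ supported ℤ ℤ (slice k s)) : sweep j s' z ∈ supported ℤ ℤ (slice k s) :=
  sweep_mem (R := slice k s) (R' := slice k s) (fun x S hx _ t _ =>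
    ⟨by simpa [Function.update_of_ne h.symm] using hx.1, by simpa [h.symm] using hx.2⟩) hz

lemma proj_mem_slice {j k : Fin 4} (h : j ≠ k) {s s' : ℤ} {z : TChain}
    (hz : z ∈ supported ℤ ℤ (slice k s)) : proj j s' z ∈ supported ℤ ℤ (slice k s) :=
  proj_mem (R := slice k s) (R' := slice k s)
    (fun x S hx _ => ⟨by simpa [Function.update_of_ne h.symm] using hx.1, hx.2⟩) hz

lemma proj_mem_slice_self {k : Fin 4} {s : ℤ} (z : TChain) :
    proj k s z ∈ supported ℤ ℤ (slice k s) :=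
  proj_mem (R := Set.univ) (R' := slice k s) (fun x S _ hk => ⟨by simp, hk⟩) (by simp [supported_univ])

lemma proj_mem_dimCells {m : ℕ} {k : Fin 4} {s : ℤ} {z : TChain}
    (hz : z ∈ supported ℤ ℤ (dimCells m)) : proj k s z ∈ supported ℤ ℤ (dimCells m) :=
  proj_mem (fun _ _ hx _ => hx) hz

section Far

variable {N w : ℕ} {G : Type} [AddCommGroup G] {ν : Form 2 N G} {a : Fin 4 → ℤ}

lemma Form.tot_eq_zero_of_slice (hsupp : ∀ c, ν.tot c ≠ 0 → c ∈ region a (fun i => a i + w))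
    {k : Fin 4} {s : ℤ} (hs : s < a k ∨ a k + w < s) {z : TChain}
    (hz : z ∈ supported ℤ ℤ (slice k s)) : ν.lin z = 0 := by
  refine ν.lin_eq_zero (fun c hc => ?_) hz
  by_contra hne
  have h1 := hsupp c hne k
  have h2 := hc.1
  simp only [hc.2, if_false] at h1
  omega

/-- If `y` is a `2`-chain that does not see `ν` then neither does the sweep of its boundary. -/
lemma Form.lin_sweep_tboundary (hν : ν.d = 0)
    (hsupp : ∀ c, ν.tot c ≠ 0 → c ∈ region a (fun i => a i + w))
    {k : Fin 4} {s : ℤ} (hs : s < a k ∨ a k + w < s) (hsN : -(N : ℤ) ≤ s) (hsN' : s ≤ N)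
    {y : TChain} (hy : y ∈ supported ℤ ℤ (boxRegion N)) (hy' : y ∈ supported ℤ ℤ (dimCells 2)) :
    ν.lin (sweep k s (tboundary y)) = ν.lin y := by
  have h := congrArg ν.lin (homotopy k s y)
  rw [map_add, map_sub, Form.lin_tboundary_eq_zero hν (sweep_mem_region hsN hsN' hy)
    (sweep_mem_dimCells hy'), Form.tot_eq_zero_of_slice hsupp hs (proj_mem_slice_self y),
    zero_add, sub_zero] at h
  exact h

/-- A closed form that vanishes outside a cube in the interior of the box does not see a chain
whose boundary avoids a neighbourhood of the cube. -/
lemma Form.lin_eq_zero_of_interior (hν : ν.d = 0)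
    (hsupp : ∀ c, ν.tot c ≠ 0 → c ∈ region a (fun i => a i + w))
    (hlo : ∀ k, -(N : ℤ) < a k - 1) (hhi : ∀ k, a k + w + 1 < N) {q : TChain}
    (hq : q ∈ supported ℤ ℤ (boxRegion N)) (hq' : q ∈ supported ℤ ℤ (dimCells 2))
    (hg : tboundary q ∈ supported ℤ ℤ (boxRegion N))
    (hg' : tboundary q ∈ supported ℤ ℤ (dimCells 1))
    (hav : ∀ c ∈ (tboundary q).support, c.1 ∉ cube (a - 1) (w + 2) ∧
      (c.1 + fun i => if i ∈ c.2 then 1 else 0) ∉ cube (a - 1) (w + 2)) : ν.lin q = 0 := by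
  classical
  have hN : ∀ k, -(N : ℤ) < a k ∨ a k + w < -(N : ℤ) := fun k => Or.inl (by have := hlo k; omega)
  have hN' : ∀ k, (N : ℤ) < a k ∨ a k + w < (N : ℤ) := fun k => Or.inr (by have := hhi k; omega)
  have hNN : -(N : ℤ) ≤ N := by omega
  set g := tboundary q with hgdef
  have hgg : tboundary g = 0 := tboundary_tboundary q
  -- From here on only the boundary `g` matters, swept down in direction 0.
  have h0 : ν.lin q = ν.lin (sweep 0 (-N) g) :=
    (Form.lin_sweep_tboundary hν hsupp (hN 0) le_rfl hNN hq hq').symm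
  -- the parts of the boundary above and below the top of the cube
  set P : TCell → Prop := fun c => a 0 + w + 1 ≤ c.1 0 with hP
  set gp := g.filter P with hgp
  set gm := g.filter (fun c => ¬ P c) with hgm
  have hsplit : gp + gm = g := Finsupp.filter_add_filter_not g P
  have hgp_mem : gp ∈ supported ℤ ℤ {c | c ∈ g.support ∧ P c} := fun c hc => by
    rw [hgp, Finset.mem_coe, Finsupp.support_filter, Finset.mem_filter] at hc; exact hc
  have hgm_mem : gm ∈ supported ℤ ℤ {c | c ∈ g.support ∧ ¬ P c} := fun c hc => by
    rw [hgm, Finset.mem_coe, Finsupp.support_filter, Finset.mem_filter] at hc; exact hc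
  have hgpN : gp ∈ supported ℤ ℤ (boxRegion N) := fun c hc => hg (hgp_mem hc).1
  have hgpd : gp ∈ supported ℤ ℤ (dimCells 1) := fun c hc => hg' (hgp_mem hc).1
  -- A cell that starts at most as high as the top of the cube and meets the cube on its way down
  -- must itself start in the enlarged cube.
  have hm0 : ν.lin (sweep 0 (-N) gm) = 0 := by
    refine ν.lin_eq_zero (R := {c | ν.tot c = 0}) (fun c hc => hc) (sweep_mem ?_ hgm_mem)
    rintro x S ⟨hx, hPx⟩ h0S t ht
    by_contra hne
    have h1 := hsupp _ hne
    refine (hav _ hx).1 fun i => ?_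
    have h2 := h1 i
    have h3 := hg hx 0
    simp only [hP, not_le] at hPx
    by_cases hi : i = 0
    · subst hi
      simp at h2 h3 ⊢; omega
    · simp [Function.update_of_ne hi] at h2 ⊢
      split_ifs at h2 <;> omega
  have htop : ν.lin (sweep 0 N gp) = 0 := by
    refine ν.lin_eq_zero (R := {c | ν.tot c = 0}) (fun c hc => hc) (sweep_mem ?_ hgp_mem)
    rintro x S ⟨hx, hPx⟩ h0S t ht
    by_contra hne
    have h2 := hsupp _ hne 0
    have h3 := hg hx 0
    simp only [hP] at hPx
    simp at h2 h3
    split_ifs at h3; omega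
  set z := proj 0 (N : ℤ) gp with hz
  have hzN : z ∈ supported ℤ ℤ (boxRegion N) := proj_mem_region hNN le_rfl hgpN
  have hz0 : z ∈ supported ℤ ℤ (slice 0 N) := proj_mem_slice_self gp
  have hzd : z ∈ supported ℤ ℤ (dimCells 1) := proj_mem_dimCells hgpd
  have hb1 : ν.lin (sweep 0 (-N) g) = ν.lin (sweep 0 (-N) z) := by
    rw [← hsplit, map_add, map_add, hm0, add_zero, sweep_eq_add 0 (-N) N gp, map_add, htop,
      add_zero]
  -- The part above the cube has been moved to the top face of the box. There it is moved in
  -- direction 1 to the side of the cube, at the cost of a boundary, which `ν` does not see, and of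
  -- the sweep of its end points.
  have hdz : z = proj 1 (-N) z + tboundary (sweep 1 (-N) z) + sweep 1 (-N) (tboundary z) := by
    have := homotopy 1 (-N) z
    rw [add_assoc, this]; abel
  have hz1 : ν.lin (sweep 0 (-N) (proj 1 (-N) z)) = 0 :=
    Form.tot_eq_zero_of_slice hsupp (hN 1)
      (sweep_mem_slice (by decide) (proj_mem_slice_self z))
  have hz2 : ν.lin (sweep 0 (-N) (tboundary (sweep 1 (-N) z))) = 0 := by
    rw [Form.lin_sweep_tboundary hν hsupp (hN 0) le_rfl hNN (sweep_mem_region le_rfl hNN hzN)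
      (sweep_mem_dimCells hzd)]
    exact Form.tot_eq_zero_of_slice hsupp (hN' 0) (sweep_mem_slice (by decide) hz0)
  -- the vertices where the loop crosses the top of the cube
  set u := tboundary gp with hu
  have hu1 : u ∈ supported ℤ ℤ {c | c.2 = ∅ ∧ c ∈ boxRegion N ∧ c.1 ∉ cube (a - 1) (w + 2) ∧
      a 0 + w + 1 ≤ c.1 0} := by
    refine tboundary_mem ?_ hgp_mem
    rintro x S ⟨hx, hPx⟩ j hj
    have hS : S = {j} := by
      obtain ⟨j', hj'⟩ := Finset.card_eq_one.1 (show S.card = 1 from hg' hx)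
      subst hj'
      rw [Finset.mem_singleton.1 hj]
    subst hS
    have h1 := hav _ hx
    have h3 := hg hx
    have hind : (fun i => if i ∈ ({j} : Finset (Fin 4)) then (1 : ℤ) else 0) = Pi.single j 1 := by
      ext i; simp [Pi.single_apply]
    simp only [hind] at h1
    refine ⟨⟨by simp, fun i => ?_, h1.2, ?_⟩, by simp, fun i => ?_, h1.1, hPx⟩
    · have := h3 i
      simp only [Finset.mem_singleton, Finset.erase_singleton, Finset.notMem_empty, if_false,
        Pi.add_apply, Pi.single_apply] at this ⊢
      split_ifs at this ⊢ <;> omega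
    · simp only [hP] at hPx
      simp only [Pi.add_apply, Pi.single_apply]
      split_ifs <;> omega
    · have := h3 i
      simp only [Finset.mem_singleton, Finset.erase_singleton, Finset.notMem_empty, if_false] at this ⊢
      split_ifs at this ⊢ <;> omega
  -- As `g` is a cycle, `u` is also minus the boundary of the lower part; so its vertices lie
  -- exactly at level `a 0 + w + 1`, still within the range of the enlarged cube in direction 0.
  have hu2 : u ∈ supported ℤ ℤ {c : TCell | c.1 0 ≤ a 0 + w + 1} := by
    have : u = -tboundary gm := by
      rw [eq_neg_iff_add_eq_zero, ← map_add, hsplit, hgg]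
    rw [this]
    refine Submodule.neg_mem _ (tboundary_mem ?_ hgm_mem)
    rintro x S ⟨hx, hPx⟩ j hj
    simp only [hP, not_le] at hPx
    constructor
    · simp only [Set.mem_ofPred_eq, Pi.add_apply, Pi.single_apply]
      split_ifs <;> omega
    · simp only [Set.mem_ofPred_eq]; omega
  have huN : u ∈ supported ℤ ℤ (boxRegion N) := fun c hc => (hu1 hc).2.1
  have hud : u ∈ supported ℤ ℤ (dimCells 0) := fun c hc => by
    simp [dimCells, (hu1 hc).1]
  set P' : TCell → Prop := fun c => a 1 + w + 1 ≤ c.1 1 with hP'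
  set up := u.filter P' with hup
  set um := u.filter (fun c => ¬ P' c) with hum
  have husplit : up + um = u := Finsupp.filter_add_filter_not u P'
  have hup_mem : up ∈ supported ℤ ℤ {c | c ∈ u.support ∧ P' c} := fun c hc => by
    rw [hup, Finset.mem_coe, Finsupp.support_filter, Finset.mem_filter] at hc; exact hc
  have hum_mem : um ∈ supported ℤ ℤ {c | c ∈ u.support ∧ ¬ P' c} := fun c hc => by
    rw [hum, Finset.mem_coe, Finsupp.support_filter, Finset.mem_filter] at hc; exact hc
  have hupN : up ∈ supported ℤ ℤ (boxRegion N) := fun c hc => huN (hup_mem hc).1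
  have hupd : up ∈ supported ℤ ℤ (dimCells 0) := fun c hc => hud (hup_mem hc).1
  -- A cell of this double sweep in the cube would force its starting vertex into the enlarged cube.
  have hum0 : ν.lin (sweep 0 (-N) (sweep 1 (-N) (proj 0 N um))) = 0 := by
    refine ν.lin_eq_zero (R := {c | ν.tot c = 0}) (fun c hc => hc) ?_
    refine sweep_mem (R := {c | ∀ t, ν.tot (Function.update c.1 0 t, insert 0 c.2) = 0})
      (fun x S hx _ t _ => hx t) ?_
    refine sweep_mem (R := {c | ∀ t' t, -(N : ℤ) ≤ t' → t' < c.1 1 →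
      ν.tot (Function.update (Function.update c.1 1 t') 0 t, insert 0 (insert 1 c.2)) = 0}) ?_ ?_
    · intro x S hx _ t' ht' t
      by_cases h : t' < x 1
      · exact hx t' t (by omega) h
      · have : (Function.update (Function.update x 1 t') 0 t, insert 0 (insert 1 S)) ∉
            region a (fun i => a i + w) := fun hmem => by
          have h1 := hmem 1
          have h2 := hlo 1
          simp at h1
          omega
        by_contra hne
        exact this (hsupp _ hne)
    · refine proj_mem ?_ hum_mem
      rintro x S ⟨hx, hPx⟩ _ t' t ht' hlt
      simp only at hlt ⊢
      by_contra hne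
      have h1 := hsupp _ hne
      have hx1 := hu1 hx
      have hx2 := hu2 hx
      refine hx1.2.2.1 fun i => ?_
      have h2 := h1 i
      simp only [hP', not_le] at hPx
      simp only [Set.mem_ofPred_eq] at hx2
      have hx3 := hx1.2.2.2
      by_cases hi0 : i = 0
      · subst hi0; simp at h2 hx2 hx3 ⊢; omega
      · by_cases hi1 : i = 1
        · subst hi1; simp at h2 hlt hPx ⊢; omega
        · simp [hi0, hi1] at h2 ⊢
          split_ifs at h2 <;> omega
  have hup0 : ν.lin (sweep 0 (-N) (sweep 1 N (proj 0 N up))) = 0 := by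
    refine ν.lin_eq_zero (R := {c | ν.tot c = 0}) (fun c hc => hc) ?_
    refine sweep_mem (R := {c | a 1 + w < c.1 1})
      (fun x S hx _ t _ => ?_) (sweep_mem (R := {c | a 1 + w < c.1 1 ∧ c.1 1 ≤ N}) ?_ ?_)
    · by_contra hne
      have h2 := hsupp _ hne 1
      simp at h2 hx
      split_ifs at h2 <;> omega
    · intro x S hx _ t ht
      simp at hx ⊢
      omega
    · refine proj_mem ?_ hup_mem
      rintro x S ⟨hx, hPx⟩ _
      have := huN hx 1
      simp only [hP'] at hPx
      simp at this ⊢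
      split_ifs at this <;> omega
  set V := proj 1 (N : ℤ) (proj 0 N up) with hV
  have hVN : V ∈ supported ℤ ℤ (boxRegion N) :=
    proj_mem_region hNN le_rfl (proj_mem_region hNN le_rfl hupN)
  have hVd : V ∈ supported ℤ ℤ (dimCells 0) := proj_mem_dimCells (proj_mem_dimCells hupd)
  have hV0 : V ∈ supported ℤ ℤ (slice 0 N) := proj_mem_slice (by decide) (proj_mem_slice_self up)
  have hV1 : V ∈ supported ℤ ℤ (slice 1 N) := proj_mem_slice_self _
  have hVb : tboundary V = 0 := by
    have : tboundary V ∈ supported ℤ ℤ (∅ : Set TCell) := by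
      refine tboundary_mem ?_ hVd
      intro x S hx j hj
      rw [Finset.card_eq_zero.1 (show S.card = 0 from hx)] at hj
      simp at hj
    simpa using this
  -- The vertices that remain are on two faces of the box. A third direction is free to push them to
  -- `x_2 = -N`; the projected points and all the tracks of the homotopies lie in hyperplanes that
  -- miss the cube.
  have hVV : ν.lin (sweep 0 (-N) (sweep 1 (-N) V)) = 0 := by
    have h := homotopy 2 (-N) V
    rw [hVb, map_zero, add_zero] at h
    set y := sweep 2 (-N) V with hy
    have hyN : y ∈ supported ℤ ℤ (boxRegion N) := sweep_mem_region le_rfl hNN hVN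
    have hyd : y ∈ supported ℤ ℤ (dimCells 1) := sweep_mem_dimCells hVd
    have hy0 : y ∈ supported ℤ ℤ (slice 0 N) := sweep_mem_slice (by decide) hV0
    have hy1 : y ∈ supported ℤ ℤ (slice 1 N) := sweep_mem_slice (by decide) hV1
    have hVe : V = proj 2 (-N) V + tboundary y := by rw [h]; abel
    have h' := homotopy 1 (-N) y
    have hye : sweep 1 (-N) (tboundary y) = y - proj 1 (-N) y - tboundary (sweep 1 (-N) y) := by
      rw [← h']; abel
    rw [hVe, map_add, map_add, map_add, hye, map_sub, map_sub, map_sub, map_sub,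
      Form.lin_sweep_tboundary hν hsupp (hN 0) le_rfl hNN (sweep_mem_region le_rfl hNN hyN)
      (sweep_mem_dimCells hyd),
      Form.tot_eq_zero_of_slice hsupp (hN 2) (sweep_mem_slice (by decide)
        (sweep_mem_slice (by decide) (proj_mem_slice_self V))),
      Form.tot_eq_zero_of_slice hsupp (hN' 1) (sweep_mem_slice (by decide) hy1),
      Form.tot_eq_zero_of_slice hsupp (hN 1) (sweep_mem_slice (by decide) (proj_mem_slice_self y)),
      Form.tot_eq_zero_of_slice hsupp (hN' 0) (sweep_mem_slice (by decide) hy0)]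
    simp
  have hz3 : ν.lin (sweep 0 (-N) (sweep 1 (-N) (tboundary z))) = 0 := by
    rw [hz, tboundary_proj, ← hu, ← husplit]
    simp only [map_add]
    rw [hum0, add_zero, sweep_eq_add 1 (-N) N (proj 0 N up), map_add, map_add, hup0, add_zero, hVV]
  rw [h0, hb1, hdz, map_add, map_add, map_add, map_add, hz1, hz2, hz3]
  simp

/-- A closed form that is supported in a cube does not see a chain whose nonzero boundary avoids a
neighbourhood of the cube. -/
lemma Form.eval_eq_zero_of_far (hν : ν.d = 0)
    (hsupp : ∀ p ∈ ν.posSupport, Cell.IsIn p.1 (cube a w)) {γ : Chain 1} {q : Chain 2}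
    (hq : q.support ⊆ cells 2 N) (hqγ : boundary q = γ) (hγ : γ.support ⊆ cells 1 N)
    (hγ0 : γ.support.Nonempty)
    (hav : ∀ e ∈ γ.support, e.1 ∉ cube (a - 1) (w + 2) ∧
      (e.1 + fun i => if i ∈ e.2.1 then 1 else 0) ∉ cube (a - 1) (w + 2)) : ν.eval q = 0 := by
  have hs : ∀ c, ν.tot c ≠ 0 → c ∈ region a (fun i => a i + w) := by
    intro c hc
    obtain ⟨p, rfl, hp⟩ := ν.exists_of_tot_ne_zero hc
    exact isIn_cube_iff.1 (hsupp p (Form.mem_posSupport.2 hp))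
  have hQ : toTChain q ∈ supported ℤ ℤ (boxRegion N) :=
    toTChain_mem_supported fun c hc => mem_cells.1 (hq hc)
  have hbd : tboundary (toTChain q) = toTChain γ := by rw [← toTChain_boundary, hqγ]
  have hΓ : toTChain γ ∈ supported ℤ ℤ (boxRegion N) :=
    toTChain_mem_supported fun c hc => mem_cells.1 (hγ hc)
  have hav' : ∀ c ∈ (toTChain γ).support, c.1 ∉ cube (a - 1) (w + 2) ∧
      (c.1 + fun i => if i ∈ c.2 then 1 else 0) ∉ cube (a - 1) (w + 2) := by
    intro c hc
    obtain ⟨e, he, rfl⟩ := mem_support_toTChain hc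
    exact hav e he
  have hNN : -(N : ℤ) ≤ N := by omega
  rw [Form.eval_eq_lin]
  have hself : toTChain γ ∈ supported ℤ ℤ {c | c ∈ (toTChain γ).support} := fun c hc => hc
  -- The enlarged cube reaches the top of the box in direction `k`: whatever falls on the cube from
  -- above would start in the enlarged cube, so sweeping the loop down suffices.
  by_cases htop : ∃ k, -(N : ℤ) ≤ a k - 1 ∧ N ≤ a k + w + 1
  · obtain ⟨k, h1, h2⟩ := htop
    rw [← Form.lin_sweep_tboundary hν hs (k := k) (s := -N) (Or.inl (by omega)) le_rfl hNN hQ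
      (toTChain_mem_dimCells q), hbd]
    refine ν.lin_eq_zero (R := {c | ν.tot c = 0}) (fun c hc => hc) (sweep_mem ?_ hself)
    intro x S hx hk t ht
    by_contra hne
    refine (hav' _ hx).1 fun i => ?_
    have h3 := hs _ hne i
    have h4 := hΓ hx i
    by_cases hi : i = k
    · subst hi; simp [hk] at h3 h4 ⊢; omega
    · simp [hi] at h3 ⊢
      split_ifs at h3 <;> omega
  -- The mirror image: the enlarged cube reaches the bottom, and the loop is swept up.
  by_cases hbot : ∃ k, (a k + w + 1 : ℤ) ≤ N ∧ a k - 1 ≤ -N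
  · obtain ⟨k, h1, h2⟩ := hbot
    rw [← Form.lin_sweep_tboundary hν hs (k := k) (s := N) (Or.inr (by omega)) hNN le_rfl hQ
      (toTChain_mem_dimCells q), hbd]
    refine ν.lin_eq_zero (R := {c | ν.tot c = 0}) (fun c hc => hc) (sweep_mem ?_ hself)
    intro x S hx hk t ht
    by_contra hne
    refine (hav' _ hx).1 fun i => ?_
    have h3 := hs _ hne i
    have h4 := hΓ hx i
    by_cases hi : i = k
    · subst hi; simp [hk] at h3 h4 ⊢; omega
    · simp [hi] at h3 ⊢
      split_ifs at h3 <;> omega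
  push Not at htop hbot
  -- If the enlarged cube sticks out on both sides in one direction, then by the excluded cases it
  -- does so in all of them and contains the box, so it cannot avoid a nonempty loop.
  by_cases hfull : ∃ k, a k - 1 < -(N : ℤ)
  · obtain ⟨k, hk⟩ := hfull
    have hw : (2 * N : ℤ) < w + 2 := by
      by_contra h
      have := hbot k (by omega)
      omega
    obtain ⟨e, he⟩ := hγ0
    refine absurd ?_ (hav e he).1
    intro i
    have h1 := mem_cells.1 (hγ he) i
    have h2 := htop i
    have h3 := hbot i
    simp only [toT] at h1
    simp
    split_ifs at h1 <;> omega
  · push Not at hfull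
    refine Form.lin_eq_zero_of_interior hν hs (fun k => ?_) (fun k => ?_) hQ
      (toTChain_mem_dimCells q) (hbd ▸ hΓ) (hbd ▸ toTChain_mem_dimCells γ)
      (by rw [hbd]; exact hav')
    · have h1 := htop k
      have h2 := hbot k
      have h3 := hfull k
      omega
    · have h1 := htop k
      have h3 := hfull k
      omega

end Far

end

end LatticeGauge

namespace LatticeGauge

noncomputable section

open Finsupp

/-! ### Surfaces spanning a loop -/

lemma boundary_apply {k : ℕ} (q : Chain (k + 1)) (f : Cell k) :
    boundary q f = ∑ c ∈ q.support, q c * boundaryCell c f := by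
  rw [boundary, linearCombination_apply, Finsupp.sum, Finsupp.finsetSum_apply]
  rfl

lemma exists_neighbour_of_boundary_eq_zero {k : ℕ} {γ : Chain (k + 1)} (hγ : boundary γ = 0)
    {e : Cell (k + 1)} (he : e ∈ γ.support) {v : Cell k} (hv : boundaryCell e v ≠ 0) :
    ∃ e' ∈ γ.support, e' ≠ e ∧ boundaryCell e' v ≠ 0 := by
  by_contra hcon
  push Not at hcon
  have h := boundary_apply γ v
  rw [hγ, Finset.sum_eq_single e] at h
  · exact mul_ne_zero (Finsupp.mem_support_iff.1 he) hv h.symm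
  · intro e' he' hne
    rw [hcon e' he' hne, mul_zero]
  · exact fun h => absurd he h

lemma two_le_card_of_boundary_eq_zero {k : ℕ} {γ : Chain (k + 1)} (hγ : boundary γ = 0)
    (h : γ.support.Nonempty) : 2 ≤ γ.support.card := by
  obtain ⟨e, he⟩ := h
  obtain ⟨j, hj⟩ := Finset.card_pos.1 (by rw [e.2.2]; omega : 0 < e.2.1.card)
  obtain ⟨v, hv⟩ := exists_face e hj (t := 1) (Or.inl rfl)
  obtain ⟨e', he', hne, -⟩ := exists_neighbour_of_boundary_eq_zero hγ he
    (boundaryCell_ne_zero_iff.2 ⟨j, -1, Or.inr rfl, by rw [hv, Pi.single_neg]; abel⟩)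
  exact Finset.one_lt_card.2 ⟨e', he', e, he, hne⟩

/-- A loop all of whose adjacent plaquettes are in `B_N` stays away from the boundary of `B_N`. -/
lemma bary_bound_of_loop {N : ℕ} {γ : Chain 1} (hγ : boundary γ = 0)
    (hγN : γ.support ⊆ cells 1 N)
    (hplaq : ∀ e ∈ γ.support, ∀ p : Cell 2, boundaryCell p e ≠ 0 → p ∈ cells 2 N)
    {e : Cell 1} (he : e ∈ γ.support) (i : Fin 4) :
    -(2 * N : ℤ) + 2 ≤ bary e i ∧ bary e i ≤ 2 * N - 2 := by
  have trans : ∀ e ∈ γ.support, ∀ i, i ∉ e.2.1 →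
      -(2 * N : ℤ) + 2 ≤ bary e i ∧ bary e i ≤ 2 * N - 2 := by
    intro e he i hi
    have h : ∀ s : Bool, -(2 * N : ℤ) ≤ bary e i + (if s then 1 else -1) ∧
        bary e i + (if s then 1 else -1) ≤ 2 * N := by
      intro s
      have h1 := hplaq e he (cofaceCell e ⟨i, hi⟩ s) (boundaryCell_ne_zero_iff.2
        ⟨i, _, by cases s <;> simp, bary_cofaceCell e ⟨i, hi⟩ s⟩)
      have h2 := bary_mem_boxRegion.1 h1 i
      rw [bary_cofaceCell] at h2
      simpa using h2
    have h1 := h true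
    have h2 := h false
    rw [bary_emod] at hi
    simp at h1 h2
    omega
  by_cases hi : i ∈ e.2.1
  swap
  · exact trans e he i hi
  -- Suppose `e` ends on a face of the box. The loop must continue there: along direction `i` it
  -- would leave the box, and transversally to `i` it would be an edge within the face, which is
  -- excluded.
  have key : ∀ t : ℤ, (t = 1 ∨ t = -1) → bary e i + t ≠ t * (2 * N) := by
    intro t ht hcon
    obtain ⟨v, hv⟩ := exists_face e hi ht
    have hvi : bary v i = t * (2 * N) := by rw [hv]; simpa using hcon
    obtain ⟨e', he', hne, hbd⟩ := exists_neighbour_of_boundary_eq_zero hγ he (v := v)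
      (boundaryCell_ne_zero_iff.2 ⟨i, -t, by omega, by rw [hv, Pi.single_neg]; abel⟩)
    obtain ⟨m, s, hs, hm⟩ := boundaryCell_ne_zero_iff.1 hbd
    by_cases hmi : m = i
    · subst hmi
      by_cases hst : s = -t
      · refine hne (bary_injective ?_)
        rw [hm, hv, hst, Pi.single_neg]; abel
      · have h1 := bary_mem_boxRegion.1 (hγN he') m
        rw [hm] at h1
        simp only [Pi.add_apply, Pi.single_eq_same, hvi] at h1
        rcases ht with rfl | rfl <;> omega
    · have hie : i ∉ e'.2.1 := by
        rw [bary_emod, hm]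
        simp only [Pi.add_apply, Pi.single_eq_of_ne (Ne.symm hmi), hvi]
        rcases ht with rfl | rfl <;> omega
      have h1 := trans e' he' i hie
      rw [hm] at h1
      simp only [Pi.add_apply, Pi.single_eq_of_ne (Ne.symm hmi), hvi] at h1
      rcases ht with rfl | rfl <;> omega
  have h1 := key 1 (Or.inl rfl)
  have h2 := key (-1) (Or.inr rfl)
  have h3 := bary_mem_boxRegion.1 (hγN he) i
  rw [bary_emod] at hi
  omega

lemma card_support_linearCombination_le {f : TCell → TChain} {m : ℕ} {z : TChain}
    (h : ∀ c ∈ z.support, (f c).support.card ≤ m) :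
    (linearCombination ℤ f z).support.card ≤ z.support.card * m := by
  classical
  rw [linearCombination_apply, Finsupp.sum]
  refine (Finset.card_le_card (Finsupp.support_finsetSum
    (s := z.support) (f := fun c => z c • f c))).trans ?_
  refine Finset.card_biUnion_le_card_mul _ _ _ fun c hc => ?_
  exact (Finset.card_le_card Finsupp.support_smul).trans (h c hc)

lemma card_support_proj_le (k : Fin 4) (s : ℤ) (z : TChain) :
    (proj k s z).support.card ≤ z.support.card := by
  refine (card_support_linearCombination_le (m := 1) fun c _ => ?_).trans (by simp)
  split_ifs
  · simp
  · exact (Finset.card_le_card Finsupp.support_single_subset).trans (by simp)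

lemma card_support_sum_single_le {ι : Type*} (s : Finset ι) (f : ι → TCell) :
    (∑ t ∈ s, (single (f t) 1 : TChain)).support.card ≤ s.card := by
  classical
  refine (Finset.card_le_card (Finsupp.support_finsetSum
    (s := s) (f := fun t => (single (f t) 1 : TChain)))).trans ?_
  refine (Finset.card_biUnion_le_card_mul _ _ 1 fun t _ => ?_).trans (by simp)
  exact (Finset.card_le_card Finsupp.support_single_subset).trans (by simp)

lemma card_support_sweep_le {k : Fin 4} {s : ℤ} {m : ℕ} {z : TChain}
    (h : ∀ c ∈ z.support, |c.1 k - s| ≤ m) :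
    (sweep k s z).support.card ≤ z.support.card * m := by
  classical
  refine card_support_linearCombination_le fun c hc => ?_
  split_ifs with hk
  · simp
  · refine (Finset.card_le_card Finsupp.support_smul).trans ?_
    refine (Finset.card_le_card Finsupp.support_sub).trans ((Finset.card_union_le _ _).trans ?_)
    refine (add_le_add (card_support_sum_single_le _ _) (card_support_sum_single_le _ _)).trans ?_
    rw [Int.card_Ico, Int.card_Ico]
    have := abs_le.1 (h c hc)
    omega

lemma card_support_projBelow_le (b : Fin 4 → ℤ) (z : TChain) (m : ℕ) :
    (projBelow b m z).support.card ≤ z.support.card := by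
  induction m with
  | zero => rfl
  | succ m ih =>
    simp only [projBelow]
    split_ifs
    · exact (card_support_proj_le _ _ _).trans ih
    · simp

lemma card_support_cone_le {b lo hi : Fin 4 → ℤ} {m : ℕ} {z : TChain} (hb : ∀ k, lo k ≤ b k)
    (hb' : ∀ k, b k ≤ hi k) (hw : ∀ k, hi k ≤ lo k + m)
    (hz : z ∈ supported ℤ ℤ (region lo hi)) :
    (cone b z).support.card ≤ 4 * (z.support.card * m) := by
  classical
  rw [cone, LinearMap.sum_apply]
  refine (Finset.card_le_card (Finsupp.support_finsetSum (s := Finset.univ)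
    (f := fun k : Fin 4 => (sweep k (b k) ∘ₗ projBelow b k) z))).trans ?_
  refine (Finset.card_biUnion_le_card_mul _ _ (z.support.card * m) fun k _ => ?_).trans (by simp)
  refine (card_support_sweep_le (m := m) fun c hc => ?_).trans
    (Nat.mul_le_mul_right _ (card_support_projBelow_le b z k))
  have h1 := projBelow_mem_region hb hb' hz k hc k
  have h2 := hb k
  have h3 := hb' k
  have h4 := hw k
  rw [abs_le]
  split_ifs at h1 <;> omega

/-- The cone over `γ` with apex at a vertex of `γ` has at most `4ℓ²` plaquettes, and `4ℓ² ≤ ℓ⁴`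
because a nonempty closed chain has at least two edges. -/
lemma exists_surface {N : ℕ} {γ : Chain 1} (hγ : boundary γ = 0) (h0 : γ.support.Nonempty)
    (hγN : γ.support ⊆ cells 1 N)
    (hplaq : ∀ e ∈ γ.support, ∀ p : Cell 2, boundaryCell p e ≠ 0 → p ∈ cells 2 N)
    (hcube : ∃ a : Fin 4 → ℤ, ∀ e ∈ γ.support, Cell.IsIn e (cube a γ.support.card)) :
    ∃ q : Chain 2, boundary q = γ ∧ q.support.card ≤ γ.support.card ^ 4 ∧
      ∀ p ∈ q.support, ∀ i, -(2 * N : ℤ) + 2 ≤ bary p i ∧ bary p i ≤ 2 * N - 2 := by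
  obtain ⟨a, ha⟩ := hcube
  set ℓ := γ.support.card with hℓ
  -- The cube is cut down to the box of radius `N - 1`, so that the plaquettes of the cone keep the
  -- distance from the boundary that the classification of small vortices needs.
  set lo : Fin 4 → ℤ := fun i => max (a i) (-N + 1) with hlo
  set hi : Fin 4 → ℤ := fun i => min (a i + ℓ) (N - 1) with hhi
  have hreg : ∀ e ∈ γ.support, toT e ∈ region lo hi := by
    intro e he i
    have h1 := isIn_cube_iff.1 (ha e he) i
    have h2 := bary_bound_of_loop hγ hγN hplaq he i
    unfold bary at h2
    simp only [toT, hlo, hhi, max_le_iff, le_min_iff] at h1 ⊢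
    by_cases h3 : i ∈ e.2.1 <;> simp only [h3, if_true, if_false] at h1 h2 ⊢ <;> omega
  have hΓ : toTChain γ ∈ supported ℤ ℤ (region lo hi) := toTChain_mem_supported hreg
  obtain ⟨e₀, he₀⟩ := id h0
  have hb : ∀ k, lo k ≤ e₀.1 k := fun k => (hreg e₀ he₀ k).1
  have hb' : ∀ k, e₀.1 k ≤ hi k := fun k => by
    have := (hreg e₀ he₀ k).2
    split_ifs at this <;> simp only [toT] at this <;> omega
  have hdim := toTChain_mem_dimCells γ
  obtain ⟨q, hq⟩ := exists_toTChain_eq (cone_mem_dimCells (b := e₀.1) hdim)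
  have hbd : tboundary (toTChain γ) = 0 := by rw [← toTChain_boundary, hγ, map_zero]
  refine ⟨q, toTChain_injective ?_, ?_, fun p hp i => ?_⟩
  · rw [toTChain_boundary, hq]
    have h := cone_homotopy e₀.1 (toTChain γ)
    rwa [hbd, map_zero, add_zero, projBelow_four_eq_zero one_ne_zero hdim, sub_zero] at h
  · have h1 : q.support.card = (toTChain q).support.card := by
      rw [toTChain, lmapDomain_apply, Finsupp.mapDomain_support_of_injective toT_injective,
        Finset.card_image_of_injective _ toT_injective]
    have h2 : (toTChain γ).support.card = ℓ := by
      rw [toTChain, lmapDomain_apply, Finsupp.mapDomain_support_of_injective toT_injective,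
        Finset.card_image_of_injective _ toT_injective]
    have h3 := card_support_cone_le (m := ℓ) hb hb' (fun k => by simp only [hlo, hhi]; omega) hΓ
    rw [h1, hq]
    refine h3.trans ?_
    rw [h2]
    have h4 : 2 ≤ ℓ := two_le_card_of_boundary_eq_zero hγ h0
    calc 4 * (ℓ * ℓ) = (2 * 2) * (ℓ * ℓ) := by ring
      _ ≤ (ℓ * ℓ) * (ℓ * ℓ) := Nat.mul_le_mul_right _ (Nat.mul_le_mul h4 h4)
      _ = ℓ ^ 4 := by ring
  · have h1 : toT p ∈ (toTChain q).support := by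
      rw [Finsupp.mem_support_iff, toTChain_apply]; exact Finsupp.mem_support_iff.1 hp
    rw [hq] at h1
    have h2 := cone_mem_region hb hb' hΓ h1 i
    unfold bary
    simp only [toT, hlo, hhi, max_le_iff, le_min_iff] at h2
    by_cases h3 : i ∈ p.2.1 <;> simp only [h3, if_true, if_false] at h2 ⊢ <;> omega

/-! ### The width of small vortices and the constant `K₁` -/

section Restrict

variable {k N : ℕ} {G : Type} [AddCommGroup G]

lemma Form.restrict_apply_of_mem {ω : Form k N G} {P : Finset {c : Cell k // c ∈ cells k N}}
    {c : {c : Cell k // c ∈ cells k N}} (h : c ∈ P) : ω.restrict P c = ω c := by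
  simp [Form.restrict, h]

lemma Form.restrict_apply_of_notMem {ω : Form k N G} {P : Finset {c : Cell k // c ∈ cells k N}}
    {c : {c : Cell k // c ∈ cells k N}} (h : c ∉ P) : ω.restrict P c = 0 := by
  simp [Form.restrict, h]

lemma Form.restrict_posSupport (ω : Form k N G) : ω.restrict ω.posSupport = ω := by
  ext c
  by_cases h : c ∈ ω.posSupport
  · exact restrict_apply_of_mem h
  · rw [restrict_apply_of_notMem h]
    simpa [Form.mem_posSupport, eq_comm] using h

/-- If any two plaquettes of the support of `ω` in a common `3`-cell are both in `P` or both not in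
`P`, then the restriction to `P` is closed. -/
lemma Form.restrict_closed {ω : Form k N G} (hω : ω.d = 0)
    {P : Finset {c : Cell k // c ∈ cells k N}}
    (h : ∀ (c : Cell (k + 1)) (q q' : {c : Cell k // c ∈ cells k N}), boundaryCell c q.1 ≠ 0 →
      boundaryCell c q'.1 ≠ 0 → ω q ≠ 0 → ω q' ≠ 0 → q ∈ P → q' ∈ P) : (ω.restrict P).d = 0 := by
  ext c
  by_cases hc : ∃ q ∈ P, boundaryCell c.1 q.1 ≠ 0 ∧ ω q ≠ 0
  · obtain ⟨q, hqP, hq, hq0⟩ := hc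
    rw [← hω, Form.d, Form.d, Form.eval, Form.eval]
    refine Finset.sum_congr rfl fun q' _ => ?_
    by_cases h1 : boundaryCell c.1 q'.1 = 0
    · rw [h1, zero_smul, zero_smul]
    · by_cases h2 : ω q' = 0
      · rw [h2]; simp [Form.restrict, h2]
      · rw [restrict_apply_of_mem (h c.1 q q' hq h1 hq0 h2 hqP)]
  · push Not at hc
    rw [Form.d, Form.eval]
    refine Finset.sum_eq_zero fun q _ => ?_
    by_cases hq : q ∈ P
    · rw [restrict_apply_of_mem hq]
      by_cases h1 : boundaryCell c.1 q.1 = 0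
      · rw [h1, zero_smul]
      · rw [hc q hq h1, smul_zero]
    · rw [restrict_apply_of_notMem hq, smul_zero]

end Restrict

lemma abs_bary_sub_le {k : ℕ} {c : Cell (k + 1)} {q q' : Cell k} (h : boundaryCell c q ≠ 0)
    (h' : boundaryCell c q' ≠ 0) (i : Fin 4) : |bary q' i - bary q i| ≤ 2 := by
  obtain ⟨j, s, hs, hj⟩ := boundaryCell_ne_zero_iff.1 h
  obtain ⟨j', s', hs', hj'⟩ := boundaryCell_ne_zero_iff.1 h'
  have h1 := congrFun (hj.symm.trans hj') i
  simp only [Pi.add_apply, Pi.single_apply] at h1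
  rw [abs_le]
  split_ifs at h1 <;> omega

/-- If a ball gains no plaquette when its radius grows by one step, then no 3-cell joins its
plaquettes to the rest of the support; the restriction to it is closed, and by irreducibility it is
everything. -/
lemma Form.IsIrreducible.card_ball {N : ℕ} {G : Type} [AddCommGroup G] {ν : Form 2 N G}
    (hν : ν.IsIrreducible) {p : {c : Cell 2 // c ∈ cells 2 N}} (hp : p ∈ ν.posSupport) (m : ℕ) :
    (∀ q ∈ ν.posSupport, ∀ i, |bary q.1 i - bary p.1 i| ≤ 2 * m) ∨
      m + 1 ≤ (ν.posSupport.filter fun q => ∀ i, |bary q.1 i - bary p.1 i| ≤ 2 * m).card := by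
  induction m with
  | zero =>
    right
    refine Finset.card_pos.2 ⟨p, ?_⟩
    simp [hp]
  | succ m ih =>
    set B : ℕ → Finset {c : Cell 2 // c ∈ cells 2 N} := fun m =>
      ν.posSupport.filter fun q => ∀ i, |bary q.1 i - bary p.1 i| ≤ 2 * (m : ℤ) with hB
    have hmono : B m ⊆ B (m + 1) := by
      intro q hq
      rw [hB, Finset.mem_filter] at hq ⊢
      refine ⟨hq.1, fun i => (hq.2 i).trans ?_⟩
      push_cast; omega
    rcases ih with ih | ih
    · left
      intro q hq i
      refine (ih q hq i).trans ?_
      push_cast; omega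
    · by_cases heq : B m = B (m + 1)
      · left
        have hclosed : (ν.restrict (B m)).d = 0 := by
          refine Form.restrict_closed hν.1 fun c q q' h1 h2 h3 h4 hq => ?_
          rw [heq, hB, Finset.mem_filter]
          refine ⟨Form.mem_posSupport.2 h4, fun i => ?_⟩
          have h5 := (Finset.mem_filter.1 hq).2 i
          have h6 := abs_bary_sub_le h1 h2 i
          rw [abs_le] at *
          push_cast; omega
        have hne : (B m).Nonempty := ⟨p, by simp [hB, hp]⟩
        have hsub : B m ⊆ ν.posSupport := Finset.filter_subset _ _
        have : B m = ν.posSupport := by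
          by_contra hcon
          exact hν.2 (B m) hne (Finset.ssubset_iff_subset_ne.2 ⟨hsub, hcon⟩) hclosed
        intro q hq i
        rw [← this, heq] at hq
        exact (Finset.mem_filter.1 hq).2 i
      · right
        have := Finset.card_lt_card (Finset.ssubset_iff_subset_ne.2 ⟨hmono, heq⟩)
        exact Nat.succ_le_of_lt (lt_of_le_of_lt ih this)

lemma exists_cube_of_irreducible {n N : ℕ} (hn : 2 ≤ n) (hN : 1 ≤ N) {ν : Form 2 N (ZMod n)}
    (hν : ν.IsIrreducible) (hcard : ν.posSupport.card ≤ 24) :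
    ∃ a : Fin 4 → ℤ, ∀ p ∈ ν.posSupport, Cell.IsIn p.1 (cube a vortexWidth) := by
  have hmem : vortexWidth ∈ {w : ℕ | ∀ n N : ℕ, 2 ≤ n → 1 ≤ N → ∀ ν : Form 2 N (ZMod n),
      ν.IsIrreducible → 2 * ν.posSupport.card ≤ 2 * 24 →
      ∃ a : Fin 4 → ℤ, ∀ p ∈ ν.posSupport, Cell.IsIn p.1 (cube a w)} := by
    -- The infimum is attained once some width is admissible. With 24 plaquettes the ball of doubled
    -- radius 48 is everything, so base points differ by at most 24, and one unit more covers the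
    -- cells.
    refine Nat.sInf_mem ⟨50, ?_⟩
    intro n N _ _ ν hν hcard
    by_cases hemp : ν.posSupport.Nonempty
    · obtain ⟨p, hp⟩ := hemp
      refine ⟨fun i => p.1.1 i - 25, fun q hq => isIn_cube_iff.2 fun i => ?_⟩
      have h : |bary q.1 i - bary p.1 i| ≤ 2 * (24 : ℕ) := by
        rcases hν.card_ball hp 24 with h | h
        · exact h q hq i
        · have := h.trans (Finset.card_filter_le _ _)
          omega
      rw [abs_le] at h
      unfold bary at h
      simp only [toT]
      split_ifs at h ⊢ <;> push_cast at h ⊢ <;> omega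
    · rw [Finset.not_nonempty_iff_eq_empty] at hemp
      exact ⟨0, by simp [hemp]⟩
  exact hmem n N hn hN ν hν (by omega)

/-- The infimum `K1` is itself admissible for a nonempty loop. Admissible constants exist because a
near plaquette lies within bounded distance of an edge of the loop, which leaves boundedly many
positions per edge. -/
lemma card_nearPlaquettes_le {γ : Chain 1} {q : Chain 2} (hγ : IsGeneralizedLoop γ)
    (hq : boundary q = γ) (h0 : γ.support.Nonempty) :
    ((nearPlaquettes γ q).card : ℝ) ≤ K1 * γ.support.card := by
  classical
  set S := {K : ℝ | ∀ (γ : Chain 1) (q : Chain 2), IsGeneralizedLoop γ → boundary q = γ →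
    ((nearPlaquettes γ q).card : ℝ) ≤ K * γ.support.card} with hS
  have hpos : (0 : ℝ) < γ.support.card := by exact_mod_cast Finset.card_pos.2 h0
  have hne : S.Nonempty := by
    set D : ℤ := vortexWidth + 4
    set T : Finset (Fin 4 → ℤ) := Finset.Icc (fun _ => -D) (fun _ => D)
    refine ⟨((T ×ˢ (Finset.univ : Finset {S : Finset (Fin 4) // S.card = 2})).card : ℕ), ?_⟩
    intro γ q _ _
    have hsub : nearPlaquettes γ q ⊆ γ.support.biUnion fun e =>
        (T ×ˢ (Finset.univ : Finset {S : Finset (Fin 4) // S.card = 2})).image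
          fun y => (e.1 + y.1, y.2) := by
      intro p hp
      obtain ⟨-, a, ha, e, he, hea⟩ := Finset.mem_filter.1 hp
      refine Finset.mem_biUnion.2 ⟨e, he, Finset.mem_image.2 ⟨(p.1 - e.1, p.2), ?_, by simp⟩⟩
      have key : ∀ i, -D ≤ p.1 i - e.1 i ∧ p.1 i - e.1 i ≤ D := by
        intro i
        have h1 := isIn_cube_iff.1 ha i
        simp only [toT] at h1
        rcases hea with h | h
        · have h2 := h i
          push_cast at h1 h2
          split_ifs at h1 <;> simp only [D] <;> omega
        · have h2 := h i
          simp only [Pi.add_apply] at h2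
          push_cast at h1 h2
          split_ifs at h1 h2 <;> simp only [D] <;> omega
      simp only [Finset.mem_product, Finset.mem_univ, and_true, T, Finset.mem_Icc, Pi.le_def]
      exact ⟨fun i => (key i).1, fun i => (key i).2⟩
    have h1 := (Finset.card_le_card hsub).trans
      (Finset.card_biUnion_le_card_mul _ _ _ fun e _ => Finset.card_image_le)
    rw [mul_comm]
    exact_mod_cast h1
  rw [← div_le_iff₀ hpos]
  exact le_csInf hne fun K hK => (div_le_iff₀ hpos).2 (hK γ q hγ hq)

end

end LatticeGauge

namespace LatticeGauge

noncomputable section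

/-! ### Irreducible parts of closed forms -/

section Irreducible

variable {k N : ℕ} {G : Type} [AddCommGroup G]

lemma Form.posSupport_restrict {ω : Form k N G} {P : Finset {c : Cell k // c ∈ cells k N}}
    (h : P ⊆ ω.posSupport) : (ω.restrict P).posSupport = P := by
  ext c
  rw [Form.mem_posSupport]
  by_cases hc : c ∈ P
  · rw [restrict_apply_of_mem hc]; simpa [hc] using Form.mem_posSupport.1 (h hc)
  · simp [restrict_apply_of_notMem hc, hc]

lemma Form.restrict_restrict {ω : Form k N G} {P P' : Finset {c : Cell k // c ∈ cells k N}}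
    (h : P' ⊆ P) : (ω.restrict P).restrict P' = ω.restrict P' := by
  ext c
  by_cases hc : c ∈ P'
  · rw [restrict_apply_of_mem hc, restrict_apply_of_mem hc, restrict_apply_of_mem (h hc)]
  · rw [restrict_apply_of_notMem hc, restrict_apply_of_notMem hc]

open Classical in
lemma Form.restrict_sdiff {ω : Form k N G} {P P' : Finset {c : Cell k // c ∈ cells k N}}
    (h : P' ⊆ P) : ω.restrict (P \ P') = ω.restrict P - ω.restrict P' := by
  ext c
  rw [Pi.sub_apply]
  by_cases hc : c ∈ P'
  · rw [restrict_apply_of_notMem (by simp [hc]), restrict_apply_of_mem hc,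
      restrict_apply_of_mem (h hc), sub_self]
  · by_cases hc' : c ∈ P
    · rw [restrict_apply_of_mem (by simp [hc, hc']), restrict_apply_of_mem hc',
        restrict_apply_of_notMem hc, sub_zero]
    · rw [restrict_apply_of_notMem (by simp [hc']), restrict_apply_of_notMem hc',
        restrict_apply_of_notMem hc, sub_zero]

/-- Every cell in the support of a closed form lies in the support of an irreducible part. -/
lemma Form.exists_irreducible_restrict {ω : Form k N G} (hω : ω.d = 0)
    {p : {c : Cell k // c ∈ cells k N}} (hp : p ∈ ω.posSupport) :
    ∃ P ⊆ ω.posSupport, p ∈ P ∧ (ω.restrict P).IsIrreducible := by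
  classical
  set S := ω.posSupport.powerset.filter fun P => p ∈ P ∧ (ω.restrict P).d = 0 with hS
  have hSne : S.Nonempty := ⟨ω.posSupport, by simp [hS, hp, Form.restrict_posSupport, hω]⟩
  obtain ⟨P, hP, hmin⟩ := Finset.exists_min_image S Finset.card hSne
  obtain ⟨hPsub, hpP, hPd⟩ : P ⊆ ω.posSupport ∧ p ∈ P ∧ (ω.restrict P).d = 0 := by
    simpa [hS] using hP
  refine ⟨P, hPsub, hpP, hPd, fun P' hne hss hd => ?_⟩
  rw [Form.posSupport_restrict hPsub] at hss
  rw [Form.restrict_restrict hss.subset] at hd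
  by_cases hpP' : p ∈ P'
  · have := hmin P' (by simp [hS, hpP', hd, hss.subset.trans hPsub])
    exact absurd (Finset.card_lt_card hss) (by omega)
  -- A closed part that misses `p` can be removed, against minimality.
  · have hd' : (ω.restrict (P \ P')).d = 0 := by
      rw [Form.restrict_sdiff hss.subset, Form.d_sub, hd, hPd, sub_zero]
    have := hmin (P \ P') (by
      simp only [hS, Finset.mem_filter, Finset.mem_powerset, Finset.mem_sdiff]
      exact ⟨Finset.sdiff_subset.trans hPsub, ⟨hpP, hpP'⟩, hd'⟩)
    have h2 := Finset.card_sdiff_add_card_eq_card hss.subset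
    have h3 := Finset.card_pos.2 hne
    omega

end Irreducible

/-! ### Counting irreducible forms -/

section Count

variable {N n : ℕ} [NeZero n]

open Classical in
/-- The irreducible forms with `m` plaquettes in their support that agree with `ω` on `P`. -/
def irreducibleExtensions (m : ℕ) (ω : Form 2 N (ZMod n))
    (P : Finset {c : Cell 2 // c ∈ cells 2 N}) : Finset (Form 2 N (ZMod n)) :=
  Finset.univ.filter fun ν => ν.IsIrreducible ∧ ν.posSupport.card = m ∧ P ⊆ ν.posSupport ∧
    ∀ c ∈ P, ν c = ω c

lemma mem_irreducibleExtensions {m : ℕ} {ω ν : Form 2 N (ZMod n)}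
    {P : Finset {c : Cell 2 // c ∈ cells 2 N}} : ν ∈ irreducibleExtensions m ω P ↔
      ν.IsIrreducible ∧ ν.posSupport.card = m ∧ P ⊆ ν.posSupport ∧ ∀ c ∈ P, ν c = ω c := by
  simp [irreducibleExtensions]

open Classical in
lemma card_faces_sdiff_le {c : Cell 3} {P : Finset {c : Cell 2 // c ∈ cells 2 N}}
    {q : {c : Cell 2 // c ∈ cells 2 N}} (hq : q ∈ P) (hcq : boundaryCell c q.1 ≠ 0) :
    (Finset.univ.filter fun q' : {c : Cell 2 // c ∈ cells 2 N} =>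
      q' ∉ P ∧ boundaryCell c q'.1 ≠ 0).card ≤ 5 := by
  set F := Finset.univ.filter fun q' : {c : Cell 2 // c ∈ cells 2 N} =>
      q' ∉ P ∧ boundaryCell c q'.1 ≠ 0 with hF
  have h1 : (insert q F).card ≤ 6 := by
    refine le_trans ?_ (card_boundaryCell_support c)
    rw [← Finset.card_map (Function.Embedding.subtype _)]
    refine Finset.card_le_card fun y hy => ?_
    obtain ⟨q', hq', rfl⟩ := Finset.mem_map.1 hy
    rw [Finsupp.mem_support_iff]
    rcases Finset.mem_insert.1 hq' with rfl | h
    · exact hcq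
    · exact (Finset.mem_filter.1 h).2.2
  rw [Finset.card_insert_of_notMem (by simp [hF, hq])] at h1
  omega

lemma card_ne_zero_zmod : (Finset.univ.filter fun g : ZMod n => g ≠ 0).card = n - 1 := by
  rw [Finset.filter_ne' , Finset.card_erase_of_mem (Finset.mem_univ _), Finset.card_univ, ZMod.card]

/-- The prescribed part is not closed unless it is everything, so it violates closedness at some
3-cell. An extension must have a further plaquette in that 3-cell: at most five places, as one of
the six faces is already in `P`, and `n - 1` values. The unprescribed plaquettes are thus found one
at a time. -/
lemma card_irreducibleExtensions_le (m : ℕ) : ∀ (r : ℕ) (ω : Form 2 N (ZMod n))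
    (P : Finset {c : Cell 2 // c ∈ cells 2 N}), P.Nonempty → P.card + r = m →
      (irreducibleExtensions m ω P).card ≤ (5 * (n - 1)) ^ r := by
  classical
  intro r
  induction r with
  | zero =>
    intro ω P _ hPm
    rw [pow_zero, Finset.card_le_one]
    have key : ∀ ν ∈ irreducibleExtensions m ω P, ν = ω.restrict P := by
      intro ν hν
      obtain ⟨-, hm, hsub, hag⟩ := mem_irreducibleExtensions.1 hν
      have hP : P = ν.posSupport := Finset.eq_of_subset_of_card_le hsub (by omega)
      ext c
      by_cases hc : c ∈ P
      · rw [Form.restrict_apply_of_mem hc, hag c hc]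
      · rw [Form.restrict_apply_of_notMem hc]
        rw [hP, Form.mem_posSupport] at hc
        simpa using hc
    intro ν hν ν' hν'
    rw [key ν hν, key ν' hν']
  | succ r ih =>
    intro ω P hPne hPm
    have hrestr : ∀ ν ∈ irreducibleExtensions m ω P, ν.restrict P = ω.restrict P := by
      intro ν hν
      obtain ⟨-, -, -, hag⟩ := mem_irreducibleExtensions.1 hν
      ext c
      by_cases hc : c ∈ P
      · rw [Form.restrict_apply_of_mem hc, Form.restrict_apply_of_mem hc, hag c hc]
      · rw [Form.restrict_apply_of_notMem hc, Form.restrict_apply_of_notMem hc]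
    by_cases hd : (ω.restrict P).d = 0
    · have : irreducibleExtensions m ω P = ∅ := by
        rw [Finset.eq_empty_iff_forall_notMem]
        intro ν hν
        obtain ⟨hirr, hm, hsub, hag⟩ := mem_irreducibleExtensions.1 hν
        refine hirr.2 P hPne (Finset.ssubset_iff_subset_ne.2 ⟨hsub, ?_⟩) (by rw [hrestr ν hν, hd])
        rintro rfl; omega
      simp [this]
    -- The 3-cell depends only on the prescribed data, so it serves all extensions at once.
    · obtain ⟨c, hc⟩ := Function.ne_iff.1 hd
      rw [Form.d, Form.eval] at hc
      obtain ⟨q₀, -, hq₀⟩ := Finset.exists_ne_zero_of_sum_ne_zero hc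
      have hq₀P : q₀ ∈ P := by
        by_contra h
        rw [Form.restrict_apply_of_notMem h, smul_zero] at hq₀
        exact hq₀ rfl
      have hcq₀ : boundaryCell c.1 q₀.1 ≠ 0 := fun h => hq₀ (by rw [h, zero_smul])
      set F := Finset.univ.filter fun q' : {c : Cell 2 // c ∈ cells 2 N} =>
        q' ∉ P ∧ boundaryCell c.1 q'.1 ≠ 0 with hF
      set Z := Finset.univ.filter fun g : ZMod n => g ≠ 0 with hZ
      have hsub : irreducibleExtensions m ω P ⊆ (F ×ˢ Z).biUnion fun x =>
          irreducibleExtensions m (Function.update ω x.1 x.2) (insert x.1 P) := by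
        intro ν hν
        obtain ⟨hirr, hm, hPsub, hag⟩ := mem_irreducibleExtensions.1 hν
        have hex : ∃ q ∈ F, ν q ≠ 0 := by
          by_contra hcon
          push Not at hcon
          refine hc ?_
          rw [← hrestr ν hν]
          have h0 := congrFun hirr.1 c
          rw [Form.d, Form.eval] at h0
          refine Eq.trans (Finset.sum_congr rfl fun q _ => ?_) h0
          by_cases hqP : q ∈ P
          · rw [Form.restrict_apply_of_mem hqP]
          · rw [Form.restrict_apply_of_notMem hqP]
            by_cases hb : boundaryCell c.1 q.1 = 0
            · rw [hb, zero_smul, zero_smul]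
            · rw [hcon q (by simp [hF, hqP, hb])]
        obtain ⟨q, hqF, hq⟩ := hex
        have hqP : q ∉ P := (Finset.mem_filter.1 hqF).2.1
        refine Finset.mem_biUnion.2 ⟨(q, ν q), by simp [hqF, hZ, hq], ?_⟩
        refine mem_irreducibleExtensions.2 ⟨hirr, hm,
          Finset.insert_subset (Form.mem_posSupport.2 hq) hPsub, fun c' hc' => ?_⟩
        rcases Finset.mem_insert.1 hc' with rfl | h
        · simp
        · have hne : c' ≠ q := fun h' => hqP (h' ▸ h)
          rw [Function.update_of_ne hne, hag c' h]
      have hFZ : (F ×ˢ Z).card ≤ 5 * (n - 1) := by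
        rw [Finset.card_product, card_ne_zero_zmod]
        exact Nat.mul_le_mul_right _ (card_faces_sdiff_le hq₀P hcq₀)
      refine (Finset.card_le_card hsub).trans ?_
      refine (Finset.card_biUnion_le_card_mul _ _ ((5 * (n - 1)) ^ r) fun x hx => ?_).trans ?_
      · have hxP : x.1 ∉ P := (Finset.mem_filter.1 (Finset.mem_product.1 hx).1).2.1
        exact ih _ _ (Finset.insert_nonempty _ _)
          (by rw [Finset.card_insert_of_notMem hxP]; omega)
      · rw [pow_succ, mul_comm]
        exact Nat.mul_le_mul_left _ hFZ

open Classical in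
/-- The irreducible forms with `m` plaquettes in their support, one of which is `p`. -/
def irreducibleAt (m : ℕ) (p : {c : Cell 2 // c ∈ cells 2 N}) : Finset (Form 2 N (ZMod n)) :=
  Finset.univ.filter fun ν => ν.IsIrreducible ∧ ν.posSupport.card = m ∧ p ∈ ν.posSupport

lemma card_irreducibleAt_le (m : ℕ) (p : {c : Cell 2 // c ∈ cells 2 N}) :
    (irreducibleAt m p : Finset (Form 2 N (ZMod n))).card ≤ (5 * (n - 1)) ^ m := by
  classical
  cases m with
  | zero =>
    have : (irreducibleAt 0 p : Finset (Form 2 N (ZMod n))) = ∅ := by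
      rw [Finset.eq_empty_iff_forall_notMem]
      intro ν hν
      obtain ⟨-, -, h1, h2⟩ := Finset.mem_filter.1 hν
      rw [Finset.card_eq_zero.1 h1] at h2
      simp at h2
    simp [this]
  | succ m =>
    set Z := Finset.univ.filter fun g : ZMod n => g ≠ 0 with hZ
    have hsub : (irreducibleAt (m + 1) p : Finset (Form 2 N (ZMod n))) ⊆ Z.biUnion fun g =>
        irreducibleExtensions (m + 1) (fun _ => g) {p} := by
      intro ν hν
      obtain ⟨-, hirr, h1, h2⟩ := Finset.mem_filter.1 hν
      refine Finset.mem_biUnion.2 ⟨ν p, by simpa [hZ] using Form.mem_posSupport.1 h2, ?_⟩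
      refine mem_irreducibleExtensions.2 ⟨hirr, h1, by simpa using h2, ?_⟩
      intro c hc
      rw [Finset.mem_singleton.1 hc]
    refine (Finset.card_le_card hsub).trans ?_
    refine (Finset.card_biUnion_le_card_mul _ _ ((5 * (n - 1)) ^ m) fun g _ =>
      card_irreducibleExtensions_le (m + 1) m _ _ (by simp) (by simp; omega)).trans ?_
    rw [pow_succ, mul_comm, card_ne_zero_zmod]
    exact Nat.mul_le_mul_left _ (by omega)

end Count

/-! ### Probabilities -/

section Gibbs

variable {n : ℕ} [NeZero n] (ρ : AddChar (ZMod n) ℂ) {N : ℕ} {β : ℝ}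

lemma re_unit_smul (u : ℤ) (hu : u = 1 ∨ u = -1) (g : ZMod n) : (ρ (u • g)).re = (ρ g).re := by
  rcases hu with rfl | rfl
  · simp
  · rw [neg_smul, one_smul, AddChar.map_neg_eq_conj, Complex.conj_re]

lemma neg_mul_action (σ : Form 1 N (ZMod n)) :
    -β * action ρ σ = ∑ p, 2 * β * (ρ (σ.d p)).re := by
  have : ∀ p : ℤˣ × {p : Cell 2 // p ∈ cells 2 N},
      (ρ ((p.1 : ℤ) • σ.d p.2)).re = (ρ (σ.d p.2)).re := fun p => by
    refine re_unit_smul ρ _ ?_ _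
    rcases Int.units_eq_one_or p.1 with h | h <;> simp [h]
  rw [action, Finset.sum_congr rfl fun p _ => this p, Fintype.sum_prod_type]
  simp only [Finset.sum_const, Finset.card_univ, Fintype.card_units_int, nsmul_eq_mul]
  rw [neg_mul_neg, Nat.cast_ofNat, ← Finset.mul_sum]
  ring

/-- The unnormalized weight of a configuration. -/
def weight (β : ℝ) (σ : Form 1 N (ZMod n)) : ℝ := Real.exp (-β * action ρ σ)

lemma weight_pos (σ : Form 1 N (ZMod n)) : 0 < weight ρ β σ := Real.exp_pos _

lemma weight_eq_prod (σ : Form 1 N (ZMod n)) :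
    weight ρ β σ = ∏ p, Real.exp (2 * β * (ρ (σ.d p)).re) := by
  rw [weight, neg_mul_action, Real.exp_sum]

lemma sum_weight_pos : 0 < ∑ τ : Form 1 N (ZMod n), weight ρ β τ :=
  Finset.sum_pos (fun τ _ => weight_pos ρ τ) Finset.univ_nonempty

lemma gibbs_eq (σ : Form 1 N (ZMod n)) :
    gibbs ρ N β σ = weight ρ β σ / ∑ τ : Form 1 N (ZMod n), weight ρ β τ := rfl

lemma gibbs_nonneg (σ : Form 1 N (ZMod n)) : 0 ≤ gibbs ρ N β σ :=
  div_nonneg (weight_pos ρ σ).le (sum_weight_pos ρ).le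

lemma sum_gibbs : ∑ σ : Form 1 N (ZMod n), gibbs ρ N β σ = 1 := by
  simp only [gibbs_eq]
  rw [← Finset.sum_div, div_self (sum_weight_pos ρ).ne']

open Classical in
/-- The probability of an event. -/
def prob (N : ℕ) (β : ℝ) (A : Set (Form 1 N (ZMod n))) : ℝ :=
  ∑ σ : Form 1 N (ZMod n), if σ ∈ A then gibbs ρ N β σ else 0

lemma prob_mono {A B : Set (Form 1 N (ZMod n))} (h : A ⊆ B) : prob ρ N β A ≤ prob ρ N β B := by
  refine Finset.sum_le_sum fun σ _ => ?_
  by_cases hA : σ ∈ A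
  · simp [hA, h hA]
  · rw [if_neg hA]; split_ifs <;> simp [gibbs_nonneg]

lemma prob_union_le (A B : Set (Form 1 N (ZMod n))) :
    prob ρ N β (A ∪ B) ≤ prob ρ N β A + prob ρ N β B := by
  classical
  rw [prob, prob, prob, ← Finset.sum_add_distrib]
  refine Finset.sum_le_sum fun σ _ => ?_
  have := gibbs_nonneg ρ (β := β) σ
  by_cases hA : σ ∈ A <;> by_cases hB : σ ∈ B <;> simp [hA, hB, this]

lemma prob_biUnion_le {ι : Type*} (s : Finset ι) (A : ι → Set (Form 1 N (ZMod n))) :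
    prob ρ N β (⋃ i ∈ s, A i) ≤ ∑ i ∈ s, prob ρ N β (A i) := by
  classical
  induction s using Finset.induction_on with
  | empty => simp [prob]
  | insert i s hi ih =>
    rw [Finset.set_biUnion_insert, Finset.sum_insert hi]
    exact (prob_union_le ρ _ _).trans (by gcongr)

lemma prob_biUnion_le_card_mul {ι : Type*} (s : Finset ι) (A : ι → Set (Form 1 N (ZMod n))) {C : ℝ}
    (h : ∀ i ∈ s, prob ρ N β (A i) ≤ C) : prob ρ N β (⋃ i ∈ s, A i) ≤ s.card * C := by
  refine (prob_biUnion_le ρ s A).trans ?_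
  rw [← nsmul_eq_mul]
  exact Finset.sum_le_card_nsmul _ _ _ h

/-- Translation by `τ` is a bijection of configurations, so the shifted Gibbs weights still sum to
one. -/
lemma prob_le_of_shift {A : Set (Form 1 N (ZMod n))} (τ : Form 1 N (ZMod n)) {C : ℝ} (hC : 0 ≤ C)
    (h : ∀ σ ∈ A, weight ρ β σ ≤ C * weight ρ β (σ - τ)) : prob ρ N β A ≤ C := by
  classical
  calc prob ρ N β A ≤ ∑ σ : Form 1 N (ZMod n), C * gibbs ρ N β (σ - τ) := by
        refine Finset.sum_le_sum fun σ _ => ?_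
        split_ifs with hσ
        · rw [gibbs_eq, gibbs_eq, ← mul_div_assoc]
          exact div_le_div_of_nonneg_right (h σ hσ) (sum_weight_pos ρ).le
        · exact mul_nonneg hC (gibbs_nonneg ρ _)
    _ = C := by
        have hsum : ∑ σ : Form 1 N (ZMod n), gibbs ρ N β (σ - τ) = ∑ σ, gibbs ρ N β σ :=
          (Equiv.subRight τ).sum_comp (gibbs ρ N β)
        rw [← Finset.mul_sum, hsum, sum_gibbs, mul_one]

lemma le_lam {g : ZMod n} (hg : g ≠ 0) :
    Real.exp (β * (ρ g).re) / Real.exp (β * (ρ 0).re) ≤ lam ρ β :=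
  le_ciSup (f := fun g : {g : ZMod n // g ≠ 0} =>
    Real.exp (β * (ρ g.1).re) / Real.exp (β * (ρ 0).re)) (Set.finite_range _).bddAbove ⟨g, hg⟩

lemma exp_le_lam_sq_mul {g : ZMod n} (hg : g ≠ 0) :
    Real.exp (2 * β * (ρ g).re) ≤ lam ρ β ^ 2 * Real.exp (2 * β * (ρ 0).re) := by
  have h := (div_le_iff₀ (Real.exp_pos _)).1 (le_lam ρ (β := β) hg)
  have h2 : ∀ x : ℝ, Real.exp (2 * β * x) = Real.exp (β * x) ^ 2 := fun x => by
    rw [← Real.exp_nat_mul]; congr 1; push_cast; ring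
  rw [h2, h2, ← mul_pow]
  exact pow_le_pow_left₀ (Real.exp_pos _).le h 2

/-- The probability that a given closed form is a part of the vortices of the configuration. -/
lemma prob_agree_le {ν : Form 2 N (ZMod n)} (hν : ν.d = 0) :
    prob ρ N β {σ | ∀ p ∈ ν.posSupport, σ.d p = ν p} ≤ (lam ρ β ^ 2) ^ ν.posSupport.card := by
  classical
  -- Shifting by a primitive `τ` of `ν` sets the plaquettes of its support to zero and leaves the
  -- others alone; each gains `λ²`, one `λ` per orientation.
  obtain ⟨τ, rfl⟩ := Form.exists_d_eq hν
  refine prob_le_of_shift ρ τ (by positivity) fun σ hσ => ?_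
  rw [weight_eq_prod, weight_eq_prod, ← Finset.prod_const]
  have h1 : ∏ p ∈ τ.d.posSupport, lam ρ β ^ 2 =
      ∏ p : {p : Cell 2 // p ∈ cells 2 N}, if p ∈ τ.d.posSupport then lam ρ β ^ 2 else 1 := by
    rw [Finset.prod_ite_mem, Finset.univ_inter]
  rw [h1, ← Finset.prod_mul_distrib]
  refine Finset.prod_le_prod (fun p _ => (Real.exp_pos _).le) fun p _ => ?_
  rw [Form.d_sub, Pi.sub_apply]
  split_ifs with hp
  · rw [hσ p hp, sub_self]
    exact exp_le_lam_sq_mul ρ (Form.mem_posSupport.1 hp)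
  · have : τ.d p = 0 := by simpa [Form.mem_posSupport] using hp
    rw [this, sub_zero, one_mul]

/-- The event that `p` lies in an irreducible part of size at least `M` of `dσ`. -/
def vortexEvent (p : {c : Cell 2 // c ∈ cells 2 N}) (M : ℕ) : Set (Form 1 N (ZMod n)) :=
  {σ | ∃ P ⊆ σ.d.posSupport, p ∈ P ∧ M ≤ P.card ∧ (σ.d.restrict P).IsIrreducible}

/-- Union bound over the irreducible forms through `p`: at most `(5(n-1))^m` of size `m`, each of
probability at most `λ^(2m)`. The sizes from `M` on form the tail of a geometric series. -/
lemma prob_vortexEvent_le (hlam : 5 * ((n : ℝ) - 1) * lam ρ β ^ 2 < 1)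
    (p : {c : Cell 2 // c ∈ cells 2 N}) (M : ℕ) :
    prob ρ N β (vortexEvent p M) ≤ K0 ρ M β * lam ρ β ^ (2 * M) := by
  classical
  set r : ℝ := 5 * ((n : ℝ) - 1) * lam ρ β ^ 2 with hr
  have hn1 : (1 : ℝ) ≤ n := by exact_mod_cast NeZero.one_le
  have hr0 : 0 ≤ r := by
    have : 0 ≤ (n : ℝ) - 1 := by linarith
    positivity
  set L := (Finset.univ : Finset {c : Cell 2 // c ∈ cells 2 N}).card + 1 with hL
  have hsub : (vortexEvent p M : Set (Form 1 N (ZMod n))) ⊆ ⋃ m ∈ Finset.Ico M L,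
      ⋃ ν ∈ (irreducibleAt m p : Finset (Form 2 N (ZMod n))),
        {σ | ∀ p ∈ ν.posSupport, σ.d p = ν p} := by
    rintro σ ⟨P, hPs, hpP, hM, hirr⟩
    have hP := Form.posSupport_restrict hPs
    refine Set.mem_biUnion (x := P.card) ?_ (Set.mem_biUnion (x := σ.d.restrict P) ?_ ?_)
    · simp only [Finset.coe_Ico, Set.mem_Ico]
      exact ⟨hM, Nat.lt_succ_of_le (Finset.card_le_card (Finset.subset_univ _))⟩
    · simp [irreducibleAt, hP, hirr, hpP]
    · intro q hq
      rw [hP] at hq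
      rw [Form.restrict_apply_of_mem hq]
  refine (prob_mono ρ hsub).trans ((prob_biUnion_le ρ _ _).trans ?_)
  have hm : ∀ m ∈ Finset.Ico M L, prob ρ N β
      (⋃ ν ∈ (irreducibleAt m p : Finset (Form 2 N (ZMod n))),
        {σ | ∀ p ∈ ν.posSupport, σ.d p = ν p}) ≤ r ^ m := by
    intro m _
    refine (prob_biUnion_le_card_mul ρ _ _ (C := (lam ρ β ^ 2) ^ m) fun ν hν => ?_).trans ?_
    · obtain ⟨-, hirr, h1, -⟩ := Finset.mem_filter.1 hν
      rw [← h1]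
      exact prob_agree_le ρ hirr.1
    · rw [hr, mul_pow]
      refine mul_le_mul_of_nonneg_right ?_ (by positivity)
      have h1 : ((irreducibleAt m p : Finset (Form 2 N (ZMod n))).card : ℝ) ≤
          ((5 * (n - 1)) ^ m : ℕ) := by exact_mod_cast card_irreducibleAt_le m p
      refine h1.trans (le_of_eq ?_)
      rw [Nat.cast_pow, Nat.cast_mul, Nat.cast_sub NeZero.one_le]
      simp
  refine (Finset.sum_le_sum hm).trans ((geom_sum_Ico_le_of_lt_one hr0 hlam).trans (le_of_eq ?_))
  rw [K0, ← hr, hr, mul_pow, mul_pow, pow_mul]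
  ring

end Gibbs

end

end LatticeGauge

namespace LatticeGauge

noncomputable section

/-! ### Edges surrounded by a constant form -/

section ConstAround

variable {N : ℕ} {G : Type} [AddCommGroup G]

/-- The form `ω` agrees with the vortex `d(g 1_e)` on all plaquettes adjacent to `e`. -/
def Form.ConstAround (ω : Form 2 N G) (e : Cell 1) (g : G) : Prop :=
  ∀ p : {p : Cell 2 // p ∈ cells 2 N}, boundaryCell p.1 e ≠ 0 → ω p = boundaryCell p.1 e • g

open Classical in
/-- The value `g` such that `ω` agrees with `d(g 1_e)` around `e`, or zero if there is none. -/
def Form.circ (ω : Form 2 N G) (e : Cell 1) : G :=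
  if h : ∃ g, ω.ConstAround e g then h.choose else 0

/-- All plaquettes adjacent to `e` are in the box. -/
def IsInner (N : ℕ) (e : Cell 1) : Prop := ∀ p : Cell 2, boundaryCell p e ≠ 0 → p ∈ cells 2 N

lemma exists_coface (e : Cell 1) : ∃ p : Cell 2, boundaryCell p e ≠ 0 := by
  have h : 0 < (cofaces e).card := by rw [card_cofaces]; norm_num
  obtain ⟨p, hp⟩ := Finset.card_pos.1 h
  exact ⟨p, mem_cofaces.1 hp⟩

lemma Form.ConstAround.unique {ω : Form 2 N G} {e : Cell 1} {g g' : G} (he : IsInner N e)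
    (h : ω.ConstAround e g) (h' : ω.ConstAround e g') : g = g' := by
  obtain ⟨p, hp⟩ := exists_coface e
  have h1 := (h ⟨p, he p hp⟩ hp).symm.trans (h' ⟨p, he p hp⟩ hp)
  simp only at h1
  have hu := boundaryCell_eq_or hp
  rw [← smul_smul_of_unit hu g, h1, smul_smul_of_unit hu g']

lemma Form.ConstAround.circ_eq {ω : Form 2 N G} {e : Cell 1} {g : G} (he : IsInner N e)
    (h : ω.ConstAround e g) : ω.circ e = g := by
  have hex : ∃ g, ω.ConstAround e g := ⟨g, h⟩
  rw [Form.circ, dif_pos hex]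
  exact hex.choose_spec.unique he h

lemma Form.circ_of_not {ω : Form 2 N G} {e : Cell 1} (h : ¬ ∃ g, ω.ConstAround e g) :
    ω.circ e = 0 := by
  rw [Form.circ, dif_neg h]

/-- The edges of `γ` that are not corner edges. -/
def straightEdges (γ : Chain 1) : Finset (Cell 1) := γ.support \ cornerEdges γ

lemma eq_of_straight {γ : Chain 1} {e e' : Cell 1} (he : e ∈ straightEdges γ)
    (he' : e' ∈ γ.support) {p : Cell 2} (hp : boundaryCell p e ≠ 0)
    (hp' : boundaryCell p e' ≠ 0) : e' = e := by
  classical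
  by_contra hne
  rw [straightEdges, Finset.mem_sdiff] at he
  refine he.2 ?_
  unfold cornerEdges
  exact Finset.mem_filter.2 ⟨he.1, e', he', hne, p, hp, hp'⟩

end ConstAround

/-! ### The Wilson loop on a typical configuration -/

section Typical

variable {N n : ℕ} [NeZero n]

open Classical in
/-- The sum of the vortices around the straight edges of `γ`. -/
def straightForm (γ : Chain 1) (ω : Form 2 N (ZMod n)) : Form 1 N (ZMod n) :=
  fun e => if e.1 ∈ straightEdges γ then ω.circ e.1 else 0

lemma straightForm_eval {γ : Chain 1} (hγN : γ.support ⊆ cells 1 N) (ω : Form 2 N (ZMod n)) :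
    (straightForm γ ω).eval γ = ∑ e ∈ straightEdges γ, γ e • ω.circ e := by
  classical
  rw [Form.eval]
  have h1 : ∀ e : {e : Cell 1 // e ∈ cells 1 N}, γ e.1 • straightForm γ ω e =
      if e.1 ∈ straightEdges γ then γ e.1 • ω.circ e.1 else 0 := fun e => by
    unfold straightForm; split_ifs <;> simp
  rw [Finset.sum_congr rfl fun e _ => h1 e,
    ← Finset.sum_subtype (cells 1 N) (fun e => Iff.rfl)
      (fun e => if e ∈ straightEdges γ then γ e • ω.circ e else 0),
    Finset.sum_ite_mem, Finset.inter_eq_right.2]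
  exact Finset.sdiff_subset.trans hγN

lemma straightForm_d_of_adjacent {γ : Chain 1} (hγN : γ.support ⊆ cells 1 N)
    (ω : Form 2 N (ZMod n)) {e : Cell 1} (he : e ∈ straightEdges γ)
    {p : {p : Cell 2 // p ∈ cells 2 N}} (hp : boundaryCell p.1 e ≠ 0) :
    (straightForm γ ω).d p = boundaryCell p.1 e • ω.circ e := by
  have heN : e ∈ cells 1 N := hγN (Finset.mem_sdiff.1 he).1
  rw [Form.d, Form.eval, Finset.sum_eq_single ⟨e, heN⟩]
  · simp [straightForm, he]
  · intro e' _ hne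
    by_cases h1 : boundaryCell p.1 e'.1 = 0
    · rw [h1, zero_smul]
    · have : e'.1 ∉ straightEdges γ := fun h =>
        hne (Subtype.ext (eq_of_straight he (Finset.mem_sdiff.1 h).1 hp h1))
      simp [straightForm, this]
  · simp

lemma straightForm_d_of_not_adjacent {γ : Chain 1} (ω : Form 2 N (ZMod n))
    {p : {p : Cell 2 // p ∈ cells 2 N}}
    (hp : ∀ e ∈ straightEdges γ, boundaryCell p.1 e = 0) : (straightForm γ ω).d p = 0 := by
  rw [Form.d, Form.eval]
  refine Finset.sum_eq_zero fun e _ => ?_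
  by_cases he : e.1 ∈ straightEdges γ
  · rw [hp e.1 he, zero_smul]
  · simp [straightForm, he]

/-- A plaquette touches at most one straight edge, whose vortex either cancels `ω` there or is
absent. So the difference is a restriction of `ω`, and its irreducible parts are parts of `ω`. -/
lemma sub_straightForm_d {γ : Chain 1} (hγN : γ.support ⊆ cells 1 N)
    (hinner : ∀ e ∈ γ.support, IsInner N e) (ω : Form 2 N (ZMod n))
    (p : {p : Cell 2 // p ∈ cells 2 N}) :
    (ω - (straightForm γ ω).d) p = 0 ∨ (ω - (straightForm γ ω).d) p = ω p := by
  by_cases h : ∃ e ∈ straightEdges γ, boundaryCell p.1 e ≠ 0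
  · obtain ⟨e, he, hp⟩ := h
    rw [Pi.sub_apply, straightForm_d_of_adjacent hγN ω he hp]
    by_cases hc : ∃ g, ω.ConstAround e g
    · obtain ⟨g, hg⟩ := hc
      left
      rw [hg.circ_eq (hinner e (Finset.mem_sdiff.1 he).1), hg p hp, sub_self]
    · right
      rw [Form.circ_of_not hc, smul_zero, sub_zero]
  · push Not at h
    right
    rw [Pi.sub_apply, straightForm_d_of_not_adjacent ω h, sub_zero]

/-- If a closed form has no nontrivial corner edge, no vortex of size at least `7` close to `γ` and
no vortex of size at least `25` on the surface `q`, then its value on `q` only depends on the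
vortices around the straight edges. -/
lemma eval_eq_sum_circ (hn : 2 ≤ n) (hN : 1 ≤ N) {γ : Chain 1} {q : Chain 2}
    (hqγ : boundary q = γ) (h0 : γ.support.Nonempty) (hγN : γ.support ⊆ cells 1 N)
    (hinner : ∀ e ∈ γ.support, IsInner N e)
    (hq : ∀ p ∈ q.support, ∀ i, -(2 * N : ℤ) + 2 ≤ bary p i ∧ bary p i ≤ 2 * N - 2)
    {ω : Form 2 N (ZMod n)} (hω : ω.d = 0)
    (hcorner : ∀ e ∈ cornerEdges γ, ∀ g, ω.ConstAround e g → g = 0)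
    (hnear : ∀ p : {p : Cell 2 // p ∈ cells 2 N}, p.1 ∈ nearPlaquettes γ q →
      ∀ P ⊆ ω.posSupport, p ∈ P → (ω.restrict P).IsIrreducible → P.card < 7)
    (hfar : ∀ p : {p : Cell 2 // p ∈ cells 2 N}, p.1 ∈ q.support →
      ∀ P ⊆ ω.posSupport, p ∈ P → (ω.restrict P).IsIrreducible → P.card < 25) :
    ω.eval q = ∑ e ∈ straightEdges γ, γ e • ω.circ e := by
  classical
  have hqN : q.support ⊆ cells 2 N := fun p hp => bary_mem_boxRegion.2 fun i => by
    have := hq p hp i; omega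
  set ω' : Form 2 N (ZMod n) := ω - (straightForm γ ω).d with hω'
  have hcase := sub_straightForm_d hγN hinner ω
  rw [← hω'] at hcase
  have hω'd : ω'.d = 0 := by rw [hω', Form.d_sub, hω, Form.d_d, sub_zero]
  have hsub : ω'.posSupport ⊆ ω.posSupport := by
    intro p hp
    rw [Form.mem_posSupport] at hp ⊢
    rwa [(hcase p).resolve_left hp] at hp
  have hrestr : ω.restrict ω'.posSupport = ω' := by
    ext p
    by_cases hp : p ∈ ω'.posSupport
    · rw [Form.restrict_apply_of_mem hp]
      exact ((hcase p).resolve_left (Form.mem_posSupport.1 hp)).symm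
    · rw [Form.restrict_apply_of_notMem hp]
      simpa [Form.mem_posSupport, eq_comm] using hp
  -- Once the vortices around straight edges are removed, no irreducible part that meets `q` has a
  -- nonzero value on it.
  have key : ∀ P ⊆ ω'.posSupport, ∀ p ∈ P, p.1 ∈ q.support → (ω.restrict P).IsIrreducible →
      (ω.restrict P).eval q = 0 := by
    intro P hP p hpP hpq hirr
    have hPω := hP.trans hsub
    have hPs := Form.posSupport_restrict hPω
    by_cases hpn : p.1 ∈ nearPlaquettes γ q
    · have hcard := hnear p hpn P hPω hpP hirr
      obtain ⟨e, g, hg, heq⟩ := Form.eq_single_d_of_card_le hirr.1 (by rw [hPs]; omega)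
        (p := p) (Form.mem_posSupport.1 (by rwa [hPs])) (hq p.1 hpq)
      rw [heq, Form.eval_d _ hqN, hqγ, Form.single_eval]
      -- The value of `d(g 1_e)` on `q` is `γ(e) g`, so `e` would be an edge of `γ`: a corner edge
      -- contradicts `hcorner`, and around a straight edge this vortex has already been subtracted.
      by_contra hne
      have heγ : e.1 ∈ γ.support := Finsupp.mem_support_iff.2 fun h => hne (by rw [h, zero_smul])
      have hcof : ∀ p' : {p : Cell 2 // p ∈ cells 2 N}, boundaryCell p'.1 e.1 ≠ 0 →
          p' ∈ P ∧ ω p' = boundaryCell p'.1 e.1 • g := by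
        intro p' hp'
        have h1 := congrFun heq p'
        rw [Form.single_d] at h1
        have h2 : p' ∈ P := by
          by_contra h
          rw [Form.restrict_apply_of_notMem h] at h1
          exact smul_ne_zero_of_unit (boundaryCell_eq_or hp') hg h1.symm
        exact ⟨h2, by rw [← h1, Form.restrict_apply_of_mem h2]⟩
      have hconst : ω.ConstAround e.1 g := fun p' hp' => (hcof p' hp').2
      by_cases hec : e.1 ∈ cornerEdges γ
      · exact hg (hcorner e.1 hec g hconst)
      · have hes : e.1 ∈ straightEdges γ := Finset.mem_sdiff.2 ⟨heγ, hec⟩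
        obtain ⟨p', hp'⟩ := exists_coface e.1
        have hp'N := hinner e.1 heγ p' hp'
        have h3 := hcof ⟨p', hp'N⟩ hp'
        refine Form.mem_posSupport.1 (hP h3.1) ?_
        rw [hω', Pi.sub_apply, straightForm_d_of_adjacent hγN ω hes hp',
          hconst.circ_eq (hinner e.1 heγ), h3.2, sub_self]
    · have hcard := hfar p hpq P hPω hpP hirr
      obtain ⟨a, ha⟩ := exists_cube_of_irreducible hn hN hirr (by rw [hPs]; omega)
      refine Form.eval_eq_zero_of_far hirr.1 ha hqN hqγ hγN h0 fun e he => ?_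
      have hpc : p.1.IsIn (cube (a - 1) (vortexWidth + 2)) := by
        have h1 := isIn_cube_iff.1 (ha p (by rwa [hPs]))
        refine isIn_cube_iff.2 fun i => ?_
        have h2 := h1 i
        simp only at h2
        simp only [Pi.sub_apply, Pi.one_apply]
        push_cast
        constructor <;> omega
      have hnot : ¬ (e.1 ∈ cube (a - 1) (vortexWidth + 2) ∨
          (e.1 + fun i => if i ∈ e.2.1 then 1 else 0) ∈ cube (a - 1) (vortexWidth + 2)) :=
        fun h => hpn (Finset.mem_filter.2 ⟨hpq, a - 1, hpc, e, he, h⟩)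
      exact not_or.1 hnot
  -- Irreducible parts that meet `q` are stripped off one by one until the support is disjoint from
  -- `q`.
  have main : ∀ (m : ℕ) (S : Finset {p : Cell 2 // p ∈ cells 2 N}), S.card = m →
      S ⊆ ω'.posSupport → (ω.restrict S).d = 0 → (ω.restrict S).eval q = 0 := by
    intro m
    induction m using Nat.strong_induction_on with
    | _ m ih =>
      intro S hSm hS hSd
      by_cases hex : ∃ p ∈ S, p.1 ∈ q.support
      · obtain ⟨p, hpS, hpq⟩ := hex
        have hSs := Form.posSupport_restrict (hS.trans hsub)
        obtain ⟨P, hPS, hpP, hirr⟩ := Form.exists_irreducible_restrict hSd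
          (p := p) (by rwa [hSs])
        rw [hSs] at hPS
        rw [Form.restrict_restrict hPS] at hirr
        have h1 := key P (hPS.trans hS) p hpP hpq hirr
        have h2 := Form.restrict_sdiff (ω := ω) hPS
        have hd2 : (ω.restrict (S \ P)).d = 0 := by
          rw [h2, Form.d_sub, hSd, hirr.1, sub_zero]
        have hcard := Finset.card_sdiff_add_card_eq_card hPS
        have hPpos := Finset.card_pos.2 ⟨p, hpP⟩
        have h3 := ih (S \ P).card (by omega) (S \ P) rfl (Finset.sdiff_subset.trans hS) hd2
        have h4 : ω.restrict S = ω.restrict (S \ P) + ω.restrict P := by rw [h2]; abel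
        rw [h4, Form.eval_add_form, h1, h3, add_zero]
      · push Not at hex
        rw [Form.eval]
        refine Finset.sum_eq_zero fun p _ => ?_
        by_cases hpS : p ∈ S
        · rw [Finsupp.notMem_support_iff.1 (hex p hpS), zero_smul]
        · rw [Form.restrict_apply_of_notMem hpS, smul_zero]
  have h1 : ω'.eval q = 0 := by
    have := main _ ω'.posSupport rfl subset_rfl (by rw [hrestr, hω'd])
    rwa [hrestr] at this
  have h2 : ω = ω' + (straightForm γ ω).d := by rw [hω']; abel
  conv_lhs => rw [h2]
  rw [Form.eval_add_form, h1, zero_add, Form.eval_d _ hqN, hqγ, straightForm_eval hγN]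

end Typical

/-! ### Integrating out the straight edges -/

section Integrate

variable {n : ℕ} [NeZero n] (ρ : AddChar (ZMod n) ℂ) {N : ℕ} {β : ℝ}

lemma d_add_single (σ : Form 1 N (ZMod n)) (e : {e : Cell 1 // e ∈ cells 1 N}) (t : ZMod n)
    (p : {p : Cell 2 // p ∈ cells 2 N}) :
    (σ + Form.single e t).d p = σ.d p + boundaryCell p.1 e.1 • t := by
  rw [Form.d_add, Pi.add_apply, Form.single_d]

/-- Whether the surroundings are constant does not depend on the spin at `e`; only the common value
moves with it. -/
lemma constAround_add_single_self (σ : Form 1 N (ZMod n)) (e : {e : Cell 1 // e ∈ cells 1 N})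
    (t g : ZMod n) :
    (σ + Form.single e t).d.ConstAround e.1 (g + t) ↔ σ.d.ConstAround e.1 g := by
  refine forall_congr' fun p => imp_congr_right fun _ => ?_
  rw [d_add_single, smul_add, add_left_inj]

lemma exists_constAround_add_single_self (σ : Form 1 N (ZMod n))
    (e : {e : Cell 1 // e ∈ cells 1 N}) (t : ZMod n) :
    (∃ g, (σ + Form.single e t).d.ConstAround e.1 g) ↔ ∃ g, σ.d.ConstAround e.1 g := by
  constructor
  · rintro ⟨g, hg⟩
    refine ⟨g - t, ?_⟩
    rw [← constAround_add_single_self σ e t, sub_add_cancel]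
    exact hg
  · rintro ⟨g, hg⟩
    exact ⟨g + t, (constAround_add_single_self σ e t g).2 hg⟩

lemma constAround_add_single_of_ne {γ : Chain 1} (σ : Form 1 N (ZMod n))
    (e : {e : Cell 1 // e ∈ cells 1 N}) (he : e.1 ∈ straightEdges γ) {e' : Cell 1}
    (he' : e' ∈ γ.support) (hne : e' ≠ e.1) (t : ZMod n) :
    (σ + Form.single e t).d.ConstAround e' = σ.d.ConstAround e' := by
  ext g
  refine forall_congr' fun p => imp_congr_right fun hp => ?_
  have : boundaryCell p.1 e.1 = 0 := by
    by_contra h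
    exact hne (eq_of_straight he he' h hp)
  rw [d_add_single, this, zero_smul, add_zero]

open Classical in
lemma card_coface_filter {e : Cell 1} (he : IsInner N e) :
    (Finset.univ.filter fun p : {p : Cell 2 // p ∈ cells 2 N} => boundaryCell p.1 e ≠ 0).card =
      6 := by
  have h := card_cofaces e
  rw [← Finset.card_map (Function.Embedding.subtype _)]
  rw [show 2 * (4 - 1) = 6 from rfl] at h
  rw [← h]
  congr 1
  ext p
  simp only [Finset.mem_map, Finset.mem_filter, Finset.mem_univ, true_and, mem_cofaces,
    Function.Embedding.subtype_apply]
  constructor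
  · rintro ⟨p', hp', rfl⟩; exact hp'
  · intro hp; exact ⟨⟨p, he p hp⟩, hp, rfl⟩

/-- The weight as a function of the spin at an edge with constant surroundings. -/
lemma weight_add_single (σ : Form 1 N (ZMod n)) (e : {e : Cell 1 // e ∈ cells 1 N})
    (he : IsInner N e.1) {g : ZMod n} (hg : σ.d.ConstAround e.1 g) :
    ∃ C : ℝ, ∀ t : ZMod n, weight ρ β (σ + Form.single e t) =
      C * Real.exp (12 * β * (ρ (g + t)).re) := by
  classical
  refine ⟨∏ p ∈ Finset.univ.filter fun p : {p : Cell 2 // p ∈ cells 2 N} =>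
    ¬ boundaryCell p.1 e.1 ≠ 0, Real.exp (2 * β * (ρ (σ.d p)).re), fun t => ?_⟩
  rw [weight_eq_prod, ← Finset.prod_filter_mul_prod_filter_not Finset.univ
    (fun p : {p : Cell 2 // p ∈ cells 2 N} => boundaryCell p.1 e.1 ≠ 0), mul_comm]
  congr 1
  · refine Finset.prod_congr rfl fun p hp => ?_
    have : boundaryCell p.1 e.1 = 0 := not_not.1 (Finset.mem_filter.1 hp).2
    rw [d_add_single, this, zero_smul, add_zero]
  · have h : ∀ p ∈ Finset.univ.filter fun p : {p : Cell 2 // p ∈ cells 2 N} =>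
        boundaryCell p.1 e.1 ≠ 0, Real.exp (2 * β * (ρ ((σ + Form.single e t).d p)).re) =
          Real.exp (2 * β * (ρ (g + t)).re) := by
      intro p hp
      have hp' := (Finset.mem_filter.1 hp).2
      rw [d_add_single, hg p hp', ← smul_add, re_unit_smul ρ _ (boundaryCell_eq_or hp')]
    rw [Finset.prod_congr rfl h, Finset.prod_const, card_coface_filter he, ← Real.exp_nat_mul]
    congr 1
    push_cast; ring

/-- Translation by `g` disappears from the full sum over the group, and the sign `u` because `Re ρ`
is even. What remains is the defining quotient of `θ`. -/
lemma sum_char_mul_exp (u : ℤ) (hu : u = 1 ∨ u = -1) (g : ZMod n) :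
    ∑ t : ZMod n, ρ (u • (g + t)) * (Real.exp (12 * β * (ρ (g + t)).re) : ℂ) =
      theta ρ β * ∑ t : ZMod n, (Real.exp (12 * β * (ρ (g + t)).re) : ℂ) := by
  have e1 : ∑ t : ZMod n, ρ (u • (g + t)) * (Real.exp (12 * β * (ρ (g + t)).re) : ℂ) =
      ∑ t : ZMod n, ρ (u • t) * (Real.exp (12 * β * (ρ t).re) : ℂ) :=
    Equiv.sum_comp (Equiv.addLeft g) fun t => ρ (u • t) * (Real.exp (12 * β * (ρ t).re) : ℂ)
  have e2 : ∑ t : ZMod n, (Real.exp (12 * β * (ρ (g + t)).re) : ℂ) =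
      ∑ t : ZMod n, (Real.exp (12 * β * (ρ t).re) : ℂ) :=
    Equiv.sum_comp (Equiv.addLeft g) fun t => (Real.exp (12 * β * (ρ t).re) : ℂ)
  have e3 : ∑ t : ZMod n, ρ (u • t) * (Real.exp (12 * β * (ρ t).re) : ℂ) =
      ∑ t : ZMod n, ρ t * (Real.exp (12 * β * (ρ t).re) : ℂ) := by
    rcases hu with rfl | rfl
    · simp
    · rw [← Equiv.sum_comp (Equiv.neg (ZMod n))]
      refine Finset.sum_congr rfl fun t _ => ?_
      have := re_unit_smul ρ (-1) (Or.inr rfl) t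
      simp only [Equiv.neg_apply, neg_smul, one_smul, neg_neg] at this ⊢
      rw [this]
  have hpos : (∑ t : ZMod n, (Real.exp (12 * β * (ρ t).re) : ℂ)) ≠ 0 := by
    rw [← Complex.ofReal_sum, Complex.ofReal_ne_zero]
    exact (Finset.sum_pos (fun t _ => Real.exp_pos _) Finset.univ_nonempty).ne'
  rw [e1, e2, e3, theta_eq, thetaC, div_mul_cancel₀ _ hpos]

open Classical in
/-- The factor that remains after integrating out the spin at `e`. -/
def thetaFactor (β : ℝ) (σ : Form 1 N (ZMod n)) (e : Cell 1) : ℂ :=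
  if ∃ g, σ.d.ConstAround e g then (theta ρ β : ℂ) else 1

lemma sum_shift (e : {e : Cell 1 // e ∈ cells 1 N}) (F : Form 1 N (ZMod n) → ℂ) :
    (n : ℂ) * ∑ σ, F σ = ∑ σ, ∑ t : ZMod n, F (σ + Form.single e t) := by
  rw [Finset.sum_comm]
  have : ∀ t : ZMod n, ∑ σ : Form 1 N (ZMod n), F (σ + Form.single e t) = ∑ σ, F σ := fun t =>
    Equiv.sum_comp (Equiv.addRight (Form.single e t)) F
  rw [Finset.sum_congr rfl fun t _ => this t]
  simp [ZMod.card]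

/-- Every sum over configurations is averaged over the spin at `e`. Constant surroundings give the
factor `θ`; otherwise `circ` is zero by convention and the factor is one, whatever the spin. -/
lemma sum_integrate_edge (u : ℤ) (hu : u = 1 ∨ u = -1) (e : {e : Cell 1 // e ∈ cells 1 N})
    (he : IsInner N e.1) {H : Form 1 N (ZMod n) → ℂ}
    (hH : ∀ σ t, H (σ + Form.single e t) = H σ) :
    ∑ σ : Form 1 N (ZMod n), ρ (u • σ.d.circ e.1) * H σ * (weight ρ β σ : ℂ) =
      ∑ σ : Form 1 N (ZMod n), thetaFactor ρ β σ e.1 * H σ * (weight ρ β σ : ℂ) := by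
  have hn0 : (n : ℂ) ≠ 0 := Nat.cast_ne_zero.2 (NeZero.ne n)
  refine mul_left_cancel₀ hn0 ?_
  rw [sum_shift e, sum_shift e]
  refine Finset.sum_congr rfl fun σ _ => ?_
  by_cases hc : ∃ g, σ.d.ConstAround e.1 g
  · have hθ : ∀ t, thetaFactor ρ β (σ + Form.single e t) e.1 = theta ρ β := fun t => by
      rw [thetaFactor, if_pos ((exists_constAround_add_single_self σ e t).2 hc)]
    obtain ⟨g, hg⟩ := hc
    have hcirc : ∀ t, (σ + Form.single e t).d.circ e.1 = g + t := fun t =>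
      ((constAround_add_single_self σ e t g).2 hg).circ_eq he
    obtain ⟨C, hC⟩ := weight_add_single ρ (β := β) σ e he hg
    simp only [hH, hθ, hcirc, hC]
    have h := sum_char_mul_exp ρ (β := β) u hu g
    calc ∑ t : ZMod n, ρ (u • (g + t)) * H σ *
          ((C * Real.exp (12 * β * (ρ (g + t)).re) : ℝ) : ℂ)
        = H σ * C * ∑ t : ZMod n, ρ (u • (g + t)) *
            (Real.exp (12 * β * (ρ (g + t)).re) : ℂ) := by
          rw [Finset.mul_sum]
          refine Finset.sum_congr rfl fun t _ => ?_
          rw [Complex.ofReal_mul]; ring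
      _ = ∑ t : ZMod n, theta ρ β * H σ *
            ((C * Real.exp (12 * β * (ρ (g + t)).re) : ℝ) : ℂ) := by
          rw [h, Finset.mul_sum, Finset.mul_sum]
          refine Finset.sum_congr rfl fun t _ => ?_
          rw [Complex.ofReal_mul]; ring
  · refine Finset.sum_congr rfl fun t _ => ?_
    have hc' := (exists_constAround_add_single_self σ e t).not.2 hc
    rw [thetaFactor, if_neg hc', Form.circ_of_not hc', smul_zero, AddChar.map_zero_eq_one]

lemma circ_add_single_of_ne {γ : Chain 1} (σ : Form 1 N (ZMod n))
    (e : {e : Cell 1 // e ∈ cells 1 N}) (he : e.1 ∈ straightEdges γ) {e' : Cell 1}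
    (he' : e' ∈ γ.support) (hne : e' ≠ e.1) (t : ZMod n) :
    (σ + Form.single e t).d.circ e' = σ.d.circ e' := by
  unfold Form.circ
  rw [constAround_add_single_of_ne σ e he he' hne t]

lemma thetaFactor_add_single_of_ne {γ : Chain 1} (σ : Form 1 N (ZMod n))
    (e : {e : Cell 1 // e ∈ cells 1 N}) (he : e.1 ∈ straightEdges γ) {e' : Cell 1}
    (he' : e' ∈ γ.support) (hne : e' ≠ e.1) (t : ZMod n) :
    thetaFactor ρ β (σ + Form.single e t) e' = thetaFactor ρ β σ e' := by
  unfold thetaFactor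
  rw [constAround_add_single_of_ne σ e he he' hne t]

/-- One edge at a time: the factors of the other edges do not depend on the spin at a straight edge,
so they may be moved into `H`. -/
lemma sum_integrate_edges {γ : Chain 1} (hγ : IsGeneralizedLoop γ) (hγN : γ.support ⊆ cells 1 N)
    (hinner : ∀ e ∈ γ.support, IsInner N e) (S : Finset (Cell 1)) :
    S ⊆ straightEdges γ → ∀ H : Form 1 N (ZMod n) → ℂ,
    (∀ e : {e : Cell 1 // e ∈ cells 1 N}, e.1 ∈ S → ∀ σ t, H (σ + Form.single e t) = H σ) →
    ∑ σ : Form 1 N (ZMod n), (∏ e ∈ S, ρ (γ e • σ.d.circ e)) * H σ * (weight ρ β σ : ℂ) =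
      ∑ σ : Form 1 N (ZMod n), (∏ e ∈ S, thetaFactor ρ β σ e) * H σ * (weight ρ β σ : ℂ) := by
  classical
  induction S using Finset.induction_on with
  | empty => intro _ H _; simp
  | insert e S heS ih =>
    intro hS H hH
    have hes : e ∈ straightEdges γ := hS (Finset.mem_insert_self e S)
    have hSs : S ⊆ straightEdges γ := (Finset.subset_insert e S).trans hS
    have heγ : e ∈ γ.support := (Finset.mem_sdiff.1 hes).1
    have hSγ : ∀ e' ∈ S, e' ∈ γ.support := fun e' he' => (Finset.mem_sdiff.1 (hSs he')).1
    have hu : γ e = 1 ∨ γ e = -1 := by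
      have := hγ.1 e
      have := Finsupp.mem_support_iff.1 heγ
      tauto
    have h1 := sum_integrate_edge ρ (β := β) (γ e) hu ⟨e, hγN heγ⟩ (hinner e heγ)
      (H := fun σ => (∏ e' ∈ S, ρ (γ e' • σ.d.circ e')) * H σ) (fun σ t => by
        rw [hH ⟨e, hγN heγ⟩ (Finset.mem_insert_self e S)]
        congr 1
        refine Finset.prod_congr rfl fun e' he' => ?_
        have hne : e' ≠ e := fun h => heS (h ▸ he')
        rw [circ_add_single_of_ne σ ⟨e, hγN heγ⟩ hes (hSγ e' he') hne])
    have h2 := ih hSs (fun σ => thetaFactor ρ β σ e * H σ) (fun e' he' σ t => by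
      rw [hH e' (Finset.mem_insert_of_mem he'),
        thetaFactor_add_single_of_ne ρ σ e' (hSs he') heγ (fun h => heS (h ▸ he'))])
    calc _ = ∑ σ : Form 1 N (ZMod n), ρ (γ e • σ.d.circ e) *
          ((∏ e' ∈ S, ρ (γ e' • σ.d.circ e')) * H σ) * (weight ρ β σ : ℂ) := by
          refine Finset.sum_congr rfl fun σ _ => ?_
          rw [Finset.prod_insert heS]; ring
      _ = _ := h1
      _ = ∑ σ : Form 1 N (ZMod n), (∏ e' ∈ S, ρ (γ e' • σ.d.circ e')) *
          (thetaFactor ρ β σ e * H σ) * (weight ρ β σ : ℂ) := by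
          refine Finset.sum_congr rfl fun σ _ => ?_
          ring
      _ = _ := h2
      _ = _ := by
          refine Finset.sum_congr rfl fun σ _ => ?_
          rw [Finset.prod_insert heS]; ring

lemma expect_eq_sum_weight (f : Form 1 N (ZMod n) → ℂ) : expect ρ N β f =
    (∑ σ, f σ * (weight ρ β σ : ℂ)) / ((∑ τ : Form 1 N (ZMod n), weight ρ β τ : ℝ) : ℂ) := by
  rw [expect, Finset.sum_div]
  refine Finset.sum_congr rfl fun σ _ => ?_
  rw [gibbs_eq, Complex.ofReal_div, mul_div_assoc]

open Classical in
/-- The number of straight edges with constant surroundings. -/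
def constCount (γ : Chain 1) (σ : Form 1 N (ZMod n)) : ℕ :=
  ((straightEdges γ).filter fun e => ∃ g, σ.d.ConstAround e g).card

lemma map_sum_eq_prod {ι : Type*} (s : Finset ι) (f : ι → ZMod n) :
    ρ (∑ i ∈ s, f i) = ∏ i ∈ s, ρ (f i) := by
  classical
  induction s using Finset.induction_on with
  | empty => simp
  | insert i s hi ih => rw [Finset.sum_insert hi, Finset.prod_insert hi, AddChar.map_add_eq_mul, ih]

lemma prod_thetaFactor (γ : Chain 1) (σ : Form 1 N (ZMod n)) :
    ∏ e ∈ straightEdges γ, thetaFactor ρ β σ e = (theta ρ β : ℂ) ^ constCount γ σ := by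
  classical
  unfold thetaFactor constCount
  rw [Finset.prod_ite, Finset.prod_const, Finset.prod_const_one, mul_one]

lemma expect_straight {γ : Chain 1} (hγ : IsGeneralizedLoop γ) (hγN : γ.support ⊆ cells 1 N)
    (hinner : ∀ e ∈ γ.support, IsInner N e) :
    expect ρ N β (fun σ => ρ (∑ e ∈ straightEdges γ, γ e • σ.d.circ e)) =
      expect ρ N β (fun σ => (theta ρ β : ℂ) ^ constCount γ σ) := by
  have h := sum_integrate_edges ρ (β := β) hγ hγN hinner (straightEdges γ) subset_rfl (fun _ => 1)
    (fun _ _ _ _ => rfl)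
  simp only [mul_one] at h
  rw [expect_eq_sum_weight, expect_eq_sum_weight]
  simp only [map_sum_eq_prod, ← prod_thetaFactor]
  rw [h]

end Integrate

end

end LatticeGauge

namespace LatticeGauge

noncomputable section

/-! ### Estimates for `θ` and `λ` -/

section Constants

variable {n : ℕ} [NeZero n] (ρ : AddChar (ZMod n) ℂ) {β β₀ : ℝ}

lemma re_char_le_one (g : ZMod n) : (ρ g).re ≤ 1 :=
  (Complex.re_le_norm _).trans (AddChar.norm_apply ρ g).le

lemma neg_one_le_re_char (g : ZMod n) : -1 ≤ (ρ g).re :=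
  (abs_le.1 ((Complex.abs_re_le_norm _).trans (AddChar.norm_apply ρ g).le)).1

lemma re_char_lt_one (hρ : Function.Injective ρ) {g : ZMod n} (hg : g ≠ 0) : (ρ g).re < 1 := by
  refine lt_of_le_of_ne (re_char_le_one ρ g) fun h => hg (hρ ?_)
  rw [AddChar.map_zero_eq_one]
  have h1 := AddChar.norm_apply ρ g
  have h2 := Complex.normSq_eq_norm_sq (ρ g)
  rw [h1, Complex.normSq_apply, h] at h2
  refine Complex.ext (by simpa using h) ?_
  have : (ρ g).im * (ρ g).im = 0 := by linarith
  simpa using this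

lemma exists_ne_zero_zmod (hn : 2 ≤ n) : ∃ g : ZMod n, g ≠ 0 := by
  have : Fact (1 < n) := ⟨hn⟩
  exact ⟨1, one_ne_zero⟩

lemma lam_pos (hn : 2 ≤ n) : 0 < lam ρ β := by
  obtain ⟨g, hg⟩ := exists_ne_zero_zmod hn
  exact lt_of_lt_of_le (by positivity) (le_lam ρ hg)

lemma one_sub_theta_eq : 1 - theta ρ β =
    (∑ g : ZMod n, (1 - (ρ g).re) * Real.exp (12 * β * (ρ g).re)) /
      ∑ g : ZMod n, Real.exp (12 * β * (ρ g).re) := by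
  have hpos : 0 < ∑ g : ZMod n, Real.exp (12 * β * (ρ g).re) :=
    Finset.sum_pos (fun t _ => Real.exp_pos _) Finset.univ_nonempty
  have h : theta ρ β = (∑ g : ZMod n, (ρ g).re * Real.exp (12 * β * (ρ g).re)) /
      ∑ g : ZMod n, Real.exp (12 * β * (ρ g).re) := by
    rw [theta, thetaC, ← Complex.ofReal_sum, Complex.div_ofReal_re, Complex.re_sum]
    congr 1
    exact Finset.sum_congr rfl fun g _ => Complex.re_mul_ofReal _ _
  rw [h, eq_div_iff hpos.ne', sub_mul, div_mul_cancel₀ _ hpos.ne', one_mul,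
    ← Finset.sum_sub_distrib]
  exact Finset.sum_congr rfl fun g _ => by ring

lemma one_sub_theta_pos (hn : 2 ≤ n) (hρ : Function.Injective ρ) : 0 < 1 - theta ρ β := by
  obtain ⟨g, hg⟩ := exists_ne_zero_zmod hn
  rw [one_sub_theta_eq]
  refine div_pos (Finset.sum_pos' (fun t _ => ?_) ⟨g, Finset.mem_univ g, ?_⟩)
    (Finset.sum_pos (fun t _ => Real.exp_pos _) Finset.univ_nonempty)
  · exact mul_nonneg (sub_nonneg.2 (re_char_le_one ρ t)) (Real.exp_pos _).le
  · exact mul_pos (sub_pos.2 (re_char_lt_one ρ hρ hg)) (Real.exp_pos _)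

lemma exp_le_lam_pow_mul {g : ZMod n} (hg : g ≠ 0) :
    Real.exp (12 * β * (ρ g).re) ≤ lam ρ β ^ 12 * Real.exp (12 * β * (ρ 0).re) := by
  have h := exp_le_lam_sq_mul ρ (β := β) hg
  have h2 : ∀ x : ℝ, Real.exp (12 * β * x) = Real.exp (2 * β * x) ^ 6 := fun x => by
    rw [← Real.exp_nat_mul]; congr 1; push_cast; ring
  rw [h2, h2, show lam ρ β ^ 12 = (lam ρ β ^ 2) ^ 6 by ring, ← mul_pow]
  exact pow_le_pow_left₀ (Real.exp_pos _).le h 6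

/-- The neutral element contributes nothing to the numerator; each other element has `1 - Re ρ ≤ 2`
and weight at most `λ^12` times that of the neutral one. This also makes the supremum `Kstar`
finite. -/
lemma one_sub_theta_le : 1 - theta ρ β ≤ 2 * ((n : ℝ) - 1) * lam ρ β ^ 12 := by
  classical
  have hpos : 0 < ∑ g : ZMod n, Real.exp (12 * β * (ρ g).re) :=
    Finset.sum_pos (fun t _ => Real.exp_pos _) Finset.univ_nonempty
  have hn1 : (1 : ℝ) ≤ n := by exact_mod_cast NeZero.one_le
  rw [one_sub_theta_eq, div_le_iff₀ hpos]
  have h0 : Real.exp (12 * β * (ρ 0).re) ≤ ∑ g : ZMod n, Real.exp (12 * β * (ρ g).re) :=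
    Finset.single_le_sum (f := fun g : ZMod n => Real.exp (12 * β * (ρ g).re))
      (fun g _ => (Real.exp_pos _).le) (Finset.mem_univ 0)
  have h1 : ∑ g : ZMod n, (1 - (ρ g).re) * Real.exp (12 * β * (ρ g).re) ≤
      ∑ g : ZMod n, if g ≠ 0 then 2 * (lam ρ β ^ 12 * Real.exp (12 * β * (ρ 0).re)) else 0 := by
    refine Finset.sum_le_sum fun g _ => ?_
    split_ifs with hg
    · have := neg_one_le_re_char ρ g
      exact mul_le_mul (by linarith) (exp_le_lam_pow_mul ρ hg) (Real.exp_pos _).le (by norm_num)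
    · rw [not_not.1 hg, AddChar.map_zero_eq_one]; simp
  refine h1.trans ?_
  rw [← Finset.sum_filter, Finset.sum_const, card_ne_zero_zmod, nsmul_eq_mul,
    Nat.cast_sub NeZero.one_le, Nat.cast_one]
  have : 0 ≤ 2 * ((n : ℝ) - 1) * lam ρ β ^ 12 := by
    have : 0 ≤ (n : ℝ) - 1 := by linarith
    positivity
  calc ((n : ℝ) - 1) * (2 * (lam ρ β ^ 12 * Real.exp (12 * β * (ρ 0).re)))
      = 2 * ((n : ℝ) - 1) * lam ρ β ^ 12 * Real.exp (12 * β * (ρ 0).re) := by ring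
    _ ≤ _ := mul_le_mul_of_nonneg_left h0 this

lemma Kstar_term_le (hn : 2 ≤ n) :
    (1 - theta ρ β) * (lam ρ β ^ 12)⁻¹ ≤ 2 * ((n : ℝ) - 1) := by
  rw [← div_eq_mul_inv, div_le_iff₀ (pow_pos (lam_pos ρ hn) 12)]
  exact one_sub_theta_le ρ

lemma one_sub_theta_le_Kstar (hn : 2 ≤ n) (hβ : β₀ < β) :
    1 - theta ρ β ≤ Kstar ρ β₀ * lam ρ β ^ 12 := by
  rw [← div_le_iff₀ (pow_pos (lam_pos ρ hn) 12), div_eq_mul_inv]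
  refine le_ciSup (f := fun β : Set.Ioi β₀ => (1 - theta ρ β) * (lam ρ β ^ 12)⁻¹)
    ⟨2 * ((n : ℝ) - 1), ?_⟩ ⟨β, hβ⟩
  rintro _ ⟨β', rfl⟩
  exact Kstar_term_le ρ hn

lemma Kstar_le (hn : 2 ≤ n) : Kstar ρ β₀ ≤ 2 * ((n : ℝ) - 1) := by
  have : Nonempty (Set.Ioi β₀) := ⟨⟨β₀ + 1, by simp⟩⟩
  exact ciSup_le fun β' => Kstar_term_le ρ hn

lemma Kstar_pos (hn : 2 ≤ n) (hρ : Function.Injective ρ) : 0 < Kstar ρ β₀ := by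
  have h1 := one_sub_theta_le_Kstar ρ (β₀ := β₀) (β := β₀ + 1) hn (by linarith)
  have h2 := one_sub_theta_pos ρ (β := β₀ + 1) hn hρ
  exact pos_of_mul_pos_left (h2.trans_le h1) (pow_pos (lam_pos ρ hn) 12).le

end Constants

/-! ### Events around edges -/

section Events

variable {n : ℕ} [NeZero n] (ρ : AddChar (ZMod n) ℂ) {N : ℕ} {β : ℝ}

open Classical in
lemma posSupport_single_d (e : {e : Cell 1 // e ∈ cells 1 N}) {g : ZMod n} (hg : g ≠ 0) :
    (Form.single e g).d.posSupport =
      Finset.univ.filter fun p : {p : Cell 2 // p ∈ cells 2 N} => boundaryCell p.1 e.1 ≠ 0 := by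
  ext p
  simp only [Form.mem_posSupport, Finset.mem_filter, Finset.mem_univ, true_and, Form.single_d]
  refine ⟨fun h h0 => h (by rw [h0, zero_smul]), fun h => ?_⟩
  exact smul_ne_zero_of_unit (boundaryCell_eq_or h) hg

/-- For each of the `n - 1` nonzero values, `dσ` agrees with a closed form on its six plaquettes. -/
lemma prob_constAround_ne_zero_le (e : {e : Cell 1 // e ∈ cells 1 N}) (he : IsInner N e.1) :
    prob ρ N β {σ | ∃ g, g ≠ 0 ∧ σ.d.ConstAround e.1 g} ≤ ((n : ℝ) - 1) * lam ρ β ^ 12 := by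
  classical
  have hsub : {σ : Form 1 N (ZMod n) | ∃ g, g ≠ 0 ∧ σ.d.ConstAround e.1 g} ⊆
      ⋃ g ∈ Finset.univ.filter fun g : ZMod n => g ≠ 0,
        {σ | ∀ p ∈ (Form.single e g).d.posSupport, σ.d p = (Form.single e g).d p} := by
    rintro σ ⟨g, hg, hσ⟩
    refine Set.mem_biUnion (x := g) (by simpa using hg) fun p hp => ?_
    rw [posSupport_single_d e hg, Finset.mem_filter] at hp
    rw [Form.single_d, hσ p hp.2]
  refine (prob_mono ρ hsub).trans ((prob_biUnion_le_card_mul ρ _ _ (C := lam ρ β ^ 12)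
    fun g hg => ?_).trans (le_of_eq ?_))
  · have hg' : g ≠ 0 := (Finset.mem_filter.1 hg).2
    refine (prob_agree_le ρ (Form.d_d _)).trans (le_of_eq ?_)
    rw [posSupport_single_d e hg', card_coface_filter he, ← pow_mul]
  · rw [card_ne_zero_zmod, Nat.cast_sub NeZero.one_le, Nat.cast_one]

/-- If `dσ` vanishes around `e`, the surroundings are constant with value zero. Otherwise one of the
six plaquettes lies in a vortex, of size at least one. -/
lemma prob_not_constAround_le (hlam : 5 * ((n : ℝ) - 1) * lam ρ β ^ 2 < 1) {e : Cell 1}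
    (he : IsInner N e) :
    prob ρ N β {σ | ¬ ∃ g, σ.d.ConstAround e g} ≤ 6 * (K0 ρ 1 β * lam ρ β ^ 2) := by
  classical
  have hsub : {σ : Form 1 N (ZMod n) | ¬ ∃ g, σ.d.ConstAround e g} ⊆
      ⋃ p ∈ Finset.univ.filter fun p : {p : Cell 2 // p ∈ cells 2 N} => boundaryCell p.1 e ≠ 0,
        vortexEvent p 1 := by
    intro σ hσ
    obtain ⟨p, hp, hp0⟩ : ∃ p : {p : Cell 2 // p ∈ cells 2 N}, boundaryCell p.1 e ≠ 0 ∧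
        σ.d p ≠ 0 := by
      by_contra hcon
      push Not at hcon
      exact hσ ⟨0, fun p hp => by rw [hcon p hp, smul_zero]⟩
    refine Set.mem_biUnion (x := p) (by simpa using hp) ?_
    obtain ⟨P, hP, hpP, hirr⟩ := Form.exists_irreducible_restrict (Form.d_d σ)
      (Form.mem_posSupport.2 hp0)
    exact ⟨P, hP, hpP, Finset.card_pos.2 ⟨p, hpP⟩, hirr⟩
  refine (prob_mono ρ hsub).trans ((prob_biUnion_le_card_mul ρ _ _
    fun p _ => prob_vortexEvent_le ρ hlam p 1).trans (le_of_eq ?_))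
  rw [card_coface_filter he]
  norm_num

/-! ### Comparison of expectations -/

lemma norm_expect_sub_le {f g : Form 1 N (ZMod n) → ℂ} {h : Form 1 N (ZMod n) → ℝ}
    (hfg : ∀ σ, ‖f σ - g σ‖ ≤ h σ) :
    ‖expect ρ N β f - expect ρ N β g‖ ≤ ∑ σ, h σ * gibbs ρ N β σ := by
  rw [expect, expect, ← Finset.sum_sub_distrib]
  refine (norm_sum_le _ _).trans (Finset.sum_le_sum fun σ _ => ?_)
  have h0 := gibbs_nonneg ρ (β := β) σ
  rw [← sub_mul, norm_mul, Complex.norm_real, Real.norm_of_nonneg h0]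
  exact mul_le_mul_of_nonneg_right (hfg σ) h0

lemma expect_const (c : ℂ) : expect ρ N β (fun _ => c) = c := by
  rw [expect, ← Finset.mul_sum, ← Complex.ofReal_sum, sum_gibbs, Complex.ofReal_one, mul_one]

/-- Two observables of modulus one that agree off `A` have expectations at distance at most
`2 ℙ(A)`. -/
lemma norm_expect_sub_le_prob {f g : Form 1 N (ZMod n) → ℂ} {A : Set (Form 1 N (ZMod n))}
    (hf : ∀ σ, ‖f σ‖ ≤ 1) (hg : ∀ σ, ‖g σ‖ ≤ 1) (hA : ∀ σ ∉ A, f σ = g σ) :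
    ‖expect ρ N β f - expect ρ N β g‖ ≤ 2 * prob ρ N β A := by
  classical
  refine (norm_expect_sub_le ρ (h := fun σ => if σ ∈ A then 2 else 0) fun σ => ?_).trans
    (le_of_eq ?_)
  · split_ifs with h
    · refine (norm_sub_le _ _).trans ?_
      have := hf σ; have := hg σ
      linarith
    · rw [hA σ h, sub_self, norm_zero]
  · rw [prob, Finset.mul_sum]
    refine Finset.sum_congr rfl fun σ _ => ?_
    split_ifs <;> simp

/-- Bernoulli's inequality bounds `1 - t^k` by `k(1 - t)`. -/
lemma abs_pow_sub_pow_le {t : ℝ} (h0 : 0 ≤ t) (h1 : t ≤ 1) {c m : ℕ} (hcm : c ≤ m) :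
    |t ^ c - t ^ m| ≤ (1 - t) * ((m : ℝ) - c) := by
  obtain ⟨k, rfl⟩ := Nat.exists_eq_add_of_le hcm
  have hB := one_add_mul_le_pow (a := t - 1) (by linarith) k
  rw [add_sub_cancel] at hB
  have hk : t ^ k ≤ 1 := pow_le_one₀ h0 h1
  have hc : t ^ c ≤ 1 := pow_le_one₀ h0 h1
  have hc0 : 0 ≤ t ^ c := pow_nonneg h0 c
  have e : t ^ c - t ^ (c + k) = t ^ c * (1 - t ^ k) := by rw [pow_add]; ring
  rw [e, abs_of_nonneg (mul_nonneg hc0 (by linarith))]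
  push_cast
  nlinarith

/-- Both sides are `m`-th powers of numbers in `[0, 1]`, with bases that differ by at most `u²`;
exchanging one factor at a time costs at most `u²` each. -/
lemma abs_pow_sub_exp_le {u : ℝ} (h0 : 0 ≤ u) (h1 : u ≤ 1) (m : ℕ) :
    |(1 - u) ^ m - Real.exp (-(m : ℝ) * u)| ≤ m * u ^ 2 := by
  have e : Real.exp (-(m : ℝ) * u) = Real.exp (-u) ^ m := by
    rw [← Real.exp_nat_mul]; congr 1; ring
  have h2 : |Real.exp (-u) - 1 - -u| ≤ (-u) ^ 2 :=
    Real.abs_exp_sub_one_sub_id_le (by rwa [abs_neg, abs_of_nonneg h0])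
  have h3 : 1 - u ≤ Real.exp (-u) := by have := Real.add_one_le_exp (-u); linarith
  have h4 : Real.exp (-u) ≤ 1 := Real.exp_le_one_iff.2 (by linarith)
  have h5 : Real.exp (-u) - (1 - u) ≤ u ^ 2 := by
    have := (abs_le.1 h2).2
    nlinarith
  rw [e]
  induction m with
  | zero => simp
  | succ m ih =>
    have e2 : (1 - u) ^ (m + 1) - Real.exp (-u) ^ (m + 1) =
        (1 - u) * ((1 - u) ^ m - Real.exp (-u) ^ m) -
          Real.exp (-u) ^ m * (Real.exp (-u) - (1 - u)) := by ring
    have hp : Real.exp (-u) ^ m ≤ 1 := pow_le_one₀ (Real.exp_pos _).le h4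
    have hp0 : 0 ≤ Real.exp (-u) ^ m := by positivity
    rw [e2]
    have ih' := ih (by rw [← Real.exp_nat_mul]; congr 1; ring)
    refine (abs_sub _ _).trans ?_
    rw [abs_mul, abs_mul, abs_of_nonneg (by linarith : 0 ≤ 1 - u), abs_of_nonneg hp0,
      abs_of_nonneg (by linarith : 0 ≤ Real.exp (-u) - (1 - u))]
    have k1 : (1 - u) * |(1 - u) ^ m - Real.exp (-u) ^ m| ≤ 1 * (m * u ^ 2) :=
      mul_le_mul (by linarith) ih' (abs_nonneg _) (by norm_num)
    have k2 : Real.exp (-u) ^ m * (Real.exp (-u) - (1 - u)) ≤ 1 * u ^ 2 :=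
      mul_le_mul hp h5 (by linarith) (by norm_num)
    push_cast
    linarith

lemma card_straightEdges_add (γ : Chain 1) :
    (straightEdges γ).card + (cornerEdges γ).card = γ.support.card :=
  Finset.card_sdiff_add_card_eq_card (by classical unfold cornerEdges; exact Finset.filter_subset _ _)

/-- The exponents differ by the number of corner edges plus the number of straight edges with
nonconstant surroundings, whose expectation is a sum of small probabilities. -/
lemma norm_expect_theta_pow_sub_le {γ : Chain 1} (hinner : ∀ e ∈ γ.support, IsInner N e)
    (h0 : 0 ≤ theta ρ β) (h1 : theta ρ β ≤ 1) (hlam : 5 * ((n : ℝ) - 1) * lam ρ β ^ 2 < 1) :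
    ‖expect ρ N β (fun σ => (theta ρ β : ℂ) ^ constCount γ σ) -
        ((theta ρ β ^ γ.support.card : ℝ) : ℂ)‖ ≤
      (1 - theta ρ β) * ((cornerEdges γ).card +
        (straightEdges γ).card * (6 * (K0 ρ 1 β * lam ρ β ^ 2))) := by
  classical
  set B : Cell 1 → Set (Form 1 N (ZMod n)) := fun e => {σ | ¬ ∃ g, σ.d.ConstAround e g} with hB
  have hcount : ∀ σ : Form 1 N (ZMod n), (γ.support.card : ℝ) - constCount γ σ =
      (cornerEdges γ).card + ∑ e ∈ straightEdges γ, if σ ∈ B e then (1 : ℝ) else 0 := by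
    intro σ
    have e1 := card_straightEdges_add γ
    have e2 := Finset.card_filter_add_card_filter_not (s := straightEdges γ)
      (fun e => ∃ g, σ.d.ConstAround e g)
    have e3 : constCount γ σ = ((straightEdges γ).filter fun e => ∃ g, σ.d.ConstAround e g).card :=
      by unfold constCount; congr
    rw [← Finset.sum_filter, Finset.sum_const, nsmul_eq_mul, mul_one, e3, ← e1, ← e2]
    simp only [hB, Set.mem_ofPred_eq]
    push_cast; ring
  have hle : ∀ σ : Form 1 N (ZMod n), constCount γ σ ≤ γ.support.card := by
    intro σ
    have : (constCount γ σ : ℝ) ≤ γ.support.card := by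
      rw [← sub_nonneg, hcount σ]
      exact add_nonneg (by positivity) (Finset.sum_nonneg fun e _ => by split_ifs <;> norm_num)
    exact_mod_cast this
  rw [← expect_const ρ (N := N) (β := β) ((theta ρ β ^ γ.support.card : ℝ) : ℂ)]
  refine (norm_expect_sub_le ρ (h := fun σ => (1 - theta ρ β) * ((cornerEdges γ).card +
    ∑ e ∈ straightEdges γ, if σ ∈ B e then (1 : ℝ) else 0)) fun σ => ?_).trans ?_
  · rw [← hcount σ, ← Complex.ofReal_pow, ← Complex.ofReal_sub, Complex.norm_real, Real.norm_eq_abs]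
    exact abs_pow_sub_pow_le h0 h1 (hle σ)
  · have hsum : ∑ σ : Form 1 N (ZMod n), (1 - theta ρ β) * ((cornerEdges γ).card +
        ∑ e ∈ straightEdges γ, if σ ∈ B e then (1 : ℝ) else 0) * gibbs ρ N β σ =
        (1 - theta ρ β) * ((cornerEdges γ).card + ∑ e ∈ straightEdges γ, prob ρ N β (B e)) := by
      have e1 : ∑ e ∈ straightEdges γ, prob ρ N β (B e) = ∑ σ : Form 1 N (ZMod n),
          (∑ e ∈ straightEdges γ, if σ ∈ B e then (1 : ℝ) else 0) * gibbs ρ N β σ := by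
        simp only [prob]
        rw [Finset.sum_comm]
        refine Finset.sum_congr rfl fun σ _ => ?_
        rw [Finset.sum_mul]
        exact Finset.sum_congr rfl fun e _ => by split_ifs <;> simp
      have e2 : ((cornerEdges γ).card : ℝ) = ∑ σ : Form 1 N (ZMod n),
          ((cornerEdges γ).card : ℝ) * gibbs ρ N β σ := by
        rw [← Finset.mul_sum, sum_gibbs, mul_one]
      conv_rhs => rw [e1, e2]
      rw [← Finset.sum_add_distrib, Finset.mul_sum]
      exact Finset.sum_congr rfl fun σ _ => by ring
    rw [hsum]
    refine mul_le_mul_of_nonneg_left (add_le_add le_rfl ?_) (by linarith)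
    rw [← nsmul_eq_mul]
    exact Finset.sum_le_card_nsmul _ _ _ fun e he =>
      prob_not_constAround_le ρ hlam (hinner e (Finset.mem_sdiff.1 he).1)

/-- The Wilson loop is a product over straight edges up to an event of small probability. -/
lemma norm_expect_wilson_sub_le (hn : 2 ≤ n) (hN : 1 ≤ N) {γ : Chain 1} {q : Chain 2}
    (hγ : IsGeneralizedLoop γ) (hqγ : boundary q = γ) (h0 : γ.support.Nonempty)
    (hγN : γ.support ⊆ cells 1 N) (hinner : ∀ e ∈ γ.support, IsInner N e)
    (hq : ∀ p ∈ q.support, ∀ i, -(2 * N : ℤ) + 2 ≤ bary p i ∧ bary p i ≤ 2 * N - 2)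
    (hlam : 5 * ((n : ℝ) - 1) * lam ρ β ^ 2 < 1) :
    ‖expect ρ N β (wilson ρ γ) - expect ρ N β (fun σ => (theta ρ β : ℂ) ^ constCount γ σ)‖ ≤
      2 * ((cornerEdges γ).card * (((n : ℝ) - 1) * lam ρ β ^ 12) +
        ((nearPlaquettes γ q).card * (K0 ρ 7 β * lam ρ β ^ 14) +
          q.support.card * (K0 ρ 25 β * lam ρ β ^ 50))) := by
  classical
  have hqN : q.support ⊆ cells 2 N := fun p hp => bary_mem_boxRegion.2 fun i => by
    have := hq p hp i; omega
  have hcγ : cornerEdges γ ⊆ γ.support := by unfold cornerEdges; exact Finset.filter_subset _ _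
  have hnq : nearPlaquettes γ q ⊆ q.support := by
    unfold nearPlaquettes; exact Finset.filter_subset _ _
  -- The membership proof is part of the event, so that the events can be indexed by plain
  -- plaquettes of `q`.
  set V : ℕ → Cell 2 → Set (Form 1 N (ZMod n)) := fun M p =>
    {σ | ∃ h : p ∈ cells 2 N, σ ∈ vortexEvent ⟨p, h⟩ M} with hV
  have hVp : ∀ M, ∀ p ∈ q.support, prob ρ N β (V M p) ≤ K0 ρ M β * lam ρ β ^ (2 * M) :=
    fun M p hp => (prob_mono ρ (fun σ hσ => hσ.2)).trans
      (prob_vortexEvent_le ρ hlam ⟨p, hqN hp⟩ M)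
  set C : Cell 1 → Set (Form 1 N (ZMod n)) := fun e =>
    {σ | ∃ g, g ≠ 0 ∧ σ.d.ConstAround e g} with hC
  set A : Set (Form 1 N (ZMod n)) := (⋃ e ∈ cornerEdges γ, C e) ∪
    ((⋃ p ∈ nearPlaquettes γ q, V 7 p) ∪ ⋃ p ∈ q.support, V 25 p) with hA
  rw [← expect_straight ρ hγ hγN hinner]
  refine (norm_expect_sub_le_prob ρ (A := A) (fun σ => (AddChar.norm_apply ρ _).le)
    (fun σ => (AddChar.norm_apply ρ _).le) fun σ hσ => ?_).trans ?_
  · simp only [hA, Set.mem_union, Set.mem_iUnion, not_or, not_exists] at hσ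
    obtain ⟨h1, h2, h3⟩ := hσ
    have heval : σ.eval γ = σ.d.eval q := by rw [Form.eval_d _ hqN, hqγ]
    change ρ (σ.eval γ) = _
    rw [heval, eval_eq_sum_circ hn hN hqγ h0 hγN hinner hq (Form.d_d σ)]
    · intro e he g hg
      by_contra hne
      exact h1 e he ⟨g, hne, hg⟩
    · intro p hp P hP hpP hirr
      by_contra hcard
      exact h2 p.1 hp ⟨p.2, P, hP, hpP, by omega, hirr⟩
    · intro p hp P hP hpP hirr
      by_contra hcard
      exact h3 p.1 hp ⟨p.2, P, hP, hpP, by omega, hirr⟩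
  · refine mul_le_mul_of_nonneg_left ?_ (by norm_num)
    refine (prob_union_le ρ _ _).trans (add_le_add ?_
      ((prob_union_le ρ _ _).trans (add_le_add ?_ ?_)))
    · exact prob_biUnion_le_card_mul ρ _ _ fun e he =>
        prob_constAround_ne_zero_le ρ ⟨e, hγN (hcγ he)⟩ (hinner e (hcγ he))
    · exact prob_biUnion_le_card_mul ρ _ _ fun p hp => hVp 7 p (hnq hp)
    · exact prob_biUnion_le_card_mul ρ _ _ fun p hp => hVp 25 p hp

end Events

end

end LatticeGauge

namespace LatticeGauge

noncomputable section

/-! ### Numerical estimates and conclusion -/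

section Final

/-- The boundary of one plaquette is a nonempty loop with a spanning surface, so the bound by `K1`
applies to an actual count. -/
lemma K1_nonneg : 0 ≤ K1 := by
  obtain ⟨p, hp⟩ := exists_coface (0, ⟨{0}, rfl⟩)
  have hb : boundary (Finsupp.single p 1) = boundaryCell p := by simp [boundary]
  have hloop : IsGeneralizedLoop (boundaryCell p) := by
    refine ⟨fun e => ?_, by rw [← hb, boundary_boundary]⟩
    by_cases h : boundaryCell p e = 0
    · exact Or.inr (Or.inl h)
    · rcases boundaryCell_eq_or h with h | h
      · exact Or.inr (Or.inr h)
      · exact Or.inl h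
  have hne : (boundaryCell p).support.Nonempty := ⟨_, Finsupp.mem_support_iff.2 hp⟩
  have h := card_nearPlaquettes_le hloop hb hne
  have hpos : (0 : ℝ) < (boundaryCell p).support.card := by exact_mod_cast Finset.card_pos.2 hne
  exact nonneg_of_mul_nonneg_left ((Nat.cast_nonneg _).trans h) hpos

variable {n : ℕ} [NeZero n] (ρ : AddChar (ZMod n) ℂ) {β β₀ : ℝ}

lemma K0_nonneg (hlam : 5 * ((n : ℝ) - 1) * lam ρ β ^ 2 < 1) (M : ℕ) : 0 ≤ K0 ρ M β := by
  have hn1 : (0 : ℝ) ≤ (n : ℝ) - 1 := sub_nonneg.2 (by exact_mod_cast NeZero.one_le)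
  exact div_nonneg (by positivity) (by linarith)

lemma CA_nonneg (hn : 2 ≤ n) (hρ : Function.Injective ρ)
    (hlam : 5 * ((n : ℝ) - 1) * lam ρ β ^ 2 < 1) : 0 ≤ CA ρ β₀ β := by
  have h1 := K0_nonneg ρ hlam
  have h2 := Kstar_pos ρ (β₀ := β₀) hn hρ
  have h3 := K1_nonneg
  have := h1 6; have := h1 7; have := h1 25
  unfold CA
  positivity

/-- The tangent of the exponential at one gives `e^(x/4) ≥ 2.7 x/4`, and `(4/2.7)⁴ < 5`. This is the
factor 5 in `CA`. -/
lemma pow_four_le_five_mul_exp {x : ℝ} (hx : 0 ≤ x) : x ^ 4 ≤ 5 * Real.exp x := by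
  have h1 : Real.exp 1 * (x / 4) ≤ Real.exp (x / 4) := by
    have := Real.add_one_le_exp (x / 4 - 1)
    rw [sub_add_cancel, Real.exp_sub, le_div_iff₀ (Real.exp_pos 1)] at this
    linarith
  have h2 : 2.7 * (x / 4) ≤ Real.exp (x / 4) :=
    (mul_le_mul_of_nonneg_right (by have := Real.exp_one_gt_d9; linarith) (by positivity)).trans h1
  have h3 : Real.exp x = Real.exp (x / 4) ^ 4 := by
    rw [← Real.exp_nat_mul]; congr 1; push_cast; ring
  have h4 := pow_le_pow_left₀ (by positivity) h2 4
  have h5 : 0 ≤ x ^ 4 := by positivity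
  rw [h3]
  nlinarith

lemma small_terms_le {a D : ℝ} (ha : 1 ≤ a) (hD0 : 0 < D) (hD1 : D ≤ 1) :
    a + 6 * (5 ^ 1 * a ^ 1 / D) * a ≤ 7 * (5 ^ 6 * a ^ 6 / D) / 2 := by
  have ha6 : a ^ 2 ≤ a ^ 6 := pow_le_pow_right₀ ha (by norm_num)
  have ha2 : a ≤ a ^ 2 := by nlinarith
  have e1 : a ≤ a / D := by
    rw [le_div_iff₀ hD0]
    nlinarith
  calc a + 6 * (5 ^ 1 * a ^ 1 / D) * a ≤ a / D + 6 * (5 ^ 1 * a ^ 1 / D) * a := by gcongr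
    _ = (a + 30 * a ^ 2) / D := by ring
    _ ≤ (109375 / 2 * a ^ 6) / D := by
      refine div_le_div_of_nonneg_right ?_ hD0.le
      linarith [sq_nonneg a]
    _ = 7 * (5 ^ 6 * a ^ 6 / D) / 2 := by ring

/-- The elementary inequality behind the final estimate, with `a = n - 1`, `L = λ(β)`, `K = K*`,
`u = 1 - θ(β)`, `l = ℓ` and `c = ℓ_c`. -/
lemma error_terms_le {a L K u l c k₁ : ℝ} (ha : 1 ≤ a) (hL : 0 < L) (hD : 5 * a * L ^ 2 < 1)
    (hK : 0 < K) (hKa : K ≤ 2 * a) (hu : 0 ≤ u) (huK : u ≤ K * L ^ 12) (hl : 0 < l) (hc : 0 ≤ c)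
    (hcl : c ≤ l) (hk₁ : 0 ≤ k₁) {κ : ℕ → ℝ}
    (hκ : ∀ M, κ M = 5 ^ M * a ^ M / (1 - 5 * a * L ^ 2)) :
    2 * (c * (a * L ^ 12) + (k₁ * l * (κ 7 * L ^ 14) + l ^ 4 * (κ 25 * L ^ 50))) +
        u * (c + l * (6 * (κ 1 * L ^ 2))) + l * u ^ 2 ≤
      (7 * κ 6 / (2 * K) + 2 * k₁ * κ 7 / K + 5 * κ 25 / (2 ^ 3 * K ^ 4) + 9 / 2) *
        Real.exp (2 * K * l * L ^ 12) * (Real.sqrt (c / l) + L ^ 2) := by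
  have hD0 : 0 < 1 - 5 * a * L ^ 2 := by linarith
  have hD1 : 1 - 5 * a * L ^ 2 ≤ 1 := by
    have : 0 ≤ 5 * a * L ^ 2 := by positivity
    linarith
  have hκ0 : ∀ M, 0 ≤ κ M := fun M => by rw [hκ]; positivity
  set x := 2 * K * l * L ^ 12 with hx
  set E := Real.exp x with hE
  set s := Real.sqrt (c / l) with hs
  have hx0 : 0 ≤ x := by positivity
  have hE0 : 0 < E := Real.exp_pos x
  have hxE : x ≤ E := by have := Real.add_one_le_exp x; linarith
  have hx4 : x ^ 4 ≤ 5 * E := pow_four_le_five_mul_exp hx0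
  have hs0 : 0 ≤ s := Real.sqrt_nonneg _
  -- A number in `[0, 1]` is at most its square root; this is where the square root in the bound
  -- comes from.
  have hcs : c ≤ s * l := by
    have h1 : c / l ≤ s := by
      have h0 : 0 ≤ c / l := by positivity
      have h2 : c / l ≤ 1 := (div_le_one hl).2 hcl
      exact Real.le_sqrt_of_sq_le (by nlinarith)
    exact (div_le_iff₀ hl).1 h1
  have hLlt : L ^ 2 < 1 := by nlinarith [sq_nonneg L]
  have hlx : l * L ^ 12 = x / (2 * K) := by rw [hx]; field_simp
  have hR : s ≤ s + L ^ 2 := by have := sq_nonneg L; linarith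
  have hR2 : L ^ 2 ≤ s + L ^ 2 := by linarith
  have hR0 : 0 ≤ s + L ^ 2 := by positivity
  have huE : u * l ≤ E / 2 := by
    have : u * l ≤ K * L ^ 12 * l := mul_le_mul_of_nonneg_right huK hl.le
    have e : K * L ^ 12 * l = x / 2 := by rw [hx]; ring
    linarith
  have hlE : l * L ^ 12 ≤ E / (2 * K) := by rw [hlx]; gcongr
  -- the corner edges
  have t1 : 2 * (c * (a * L ^ 12)) ≤ a / K * E * (s + L ^ 2) := by
    calc 2 * (c * (a * L ^ 12)) ≤ 2 * (s * l * (a * L ^ 12)) := by gcongr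
      _ = 2 * a * s * (l * L ^ 12) := by ring
      _ ≤ 2 * a * s * (E / (2 * K)) := by gcongr
      _ = a / K * E * s := by field_simp
      _ ≤ _ := by gcongr
  -- large vortices close to the loop
  have t2 : 2 * (k₁ * l * (κ 7 * L ^ 14)) ≤ 2 * k₁ * κ 7 / K * E * (s + L ^ 2) := by
    have := hκ0 7
    calc 2 * (k₁ * l * (κ 7 * L ^ 14)) = 2 * k₁ * κ 7 * L ^ 2 * (l * L ^ 12) := by ring
      _ ≤ 2 * k₁ * κ 7 * L ^ 2 * (E / (2 * K)) := by gcongr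
      _ ≤ 2 * k₁ * κ 7 * (s + L ^ 2) * (E / K) := by
          gcongr
          linarith
      _ = _ := by ring
  -- very large vortices
  have t3 : 2 * (l ^ 4 * (κ 25 * L ^ 50)) ≤ 5 * κ 25 / (2 ^ 3 * K ^ 4) * E * (s + L ^ 2) := by
    have := hκ0 25
    calc 2 * (l ^ 4 * (κ 25 * L ^ 50)) = 2 * κ 25 * L ^ 2 * (l * L ^ 12) ^ 4 := by ring
      _ = κ 25 / (2 ^ 3 * K ^ 4) * L ^ 2 * x ^ 4 := by rw [hlx]; field_simp
      _ ≤ κ 25 / (2 ^ 3 * K ^ 4) * (s + L ^ 2) * (5 * E) := by gcongr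
      _ = _ := by ring
  have t4 : u * c ≤ 1 / 2 * E * (s + L ^ 2) := by
    calc u * c ≤ u * (s * l) := by gcongr
      _ = u * l * s := by ring
      _ ≤ E / 2 * (s + L ^ 2) := by gcongr
      _ = _ := by ring
  have t5 : u * (l * (6 * (κ 1 * L ^ 2))) ≤ 6 * κ 1 * a / K * E * (s + L ^ 2) := by
    have := hκ0 1
    have h1 : 1 / 2 ≤ a / K := by rw [div_le_div_iff₀ (by norm_num) hK]; linarith
    calc u * (l * (6 * (κ 1 * L ^ 2))) = 6 * κ 1 * (u * l) * L ^ 2 := by ring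
      _ ≤ 6 * κ 1 * (E / 2) * (s + L ^ 2) := by gcongr
      _ = 6 * κ 1 * (1 / 2) * E * (s + L ^ 2) := by ring
      _ ≤ 6 * κ 1 * (a / K) * E * (s + L ^ 2) := by gcongr
      _ = _ := by ring
  have t6 : l * u ^ 2 ≤ 1 / 2 * E * (s + L ^ 2) := by
    -- From `u ≤ 2a L^12` and `5a L² < 1`, with plenty of room.
    have h1 : u ≤ L ^ 2 := by
      have h2 : L ^ 10 ≤ 1 := by
        rw [show L ^ 10 = (L ^ 2) ^ 5 by ring]
        exact pow_le_one₀ (by positivity) hLlt.le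
      calc u ≤ K * L ^ 12 := huK
        _ ≤ 2 * a * L ^ 12 := by gcongr
        _ = 2 * a * L ^ 2 * L ^ 10 := by ring
        _ ≤ 2 * a * L ^ 2 * (L ^ 2) := by
          have h3 : L ^ 10 ≤ L ^ 2 := by
            rw [show L ^ 10 = (L ^ 2) ^ 5 by ring]
            exact pow_le_of_le_one (by positivity) hLlt.le (by norm_num)
          gcongr
        _ ≤ 1 * L ^ 2 := by
          have : 0 ≤ a * L ^ 2 := by positivity
          refine mul_le_mul_of_nonneg_right ?_ (by positivity)
          linarith
        _ = L ^ 2 := one_mul _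
    calc l * u ^ 2 = u * l * u := by ring
      _ ≤ E / 2 * (s + L ^ 2) := by gcongr; linarith
      _ = _ := by ring
  -- The corner term and the nonconstant edges together are paid for by the first summand of the
  -- constant.
  have t7 : a / K + 6 * κ 1 * a / K ≤ 7 * κ 6 / (2 * K) := by
    have hle : a + 6 * κ 1 * a ≤ 7 * κ 6 / 2 := by
      rw [hκ 1, hκ 6]
      exact small_terms_le ha hD0 hD1
    calc a / K + 6 * κ 1 * a / K = (a + 6 * κ 1 * a) / K := by ring
      _ ≤ (7 * κ 6 / 2) / K := by gcongr
      _ = _ := by rw [div_div]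
  have t8 : (a / K + 6 * κ 1 * a / K) * (E * (s + L ^ 2)) ≤ 7 * κ 6 / (2 * K) * (E * (s + L ^ 2)) :=
    mul_le_mul_of_nonneg_right t7 (by positivity)
  -- Of the summand `9/2`, the bounds `t4` and `t6` use one half each; the rest is slack.
  have t9 : 0 ≤ 7 / 2 * E * (s + L ^ 2) := by positivity
  linarith

end Final

end

end LatticeGauge

theorem proposition7p1 {n : ℕ} [NeZero n] (hn : 2 ≤ n)
    (ρ : AddChar (ZMod n) ℂ) (hρ : Function.Injective ρ)
    (γ : LatticeGauge.Chain 1) (hγ : LatticeGauge.IsGeneralizedLoop γ)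
    (ℓ ℓc : ℕ) (hℓ : ℓ = γ.support.card) (hℓc : ℓc = (LatticeGauge.cornerEdges γ).card)
    (N : ℕ) (hN : 1 ≤ N)
    (hγN : γ.support ⊆ LatticeGauge.cells 1 N)
    (hcube : ∃ a : Fin 4 → ℤ, LatticeGauge.cube a ℓ ⊆ (LatticeGauge.box N : Set (Fin 4 → ℤ)) ∧
      ∀ e ∈ γ.support, LatticeGauge.Cell.IsIn e (LatticeGauge.cube a ℓ))
    -- every plaquette of `ℤ⁴` adjacent to an edge of `γ` is in `B_N`
    (hplaq : ∀ e ∈ γ.support, ∀ p : LatticeGauge.Cell 2,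
      LatticeGauge.boundaryCell p e ≠ 0 → p ∈ LatticeGauge.cells 2 N)
    (β₀ : ℝ) (hβ₀ : 0 < β₀)
    (hlam : ∀ β : ℝ, β₀ < β → 5 * ((n : ℝ) - 1) * LatticeGauge.lam ρ β ^ 2 < 1)
    (β : ℝ) (hβ : β₀ < β) :
    ‖LatticeGauge.expect ρ N β (LatticeGauge.wilson ρ γ) -
        (Real.exp (-(ℓ : ℝ) * (1 - LatticeGauge.theta ρ β)) : ℂ)‖ ≤
      LatticeGauge.CA ρ β₀ β *
        Real.exp (2 * LatticeGauge.Kstar ρ β₀ * ℓ * LatticeGauge.lam ρ β ^ 12) *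
          (Real.sqrt ((ℓc : ℝ) / ℓ) + LatticeGauge.lam ρ β ^ 2) := by
  have hlamβ := hlam β hβ
  rcases γ.support.eq_empty_or_nonempty with h0 | h0
  -- For the empty loop both terms on the left are one.
  · have hγ0 : γ = 0 := Finsupp.support_eq_empty.1 h0
    have hℓ0 : ℓ = 0 := by rw [hℓ, h0, Finset.card_empty]
    have hw : LatticeGauge.expect ρ N β (LatticeGauge.wilson ρ γ) = 1 := by
      have : LatticeGauge.wilson (N := N) ρ γ = fun _ => 1 := by
        funext σ
        simp [LatticeGauge.wilson, LatticeGauge.Form.eval, hγ0]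
      rw [this, LatticeGauge.expect_const]
    have hCA := LatticeGauge.CA_nonneg ρ (β₀ := β₀) hn hρ hlamβ
    rw [hw, hℓ0]
    simp only [Nat.cast_zero, neg_zero, zero_mul, Real.exp_zero, Complex.ofReal_one, sub_self,
      norm_zero]
    positivity
  · have ha : (1 : ℝ) ≤ (n : ℝ) - 1 := by
      have : (2 : ℝ) ≤ n := by exact_mod_cast hn
      linarith
    have hL := LatticeGauge.lam_pos ρ (β := β) hn
    have hu := (LatticeGauge.one_sub_theta_pos ρ (β := β) hn hρ).le
    have huK := LatticeGauge.one_sub_theta_le_Kstar ρ hn hβ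
    have hKpos := LatticeGauge.Kstar_pos ρ (β₀ := β₀) hn hρ
    have hKle := LatticeGauge.Kstar_le ρ (β₀ := β₀) hn
    -- Positivity of `θ` follows from `1 - θ ≤ 2(n-1)λ^12 ≤ 2(n-1)λ² < 1`.
    have hθ0 : 0 ≤ LatticeGauge.theta ρ β := by
      have h1 := LatticeGauge.one_sub_theta_le ρ (β := β)
      have h2 : LatticeGauge.lam ρ β ^ 2 ≤ 1 := by nlinarith [sq_nonneg (LatticeGauge.lam ρ β)]
      have h3 : LatticeGauge.lam ρ β ^ 12 ≤ LatticeGauge.lam ρ β ^ 2 := by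
        rw [show LatticeGauge.lam ρ β ^ 12 = (LatticeGauge.lam ρ β ^ 2) ^ 6 by ring]
        exact pow_le_of_le_one (by positivity) h2 (by norm_num)
      have h4 : 2 * ((n : ℝ) - 1) * LatticeGauge.lam ρ β ^ 12 ≤
          2 * ((n : ℝ) - 1) * LatticeGauge.lam ρ β ^ 2 :=
        mul_le_mul_of_nonneg_left h3 (by linarith)
      have h5 : 0 ≤ ((n : ℝ) - 1) * LatticeGauge.lam ρ β ^ 2 :=
        mul_nonneg (by linarith) (sq_nonneg _)
      linarith
    obtain ⟨q, hqγ, hqcard, hqb⟩ := LatticeGauge.exists_surface hγ.2 h0 hγN hplaq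
      (by obtain ⟨a, -, ha⟩ := hcube; exact ⟨a, by rwa [← hℓ]⟩)
    have hnear := LatticeGauge.card_nearPlaquettes_le hγ hqγ h0
    have e1 := LatticeGauge.norm_expect_wilson_sub_le ρ (β := β) hn hN hγ hqγ h0 hγN hplaq hqb hlamβ
    have e2 := LatticeGauge.norm_expect_theta_pow_sub_le ρ (N := N) hplaq hθ0 (by linarith) hlamβ
    have e3 := LatticeGauge.abs_pow_sub_exp_le hu (by linarith) ℓ
    rw [sub_sub_cancel] at e3
    rw [← hℓ] at hqcard hnear e2
    rw [← hℓc] at e1 e2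
    have hcl : ℓc ≤ ℓ := by
      have := LatticeGauge.card_straightEdges_add γ
      omega
    have hsl : (LatticeGauge.straightEdges γ).card ≤ ℓ := by
      have := LatticeGauge.card_straightEdges_add γ
      omega
    have hl0 : 0 < ℓ := by rw [hℓ]; exact Finset.card_pos.2 h0
    have hmain := LatticeGauge.error_terms_le (c := ℓc) (l := ℓ) ha hL hlamβ hKpos hKle hu huK
      (by exact_mod_cast hl0) (by positivity) (by exact_mod_cast hcl) LatticeGauge.K1_nonneg
      (κ := fun M => LatticeGauge.K0 ρ M β) (fun M => rfl)
    have hK0 := LatticeGauge.K0_nonneg ρ hlamβ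
    have m1 : ((LatticeGauge.nearPlaquettes γ q).card : ℝ) *
        (LatticeGauge.K0 ρ 7 β * LatticeGauge.lam ρ β ^ 14) ≤
        LatticeGauge.K1 * ℓ * (LatticeGauge.K0 ρ 7 β * LatticeGauge.lam ρ β ^ 14) :=
      mul_le_mul_of_nonneg_right hnear (mul_nonneg (hK0 7) (by positivity))
    have m2 : (q.support.card : ℝ) * (LatticeGauge.K0 ρ 25 β * LatticeGauge.lam ρ β ^ 50) ≤
        (ℓ : ℝ) ^ 4 * (LatticeGauge.K0 ρ 25 β * LatticeGauge.lam ρ β ^ 50) :=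
      mul_le_mul_of_nonneg_right (by exact_mod_cast hqcard) (mul_nonneg (hK0 25) (by positivity))
    have m3 : (1 - LatticeGauge.theta ρ β) * ((ℓc : ℝ) + (LatticeGauge.straightEdges γ).card *
          (6 * (LatticeGauge.K0 ρ 1 β * LatticeGauge.lam ρ β ^ 2))) ≤
        (1 - LatticeGauge.theta ρ β) * ((ℓc : ℝ) + ℓ *
          (6 * (LatticeGauge.K0 ρ 1 β * LatticeGauge.lam ρ β ^ 2))) := by
      refine mul_le_mul_of_nonneg_left (add_le_add le_rfl (mul_le_mul_of_nonneg_right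
        (by exact_mod_cast hsl) ?_)) hu
      have := hK0 1
      positivity
    have e3' : ‖((LatticeGauge.theta ρ β ^ ℓ : ℝ) : ℂ) -
        (Real.exp (-(ℓ : ℝ) * (1 - LatticeGauge.theta ρ β)) : ℂ)‖ ≤
        ℓ * (1 - LatticeGauge.theta ρ β) ^ 2 := by
      rw [← Complex.ofReal_sub, Complex.norm_real, Real.norm_eq_abs]
      exact e3
    refine le_trans ?_ hmain
    -- The path leads from the Wilson loop to the expectation of `θ` to the number of constant
    -- edges, then to `θ^ℓ`, then to the exponential.
    have tri := norm_sub_le_norm_sub_add_norm_sub (LatticeGauge.expect ρ N β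
      (LatticeGauge.wilson ρ γ)) ((LatticeGauge.theta ρ β ^ ℓ : ℝ) : ℂ)
      (Real.exp (-(ℓ : ℝ) * (1 - LatticeGauge.theta ρ β)) : ℂ)
    have tri' := norm_sub_le_norm_sub_add_norm_sub (LatticeGauge.expect ρ N β
      (LatticeGauge.wilson ρ γ)) (LatticeGauge.expect ρ N β
        (fun σ => (LatticeGauge.theta ρ β : ℂ) ^ LatticeGauge.constCount γ σ))
      ((LatticeGauge.theta ρ β ^ ℓ : ℝ) : ℂ)
    linarith
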